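/- **Source calculus $\lambda_{cs}^{\forall}$.** Locations are $Loc ::= \mathbf c \mid \mathbf s \mid l$ (client, server, location variable); $a,b$ range over $\{\mathbf c,\mathbf s\}$. The syntax is - types $A,B ::= base \mid A\xrightarrow{Loc}B \mid Clo(A) \mid A\times B \mid \alpha \mid \forall\alpha.A \mid \forall l.A \mid T\,A$; - values $V,W ::= x \mid (V,W) \mid clo(\overline W, F[\overline{Loc}\,\overline A]) \mid \Lambda\alpha.\mathsf{unit}\,V \mid \mathsf{unit}\,V \mid \mathsf{do}\,x\leftarrow M;N \mid req(V,W) \mid call(V,W) \mid gen(Loc,V,W)$; - terms $M,N ::= V \mid \mathsf{let}\,x=M\,\mathsf{in}\,N \mid \pi_i(V) \mid V(W) \mid V[A] \mid V[Loc]$. A program is a pair of function maps $(\Phi_{\mathbf c},\Phi_{\mathbf s})$ with bindings $F:\overline l\,\overline\alpha.\overline B.A=\overline l\,\overline\alpha.\overline z.o$, where $o$ is $\lambda x.M$ or $\Lambda l.V$ and the variables $\overline z$ (and $x$) are distinct; $\Phi(F[\overline{Loc}\,\overline A])=\overline z.\,o\{\overline{Loc}\,\overline A/\overline l\,\overline\alpha\}$.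 A type is *relocatable* if it is $base$, $\alpha$, $Clo(A)$, $\forall\alpha.A$, or a product of relocatable types. *Typing.* Judgments $\Gamma\vdash_{Loc}M:A$, with all type and location variables bound in $\Gamma$, are given by the usual rules for variables, $\mathsf{let}$, pairs, and projections and by the following rules. - $\mathsf{unit}\,V:T A$ if $V:A$ with $A$ relocatable; $(\mathsf{do}\,x\leftarrow M;N):T B$ if $M:T A$ and $N:T B$ under $x:A$. - $\Lambda\alpha.V':\forall\alpha.A$ if $\Gamma,\alpha\vdash_{Loc_0}V':A$ for every $Loc_0$; $V[B]:A\{B/\alpha\}$ if $V:\forall\alpha.A$ and $B$ is relocatable; $V[Loc']:A\{Loc'/l\}$ if $V:Clo(\forall l.A)$. - $V(W):B$ at $Loc$ if $V:Clo(A\xrightarrow{Loc}B)$ and $W:A$. - If $V:Clo(A\xrightarrow{Loc'}T B)$ and $W:A$ with $A$ relocatable, then $gen(Loc',V,W):T B$; moreover $req(V,W):T B$ at $\mathbf c$ if $Loc'=\mathbf s$, and $call(V,W):T B$ at $\mathbf s$ if $Loc'=\mathbf c$. - If $F:\overline l\,\overline\alpha.\overline B.A$ is a binding with $\overline B$ relocatable,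 $\theta=\{\overline{Loc}\,\overline A/\overline l\,\overline\alpha\}$ with $\overline A$ relocatable, and $\Gamma\vdash_{Loc}\overline W:\overline{B\theta}$, then $clo(\overline W,F[\overline{Loc}\,\overline A]):Clo(A\theta)$. The program is *well-formed* if $\Phi_{\mathbf c}\cup\Phi_{\mathbf s}$ is the union of three maps $\Phi^\circ_{\mathbf c},\Phi^\circ_{\mathbf s},\Phi_{common}$ with disjoint sets of names, and every binding has closed type and code and satisfies one of the following: $A=A_1\xrightarrow{Loc}A_2$, $o=\lambda x.M$, $\overline l,\overline\alpha,\overline{z:B},x:A_1\vdash_{Loc}M:A_2$, and the binding lies in $\Phi^\circ_a$ if $Loc=a$ and in $\Phi_{common}$ if $Loc$ is a variable; or $A=\forall l.A_1$, $o=\Lambda l.V$, $\overline l,\overline\alpha,\overline{z:B},l\vdash_{Loc}V:A_1$ for every $Loc$, and the binding lies in $\Phi_{common}$. (The closure rule looks bindings up in the same parts.) *Reduction.* Evaluation contexts are $E::=E_{let}\mid\mathsf{do}\,x\leftarrow E;M$ and $E_{let}::=[\,]\mid\mathsf{let}\,x=E_{let}\,\mathsf{in}\,M$; a stack $\Delta$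 is a list of evaluation contexts ($\epsilon$ is the empty one); configurations are $\langle M;\Delta_{\mathbf c}\mid\Delta_{\mathbf s}\rangle$ and $\langle\Delta_{\mathbf c}\mid M;\Delta_{\mathbf s}\rangle$. Local reductions at $a$, performed inside any $E$ on the running side, are $\mathsf{let}\,x=V\,\mathsf{in}\,M\to M\{V/x\}$; $\mathsf{do}\,x\leftarrow\mathsf{unit}\,V;M\to M\{V/x\}$; $\pi_i(V_1,V_2)\to V_i$; $(\Lambda\alpha.V)[A]\to V\{A/\alpha\}$; $clo(\overline W,F)(V)\to M\{\overline W/\overline z\}\{V/x\}$ if $\Phi_a(F)=\overline z.\lambda x.M$; $clo(\overline W,F)[b]\to V\{\overline W/\overline z\}\{b/l\}$ if $\Phi_a(F)=\overline z.\Lambda l.V$. The communication steps are - $\langle E[req(V,W)];\Delta_{\mathbf c}\mid\Delta_{\mathbf s}\rangle\to\langle E;\Delta_{\mathbf c}\mid V(W);\Delta_{\mathbf s}\rangle$ and $\langle\Delta_{\mathbf c}\mid E[call(V,W)];\Delta_{\mathbf s}\rangle\to\langle V(W);\Delta_{\mathbf c}\mid E;\Delta_{\mathbf s}\rangle$; -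 $\langle\mathsf{unit}\,V;\Delta_{\mathbf c}\mid E;\Delta_{\mathbf s}\rangle\to\langle\Delta_{\mathbf c}\mid E[\mathsf{unit}\,V];\Delta_{\mathbf s}\rangle$, $\langle E;\Delta_{\mathbf c}\mid\mathsf{unit}\,V;\Delta_{\mathbf s}\rangle\to\langle E[\mathsf{unit}\,V];\Delta_{\mathbf c}\mid\Delta_{\mathbf s}\rangle$, and $\langle\epsilon\mid\mathsf{unit}\,V;\epsilon\rangle\to\langle\mathsf{unit}\,V;\epsilon\mid\epsilon\rangle$; - inside $E$ on the running side, $gen(\mathbf c,V,W)$ becomes $V(W)$ at the client and $call(V,W)$ at the server, and $gen(\mathbf s,V,W)$ becomes $req(V,W)$ at the client and $V(W)$ at the server. **Target calculus $\lambda_{cs}$.** Values are $v,w::=x\mid(v,w)\mid Con\,\overline v\mid\mathsf{unit}\,v\mid\mathsf{do}\,x\leftarrow m;n$ and terms are $m,n::=v\mid\mathsf{let}\,x=m\,\mathsf{in}\,n\mid\pi_i(v)\mid v(w)\mid send\,v\mid receive\mid\mathsf{case}\,v\,\mathsf{of}\,\{\overline{Con\,\overline x\to m}\}$, with constructors $Client$,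 $Server$, $Apply$, $Ret$, and $Closure_F$ for function names $F$ (one writes $Closure\,\overline v\,F$ for $Closure_F\,\overline v$). Function maps send names to codes $\overline z.\lambda x.m$. The evaluation contexts $e$ have the same shape as before, and $\mathsf{do}\ send\,v;m$ denotes $\mathsf{do}\,x\leftarrow send\,v;m$ with $x$ unused. The expression $loop\,()$ is identified with its body $$\mathsf{do}\,x\leftarrow receive;\ \mathsf{case}\,x\,\mathsf{of}\,\{Apply\,f\,arg\to\mathsf{do}\,z\leftarrow f(arg);\ \mathsf{do}\ send\,(Ret\,z);\ loop\,();\quad Ret\,y\to\mathsf{unit}\,y\}.$$ Configurations are $\langle m_{\mathbf c}\mid m_{\mathbf s}\rangle$. While one side has the form $e_2[\mathsf{do}\,x\leftarrow receive;m_2]$, the other side may take a local step inside an evaluation context (the reductions for $\mathsf{let}$, $\mathsf{do}$, and $\pi_i$ as above; $(Closure\,\overline w\,F)(v)\to m\{\overline w/\overline z\}\{v/x\}$ if this side's map sends $F$ to $\overline z.\lambda x.m$; and the usual reduction of $\mathsf{case}$), or, if it has the form $e_1[\mathsf{do}\ send\,v;m_1]$, both sides step together to $e_1[m_1]$ and $e_2[m_2\{v/x\}]$.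 **Compilation.** $[\![l]\!]=x_l$, $[\![\mathbf c]\!]=Client$, $[\![\mathbf s]\!]=Server$. The map $[\![\cdot]\!]_a$ commutes with variables, pairs, projections, $\mathsf{unit}$, $\mathsf{do}$, $\mathsf{let}$ and $V(W)$, and - $[\![clo(\overline W,F[\overline{Loc}\,\overline A])]\!]_a=Closure\,(\overline{[\![Loc]\!]}\,\overline{[\![W]\!]_a})\,F$; - $[\![\Lambda\alpha.\mathsf{unit}\,V]\!]_a=[\![V]\!]_a$, $[\![V[A]]\!]_a=\mathsf{unit}\,[\![V]\!]_a$, $[\![V[Loc]]\!]_a=[\![V]\!]_a([\![Loc]\!])$; - $[\![req(V,W)]\!]_a=[\![call(V,W)]\!]_a=\mathsf{do}\ send\,(Apply\,[\![V]\!]_a\,[\![W]\!]_a);\ loop\,()$; - $[\![gen(Loc,V,W)]\!]_a=\mathsf{do}\,x\leftarrow\mathsf{case}\,[\![Loc]\!]\,\mathsf{of}\,\{Client\to m_1;Server\to m_2\};\ \mathsf{unit}\,x$, where $(m_1,m_2)$ is $([\![V(W)]\!]_{\mathbf c},[\![req(V,W)]\!]_{\mathbf c})$ for $a=\mathbf c$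 and $([\![call(V,W)]\!]_{\mathbf s},[\![V(W)]\!]_{\mathbf s})$ for $a=\mathbf s$. A code $\overline l\,\overline\alpha.\overline z.o$ compiles at $a$ to $\overline{x_l}\,\overline z.[\![o]\!]_a$, with $[\![\lambda x.M]\!]_a=\lambda x.[\![M]\!]_a$ and $[\![\Lambda l.V]\!]_a=\lambda x_l.[\![V]\!]_a$, and $(\Phi_{\mathbf c},\Phi_{\mathbf s})$ compiles to $([\![\Phi_{\mathbf c}]\!]_{\mathbf c},[\![\Phi_{\mathbf s}]\!]_{\mathbf s})$. **Theorem (semantic correctness of the compilation of $\lambda_{cs}^{\forall}$ into $\lambda_{cs}$).** Let $(\Phi_{\mathbf c},\Phi_{\mathbf s})$ be a well-formed program and $M$ a closed main term with $\emptyset\vdash_{\mathbf c}M:T A$ for some type $A$. If $\langle M;\epsilon\mid\epsilon\rangle\longrightarrow^*\langle\mathsf{unit}\,V;\epsilon\mid\epsilon\rangle$ in $\lambda_{cs}^{\forall}$ under $(\Phi_{\mathbf c},\Phi_{\mathbf s})$, then $$\langle[\![M]\!]_{\mathbf c}\mid loop\,()\rangle\longrightarrow^*\langle[\![\mathsf{unit}\,V]\!]_{\mathbf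 c}\mid loop\,()\rangle$$ in $\lambda_{cs}$ under the compiled program. -/

import Mathlib

namespace LamCS

/-! ## Locations, names, lists as substitutions -/

/-- The two location constants: the client **c** and the server **s**. -/
inductive Side where
  | c
  | s
deriving DecidableEq

/-- Locations: a constant, or a location variable (a de Bruijn index). -/
inductive Loc where
  | const (a : Side)
  | var (i : ℕ)
deriving DecidableEq

/-- Term variables are named; type and location variables are de Bruijn indices. -/
abbrev Name := ℕ

/-- Names of functions. -/
abbrev FName := ℕ

/-- The substitution that replaces the variables `0, …, n - 1` by the entries of a list of
length `n` and lowers the remaining variables by `n`. -/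
def ofList {α : Type} (v : ℕ → α) (as : List α) : ℕ → α :=
  fun i => as.getD i (v (i - as.length))

/-- No location variable `≥ nl`. -/
def Loc.WF (nl : ℕ) : Loc → Prop
  | .const _ => True
  | .var i => i < nl

def Loc.ren (ρ : ℕ → ℕ) : Loc → Loc
  | .const a => .const a
  | .var i => .var (ρ i)

def Loc.subst (σ : ℕ → Loc) : Loc → Loc
  | .const a => .const a
  | .var i => σ i

/-- A renaming under one more binder. -/
def liftRen (ρ : ℕ → ℕ) : ℕ → ℕ
  | 0 => 0
  | i + 1 => ρ i + 1

/-- A location substitution under one more location binder. -/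
def liftL (σ : ℕ → Loc) : ℕ → Loc
  | 0 => .var 0
  | i + 1 => (σ i).ren Nat.succ

/-! ## Types -/

inductive Ty where
  /-- `base` -/
  | base
  /-- `A →^Loc B` -/
  | fn (A : Ty) (L : Loc) (B : Ty)
  /-- `Clo(A)` -/
  | clo (A : Ty)
  /-- `A × B` -/
  | prod (A B : Ty)
  /-- a type variable -/
  | var (i : ℕ)
  /-- `∀ α. A` -/
  | allT (A : Ty)
  /-- `∀ l. A` -/
  | allL (A : Ty)
  /-- the monadic type `T A` -/
  | T (A : Ty)

namespace Ty

/-- Free location variables `< nl`, free type variables `< nt`. -/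
def WF : ℕ → ℕ → Ty → Prop
  | _, _, base => True
  | nl, nt, fn A L B => WF nl nt A ∧ L.WF nl ∧ WF nl nt B
  | nl, nt, clo A => WF nl nt A
  | nl, nt, prod A B => WF nl nt A ∧ WF nl nt B
  | _, nt, var i => i < nt
  | nl, nt, allT A => WF nl (nt + 1) A
  | nl, nt, allL A => WF (nl + 1) nt A
  | nl, nt, T A => WF nl nt A

/-- Renaming of location variables by `ρl` and of type variables by `ρt`. -/
def ren : (ℕ → ℕ) → (ℕ → ℕ) → Ty → Ty
  | _, _, base => base
  | ρl, ρt, fn A L B => fn (ren ρl ρt A) (L.ren ρl) (ren ρl ρt B)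
  | ρl, ρt, clo A => clo (ren ρl ρt A)
  | ρl, ρt, prod A B => prod (ren ρl ρt A) (ren ρl ρt B)
  | _, ρt, var i => var (ρt i)
  | ρl, ρt, allT A => allT (ren ρl (liftRen ρt) A)
  | ρl, ρt, allL A => allL (ren (liftRen ρl) ρt A)
  | ρl, ρt, T A => T (ren ρl ρt A)

/-- Weakening by one location variable. -/
def shiftL (A : Ty) : Ty := ren Nat.succ id A

/-- Weakening by one type variable. -/
def shiftT (A : Ty) : Ty := ren id Nat.succ A

/-- A type substitution under one more type binder. -/
def liftT (σ : ℕ → Ty) : ℕ → Ty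
  | 0 => var 0
  | i + 1 => (σ i).shiftT

/-- Simultaneous capture-avoiding substitution for location and type variables. -/
def subst : (ℕ → Loc) → (ℕ → Ty) → Ty → Ty
  | _, _, base => base
  | σl, σt, fn A L B => fn (subst σl σt A) (L.subst σl) (subst σl σt B)
  | σl, σt, clo A => clo (subst σl σt A)
  | σl, σt, prod A B => prod (subst σl σt A) (subst σl σt B)
  | _, σt, var i => σt i
  | σl, σt, allT A => allT (subst σl (liftT σt) A)
  | σl, σt, allL A => allL (subst (liftL σl) (fun i => (σt i).shiftL) A)
  | σl, σt, T A => T (subst σl σt A)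

/-- `A{B/α}` for the outermost bound variable `α` of `∀ α. A`. -/
def instT (A B : Ty) : Ty := A.subst Loc.var (ofList var [B])

/-- `A{L/l}` for the outermost bound variable `l` of `∀ l. A`. -/
def instL (A : Ty) (L : Loc) : Ty := A.subst (ofList Loc.var [L]) var

/-- The relocatable types. -/
def Reloc : Ty → Prop
  | base => True
  | clo _ => True
  | var _ => True
  | allT _ => True
  | prod A B => Reloc A ∧ Reloc B
  | fn _ _ _ => False
  | allL _ => False
  | T _ => False

end Ty

/-! ## Terms of the polymorphic calculus -/

mutual
  /-- Values. -/
  inductive Val where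
    | var (x : Name)
    | pair (V W : Val)
    /-- `clo(W̄, F[L̄ Ā])` -/
    | clo (Ws : List Val) (F : FName) (Ls : List Loc) (As : List Ty)
    /-- `Λ α. unit V`: the body of a type abstraction is always of the form `unit V`. -/
    | tabs (V : Val)
    | unit (V : Val)
    /-- `do x ← M; N` -/
    | bind (x : Name) (M N : Tm)
    | req (V W : Val)
    | call (V W : Val)
    | gen (L : Loc) (V W : Val)
  /-- Terms. -/
  inductive Tm where
    | val (V : Val)
    /-- `let x = M in N` -/
    | letin (x : Name) (M N : Tm)
    /-- `π₁(V)` is `proj 0 V`, and `π₂(V)` is `proj 1 V`. -/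
    | proj (i : Fin 2) (V : Val)
    | app (V W : Val)
    /-- `V[A]` -/
    | tapp (V : Val) (A : Ty)
    /-- `V[L]` -/
    | lapp (V : Val) (L : Loc)
end

/- Substitution `M{W/x}` of a value for a term variable. (Reduction only ever substitutes closed
values, so no renaming of bound term variables is needed.) -/
mutual
  def Val.subst : Val → Name → Val → Val
    | .var y, x, U => if x = y then U else .var y
    | .pair V W, x, U => .pair (V.subst x U) (W.subst x U)
    | .clo Ws F Ls As, x, U => .clo (Val.substList Ws x U) F Ls As
    | .tabs V, x, U => .tabs (V.subst x U)
    | .unit V, x, U => .unit (V.subst x U)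
    | .bind y M N, x, U => .bind y (M.subst x U) (if x = y then N else N.subst x U)
    | .req V W, x, U => .req (V.subst x U) (W.subst x U)
    | .call V W, x, U => .call (V.subst x U) (W.subst x U)
    | .gen L V W, x, U => .gen L (V.subst x U) (W.subst x U)
  def Val.substList : List Val → Name → Val → List Val
    | [], _, _ => []
    | V :: Vs, x, U => V.subst x U :: Val.substList Vs x U
  def Tm.subst : Tm → Name → Val → Tm
    | .val V, x, U => .val (V.subst x U)
    | .letin y M N, x, U => .letin y (M.subst x U) (if x = y then N else N.subst x U)
    | .proj i V, x, U => .proj i (V.subst x U)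
    | .app V W, x, U => .app (V.subst x U) (W.subst x U)
    | .tapp V A, x, U => .tapp (V.subst x U) A
    | .lapp V L, x, U => .lapp (V.subst x U) L
end

/-- `M{W̄/z̄}` -/
def Tm.substs (M : Tm) (zs : List Name) (Ws : List Val) : Tm :=
  (zs.zip Ws).foldl (fun N p => N.subst p.1 p.2) M

/-- `V{W̄/z̄}` -/
def Val.substs (V : Val) (zs : List Name) (Ws : List Val) : Val :=
  (zs.zip Ws).foldl (fun U p => U.subst p.1 p.2) V

/- Simultaneous substitution of locations and types for location and type variables. -/
mutual
  def Val.inst : (ℕ → Loc) → (ℕ → Ty) → Val → Val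
    | _, _, .var y => .var y
    | σl, σt, .pair V W => .pair (V.inst σl σt) (W.inst σl σt)
    | σl, σt, .clo Ws F Ls As =>
        .clo (Val.instList σl σt Ws) F (Ls.map (Loc.subst σl)) (As.map (Ty.subst σl σt))
    | σl, σt, .tabs V => .tabs (V.inst σl (Ty.liftT σt))
    | σl, σt, .unit V => .unit (V.inst σl σt)
    | σl, σt, .bind y M N => .bind y (M.inst σl σt) (N.inst σl σt)
    | σl, σt, .req V W => .req (V.inst σl σt) (W.inst σl σt)
    | σl, σt, .call V W => .call (V.inst σl σt) (W.inst σl σt)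
    | σl, σt, .gen L V W => .gen (L.subst σl) (V.inst σl σt) (W.inst σl σt)
  def Val.instList : (ℕ → Loc) → (ℕ → Ty) → List Val → List Val
    | _, _, [] => []
    | σl, σt, V :: Vs => V.inst σl σt :: Val.instList σl σt Vs
  def Tm.inst : (ℕ → Loc) → (ℕ → Ty) → Tm → Tm
    | σl, σt, .val V => .val (V.inst σl σt)
    | σl, σt, .letin y M N => .letin y (M.inst σl σt) (N.inst σl σt)
    | σl, σt, .proj i V => .proj i (V.inst σl σt)
    | σl, σt, .app V W => .app (V.inst σl σt) (W.inst σl σt)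
    | σl, σt, .tapp V A => .tapp (V.inst σl σt) (A.subst σl σt)
    | σl, σt, .lapp V L => .lapp (V.inst σl σt) (L.subst σl)
end

/-- `V{A/α}` for the variable `α` bound by the outermost type abstraction. -/
def Val.instT (V : Val) (A : Ty) : Val := V.inst Loc.var (ofList Ty.var [A])

/-- `V{L/l}` for the variable `l` bound by the location abstraction. -/
def Val.instL (V : Val) (L : Loc) : Val := V.inst (ofList Loc.var [L]) Ty.var

/-! ## Programs -/

/-- Open codes `λ x. M` and `Λ l. V`. In `Λ l. V` the variable `l` has index `0` in `V`. -/
inductive OpenCode where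
  | lam (x : Name) (M : Tm)
  | llam (V : Val)

/-- `OpenCode{L̄ Ā / l̄ ᾱ}` -/
def OpenCode.inst (Ls : List Loc) (As : List Ty) : OpenCode → OpenCode
  | lam x M => lam x (M.inst (ofList Loc.var Ls) (ofList Ty.var As))
  | llam V => llam (V.inst (liftL (ofList Loc.var Ls)) (fun i => (ofList Ty.var As i).shiftL))

/-- The data bound to a function name: the type `l̄ ᾱ. B̄. A` and the code
`l̄ ᾱ. z̄. OpenCode`, with `nl` location variables `l̄` and `nt` type variables `ᾱ`. -/
structure FunDef where
  nl : ℕ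
  nt : ℕ
  Bs : List Ty
  ty : Ty
  zs : List Name
  code : OpenCode

/-- Function maps. -/
abbrev FunMap := FName → Option FunDef

/-- A program: the client function map and the server function map. -/
structure Program where
  client : FunMap
  server : FunMap

def Program.at (P : Program) : Side → FunMap
  | .c => P.client
  | .s => P.server

/-- `Lookup Φ F Ls As zs o` says `Φ(F[L̄ Ā]) = z̄. o`. -/
def Lookup (Φ : FunMap) (F : FName) (Ls : List Loc) (As : List Ty)
    (zs : List Name) (o : OpenCode) : Prop :=
  ∃ d, Φ F = some d ∧ Ls.length = d.nl ∧ As.length = d.nt ∧ zs = d.zs ∧ o = d.code.inst Ls As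

/-! ## The type system -/

/-- A decomposition of the bindings of a program into client functions, server functions
and common functions. -/
structure Decomp where
  client : FunMap
  server : FunMap
  common : FunMap

/-- The part in which functions of location `L` live. -/
def Decomp.at (D : Decomp) : Loc → FunMap
  | .const .c => D.client
  | .const .s => D.server
  | .var _ => D.common

/-- Typing of function names: `FunTyping D nl nt F Ls As Bs A` is the judgment that
`F[L̄ Ā]` has type `B̄. A` in the presence of `nl` location and `nt` type variables. -/
inductive FunTyping (D : Decomp) (nl nt : ℕ) :
    FName → List Loc → List Ty → List Ty → Ty → Prop where
  | abs {F Ls As d A L B x M} :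
      D.at L F = some d → d.ty = .fn A L B → d.code = .lam x M →
      Ls.length = d.nl → As.length = d.nt →
      (∀ L' ∈ Ls, L'.WF nl) → (∀ A' ∈ As, A'.WF nl nt) →
      (∀ A' ∈ As, A'.Reloc) → (∀ B' ∈ d.Bs, B'.Reloc) →
      FunTyping D nl nt F Ls As
        (d.Bs.map (Ty.subst (ofList Loc.var Ls) (ofList Ty.var As)))
        (d.ty.subst (ofList Loc.var Ls) (ofList Ty.var As))
  | labs {F Ls As d A V} :
      D.common F = some d → d.ty = .allL A → d.code = .llam V →
      Ls.length = d.nl → As.length = d.nt →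
      (∀ L' ∈ Ls, L'.WF nl) → (∀ A' ∈ As, A'.WF nl nt) →
      (∀ A' ∈ As, A'.Reloc) → (∀ B' ∈ d.Bs, B'.Reloc) →
      FunTyping D nl nt F Ls As
        (d.Bs.map (Ty.subst (ofList Loc.var Ls) (ofList Ty.var As)))
        (d.ty.subst (ofList Loc.var Ls) (ofList Ty.var As))

/-- The part `x₁ : A₁, …, xₘ : Aₘ` of a typing environment; the most recent binding comes first. -/
abbrev Ctx := List (Name × Ty)

/-- `Typing D nl nt Γ L M A` is the judgment `Γ ⊢_L M : A`, where the environment consists of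
`nl` location variables, `nt` type variables and the bindings `Γ`. -/
inductive Typing (D : Decomp) : ℕ → ℕ → Ctx → Loc → Tm → Ty → Prop where
  | var {nl nt Γ L x A} :
      Γ.lookup x = some A → Typing D nl nt Γ L (.val (.var x)) A
  | letin {nl nt Γ L x M N A B} :
      Typing D nl nt Γ L M A → Typing D nl nt ((x, A) :: Γ) L N B →
      Typing D nl nt Γ L (.letin x M N) B
  | clo {nl nt Γ L Ws F Ls As Bs A} :
      FunTyping D nl nt F Ls As Bs A → Ws.length = Bs.length →
      (∀ p ∈ Ws.zip Bs, Typing D nl nt Γ L (.val p.1) p.2) →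
      Typing D nl nt Γ L (.val (.clo Ws F Ls As)) (.clo A)
  | proj1 {nl nt Γ L V A B} :
      Typing D nl nt Γ L (.val V) (.prod A B) → Typing D nl nt Γ L (.proj 0 V) A
  | proj2 {nl nt Γ L V A B} :
      Typing D nl nt Γ L (.val V) (.prod A B) → Typing D nl nt Γ L (.proj 1 V) B
  | pair {nl nt Γ L V W A B} :
      Typing D nl nt Γ L (.val V) A → Typing D nl nt Γ L (.val W) B →
      Typing D nl nt Γ L (.val (.pair V W)) (.prod A B)
  | tabs {nl nt Γ L V A} :
      (∀ L₀ : Loc, L₀.WF nl →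
        Typing D nl (nt + 1) (Γ.map fun p => (p.1, p.2.shiftT)) L₀ (.val (.unit V)) A) →
      Typing D nl nt Γ L (.val (.tabs V)) (.allT A)
  | tapp {nl nt Γ L V A B} :
      Typing D nl nt Γ L (.val V) (.allT A) → B.WF nl nt → B.Reloc →
      Typing D nl nt Γ L (.tapp V B) (A.instT B)
  | lapp {nl nt Γ L V A L'} :
      Typing D nl nt Γ L (.val V) (.clo (.allL A)) → L'.WF nl →
      Typing D nl nt Γ L (.lapp V L') (A.instL L')
  | unit {nl nt Γ L V A} :
      Typing D nl nt Γ L (.val V) A → A.Reloc →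
      Typing D nl nt Γ L (.val (.unit V)) (.T A)
  | bind {nl nt Γ L x M N A B} :
      Typing D nl nt Γ L M (.T A) → Typing D nl nt ((x, A) :: Γ) L N (.T B) →
      Typing D nl nt Γ L (.val (.bind x M N)) (.T B)
  | app {nl nt Γ L V W A B} :
      Typing D nl nt Γ L (.val V) (.clo (.fn A L B)) → Typing D nl nt Γ L (.val W) A →
      Typing D nl nt Γ L (.app V W) B
  | gen {nl nt Γ L L' V W A B} :
      Typing D nl nt Γ L (.val V) (.clo (.fn A L' (.T B))) → Typing D nl nt Γ L (.val W) A →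
      A.Reloc → L'.WF nl →
      Typing D nl nt Γ L (.val (.gen L' V W)) (.T B)
  | req {nl nt Γ V W A B} :
      Typing D nl nt Γ (.const .c) (.val V) (.clo (.fn A (.const .s) (.T B))) →
      Typing D nl nt Γ (.const .c) (.val W) A → A.Reloc →
      Typing D nl nt Γ (.const .c) (.val (.req V W)) (.T B)
  | call {nl nt Γ V W A B} :
      Typing D nl nt Γ (.const .s) (.val V) (.clo (.fn A (.const .c) (.T B))) →
      Typing D nl nt Γ (.const .s) (.val W) A → A.Reloc →
      Typing D nl nt Γ (.const .s) (.val (.call V W)) (.T B)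

/-- A binding `F : l̄ ᾱ. B̄. A = l̄ ᾱ. z̄. OpenCode` is well-typed and lies in the right part of the
decomposition. -/
inductive BindingOK (D : Decomp) (F : FName) (d : FunDef) : Prop where
  | abs {A L B x M} :
      d.ty = .fn A L B → d.code = .lam x M → D.at L F = some d →
      d.zs.length = d.Bs.length → (x :: d.zs).Nodup →
      d.ty.WF d.nl d.nt → (∀ B' ∈ d.Bs, B'.WF d.nl d.nt) →
      Typing D d.nl d.nt ((x, A) :: d.zs.zip d.Bs) L M B →
      BindingOK D F d
  | labs {A V} :
      d.ty = .allL A → d.code = .llam V → D.common F = some d →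
      d.zs.length = d.Bs.length → d.zs.Nodup →
      d.ty.WF d.nl d.nt → (∀ B' ∈ d.Bs, B'.WF d.nl d.nt) →
      (∀ L : Loc, L.WF (d.nl + 1) →
        Typing D (d.nl + 1) d.nt (d.zs.zip (d.Bs.map Ty.shiftL)) L (.val V) A) →
      BindingOK D F d

/-- The program `(Φ_c, Φ_s)` is well-formed through the decomposition `D`: the three parts have
disjoint sets of names, their union is `Φ_c ∪ Φ_s`, and every binding is well-typed. -/
structure Program.WF (P : Program) (D : Decomp) : Prop where
  disj_client_server : ∀ F, D.client F = none ∨ D.server F = none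
  disj_client_common : ∀ F, D.client F = none ∨ D.common F = none
  disj_server_common : ∀ F, D.server F = none ∨ D.common F = none
  union : ∀ F d, (P.client F = some d ∨ P.server F = some d) ↔
    (D.client F = some d ∨ D.server F = some d ∨ D.common F = some d)
  ok : ∀ F d, (P.client F = some d ∨ P.server F = some d) → BindingOK D F d

/-! ## The semantics of the polymorphic calculus -/

/-- Contexts `E_let`. -/
inductive ELet where
  | hole
  | letin (x : Name) (E : ELet) (M : Tm)

/-- Evaluation contexts `E`. -/
inductive ECtx where
  | ofLet (E : ELet)
  | bind (x : Name) (E : ECtx) (M : Tm)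

def ELet.plug : ELet → Tm → Tm
  | .hole, N => N
  | .letin x E M, N => .letin x (E.plug N) M

def ECtx.plug : ECtx → Tm → Tm
  | .ofLet E, N => E.plug N
  | .bind x E M, N => .val (.bind x (E.plug N) M)

abbrev Stack := List ECtx

/-- Configurations `⟨M;Δ_c | Δ_s⟩` and `⟨Δ_c | M;Δ_s⟩`. -/
inductive Conf where
  | client (M : Tm) (Δc Δs : Stack)
  | server (Δc : Stack) (M : Tm) (Δs : Stack)

/-- Local reduction with the function map `Φ`. -/
inductive LocalStep (Φ : FunMap) : Tm → Tm → Prop where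
  | letin {x V M} : LocalStep Φ (.letin x (.val V) M) (M.subst x V)
  | bind {x V M} : LocalStep Φ (.val (.bind x (.val (.unit V)) M)) (M.subst x V)
  | proj1 {V₁ V₂} : LocalStep Φ (.proj 0 (.pair V₁ V₂)) (.val V₁)
  | proj2 {V₁ V₂} : LocalStep Φ (.proj 1 (.pair V₁ V₂)) (.val V₂)
  | tapp {V A} : LocalStep Φ (.tapp (.tabs V) A) (.val (.unit (V.instT A)))
  | app {Ws F Ls As V zs x M} :
      Lookup Φ F Ls As zs (.lam x M) → Ws.length = zs.length →
      LocalStep Φ (.app (.clo Ws F Ls As) V) ((M.substs zs Ws).subst x V)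
  | lapp {Ws F Ls As b zs V} :
      Lookup Φ F Ls As zs (.llam V) → Ws.length = zs.length →
      LocalStep Φ (.lapp (.clo Ws F Ls As) (.const b)) (.val ((V.substs zs Ws).instL (.const b)))

/-- Reduction of configurations. -/
inductive Step (P : Program) : Conf → Conf → Prop where
  | localC {M M' E Δc Δs} :
      LocalStep P.client M M' →
      Step P (.client (ECtx.plug E M) Δc Δs) (.client (ECtx.plug E M') Δc Δs)
  | localS {M M' E Δc Δs} :
      LocalStep P.server M M' →
      Step P (.server Δc (ECtx.plug E M) Δs) (.server Δc (ECtx.plug E M') Δs)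
  | req {E V W Δc Δs} :
      Step P (.client (ECtx.plug E (.val (.req V W))) Δc Δs)
        (.server (E :: Δc) (.app V W) Δs)
  | call {E V W Δc Δs} :
      Step P (.server Δc (ECtx.plug E (.val (.call V W))) Δs)
        (.client (.app V W) Δc (E :: Δs))
  | unitC {V E Δc Δs} :
      Step P (.client (.val (.unit V)) Δc (E :: Δs))
        (.server Δc (E.plug (.val (.unit V))) Δs)
  | unitS {V E Δc Δs} :
      Step P (.server (E :: Δc) (.val (.unit V)) Δs)
        (.client (E.plug (.val (.unit V))) Δc Δs)
  | unitSE {V} :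
      Step P (.server [] (.val (.unit V)) []) (.client (.val (.unit V)) [] [])
  | genCC {E V W Δc Δs} :
      Step P (.client (ECtx.plug E (.val (.gen (.const .c) V W))) Δc Δs)
        (.client (ECtx.plug E (.app V W)) Δc Δs)
  | genSC {E V W Δc Δs} :
      Step P (.client (ECtx.plug E (.val (.gen (.const .s) V W))) Δc Δs)
        (.client (ECtx.plug E (.val (.req V W))) Δc Δs)
  | genCS {E V W Δc Δs} :
      Step P (.server Δc (ECtx.plug E (.val (.gen (.const .c) V W))) Δs)
        (.server Δc (ECtx.plug E (.val (.call V W))) Δs)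
  | genSS {E V W Δc Δs} :
      Step P (.server Δc (ECtx.plug E (.val (.gen (.const .s) V W))) Δs)
        (.server Δc (ECtx.plug E (.app V W)) Δs)

/-! ## The untyped calculus -/

/-- Variables of the untyped calculus: the term variables `x` of the polymorphic calculus, and a
variable `x_l` (also written `z_l`) for every location variable `l`. -/
inductive UVar where
  | tm (x : Name)
  | loc (l : ℕ)
deriving DecidableEq

/-- Data constructors; `Closure v̄ F` is the constructor `closure F` applied to `v̄`. -/
inductive Con where
  | client
  | server
  | apply
  | ret
  | closure (F : FName)
deriving DecidableEq

/-- Communication primitives. -/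
inductive Prim where
  | send
  | receive
deriving DecidableEq

mutual
  inductive UVal where
    | var (x : UVar)
    | pair (v w : UVal)
    | con (k : Con) (vs : List UVal)
    | unit (v : UVal)
    | bind (x : UVar) (m n : UTm)
    /-- `loop ()`. It stands for its body, which is a value of the form `do x ← receive; m`. -/
    | loop
  inductive UTm where
    | val (v : UVal)
    | letin (x : UVar) (m n : UTm)
    | proj (i : Fin 2) (v : UVal)
    | app (v w : UVal)
    | prim (p : Prim) (vs : List UVal)
    | case (v : UVal) (brs : Branches)
  /-- The branches `k₁ x̄₁ → m₁; …; kₙ x̄ₙ → mₙ` of a case term. -/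
  inductive Branches where
    | nil
    | cons (k : Con) (xs : List UVar) (m : UTm) (rest : Branches)
end

mutual
  def UVal.subst : UVal → UVar → UVal → UVal
    | .var y, x, u => if x = y then u else .var y
    | .pair v w, x, u => .pair (v.subst x u) (w.subst x u)
    | .con k vs, x, u => .con k (UVal.substList vs x u)
    | .unit v, x, u => .unit (v.subst x u)
    | .bind y m n, x, u => .bind y (m.subst x u) (if x = y then n else n.subst x u)
    | .loop, _, _ => .loop
  termination_by structural v => v
  def UVal.substList : List UVal → UVar → UVal → List UVal
    | [], _, _ => []
    | v :: vs, x, u => v.subst x u :: UVal.substList vs x u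
  def UTm.subst : UTm → UVar → UVal → UTm
    | .val v, x, u => .val (v.subst x u)
    | .letin y m n, x, u => .letin y (m.subst x u) (if x = y then n else n.subst x u)
    | .proj i v, x, u => .proj i (v.subst x u)
    | .app v w, x, u => .app (v.subst x u) (w.subst x u)
    | .prim p vs, x, u => .prim p (UVal.substList vs x u)
    | .case v brs, x, u => .case (v.subst x u) (brs.subst x u)
  def Branches.subst : Branches → UVar → UVal → Branches
    | .nil, _, _ => .nil
    | .cons k xs m rest, x, u =>
        .cons k xs (if x ∈ xs then m else m.subst x u) (rest.subst x u)
end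

/-- `m{v̄/x̄}` -/
def UTm.substs (m : UTm) (xs : List UVar) (vs : List UVal) : UTm :=
  (xs.zip vs).foldl (fun n p => n.subst p.1 p.2) m

/-- The variable `x` is not used in `m`. -/
def UTm.Unused (x : UVar) (m : UTm) : Prop := ∀ v, m.subst x v = m

/-- The branch for a constructor. -/
def Branches.find (k : Con) : Branches → Option (List UVar × UTm)
  | .nil => none
  | .cons k' xs m rest => if k = k' then some (xs, m) else rest.find k

/-- Untyped codes `z̄. λ x. m`. -/
structure UFun where
  zs : List UVar
  x : UVar
  body : UTm

abbrev UFunMap := FName → Option UFun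

structure UProgram where
  client : UFunMap
  server : UFunMap

/-- `do send v; m` -/
def sendThen (v : UVal) (m : UTm) : UVal := .bind (.tm 0) (.prim .send [v]) m

/-- The term after `do x ← receive` in the body of `loop`, where `x` is `UVar.tm 0`:
`case x of { Apply f arg → do z ← f(arg); do send (Ret z); loop (); Ret y → unit y }`. -/
def loopCase : UTm :=
  .case (.var (.tm 0))
    (.cons .apply [.tm 1, .tm 2]
      (.val (.bind (.tm 3) (.app (.var (.tm 1)) (.var (.tm 2)))
        (.val (sendThen (.con .ret [.var (.tm 3)]) (.val .loop)))))
    (.cons .ret [.tm 4] (.val (.unit (.var (.tm 4))))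
    .nil))

/-- `Receives w x m`: the value `w` is `do x ← receive; m`, where `loop ()` is identified with
its body. -/
inductive Receives : UVal → UVar → UTm → Prop where
  | receive {x m} : Receives (.bind x (.prim .receive []) m) x m
  | loop : Receives .loop (.tm 0) loopCase

/-- Contexts `e_let`. -/
inductive UELet where
  | hole
  | letin (x : UVar) (e : UELet) (m : UTm)

/-- Evaluation contexts `e`. -/
inductive UECtx where
  | ofLet (e : UELet)
  | bind (x : UVar) (e : UECtx) (m : UTm)

def UELet.plug : UELet → UTm → UTm
  | .hole, n => n
  | .letin x e m, n => .letin x (e.plug n) m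

def UECtx.plug : UECtx → UTm → UTm
  | .ofLet e, n => e.plug n
  | .bind x e m, n => .val (.bind x (e.plug n) m)

/-- Configurations `⟨m_c | m_s⟩`. -/
structure UConf where
  client : UTm
  server : UTm

/-- Local reduction with the function map `φ`. -/
inductive ULocalStep (φ : UFunMap) : UTm → UTm → Prop where
  | letin {x v m} : ULocalStep φ (.letin x (.val v) m) (m.subst x v)
  | bind {x v m} : ULocalStep φ (.val (.bind x (.val (.unit v)) m)) (m.subst x v)
  | proj1 {v₁ v₂} : ULocalStep φ (.proj 0 (.pair v₁ v₂)) (.val v₁)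
  | proj2 {v₁ v₂} : ULocalStep φ (.proj 1 (.pair v₁ v₂)) (.val v₂)
  | app {F f ws v} :
      φ F = some f → ws.length = f.zs.length →
      ULocalStep φ (.app (.con (.closure F) ws) v) ((f.body.substs f.zs ws).subst f.x v)
  | case {k vs brs xs m} :
      brs.find k = some (xs, m) → vs.length = xs.length →
      ULocalStep φ (.case (.con k vs) brs) (m.substs xs vs)

/-- Reduction of configurations: one side takes a local step while the other side is waiting to
receive, or one side sends a value to the other side. -/
inductive UStep (p : UProgram) : UConf → UConf → Prop where
  | localC {m m' e₁ e₂ w x n} :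
      ULocalStep p.client m m' → Receives w x n →
      UStep p ⟨UECtx.plug e₁ m, UECtx.plug e₂ (.val w)⟩ ⟨UECtx.plug e₁ m', UECtx.plug e₂ (.val w)⟩
  | localS {m m' e₁ e₂ w x n} :
      ULocalStep p.server m m' → Receives w x n →
      UStep p ⟨UECtx.plug e₁ (.val w), UECtx.plug e₂ m⟩ ⟨UECtx.plug e₁ (.val w), UECtx.plug e₂ m'⟩
  | commCS {e₁ e₂ y v m₁ w x m₂} :
      UTm.Unused y m₁ → Receives w x m₂ →
      UStep p
        ⟨UECtx.plug e₁ (.val (.bind y (.prim .send [v]) m₁)), UECtx.plug e₂ (.val w)⟩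
        ⟨UECtx.plug e₁ m₁, UECtx.plug e₂ (m₂.subst x v)⟩
  | commSC {e₁ e₂ y v m₁ w x m₂} :
      Receives w x m₁ → UTm.Unused y m₂ →
      UStep p
        ⟨UECtx.plug e₁ (.val w), UECtx.plug e₂ (.val (.bind y (.prim .send [v]) m₂))⟩
        ⟨UECtx.plug e₁ (m₁.subst x v), UECtx.plug e₂ m₂⟩

/-! ## The compilation -/

/-- `⟦L⟧` -/
def Loc.comp : Loc → UVal
  | .const .c => .con .client []
  | .const .s => .con .server []
  | .var l => .var (.loc l)

/-- `if(v, m₁, m₂)` -/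
def ifClient (v : UVal) (m₁ m₂ : UTm) : UTm :=
  .case v (.cons .client [] m₁ (.cons .server [] m₂ .nil))

/-- `do x ← m; unit x` -/
def bindUnit (m : UTm) : UVal := .bind (.tm 0) m (.val (.unit (.var (.tm 0))))

/-- `do send (Apply v w); loop ()`, the compilation of `req(V, W)` and `call(V, W)`. -/
def remoteCall (v w : UVal) : UVal := sendThen (.con .apply [v, w]) (.val .loop)

/-- The compilation of `gen(L, V, W)` at a location, from the compilations of `L`, `V`, `W`. -/
def genCall : Side → UVal → UVal → UVal → UVal
  | .c, l, v, w => bindUnit (ifClient l (.app v w) (.val (remoteCall v w)))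
  | .s, l, v, w => bindUnit (ifClient l (.val (remoteCall v w)) (.app v w))

mutual
  /-- `⟦V⟧_a` -/
  def Val.comp (a : Side) : Val → UVal
    | .var x => .var (.tm x)
    | .pair V W => .pair (V.comp a) (W.comp a)
    | .clo Ws F Ls _ => .con (.closure F) (Ls.map Loc.comp ++ Val.compList a Ws)
    | .tabs V => V.comp a
    | .unit V => .unit (V.comp a)
    | .bind x M N => .bind (.tm x) (M.comp a) (N.comp a)
    | .req V W => remoteCall (V.comp a) (W.comp a)
    | .call V W => remoteCall (V.comp a) (W.comp a)
    | .gen L V W => genCall a L.comp (V.comp a) (W.comp a)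
  def Val.compList (a : Side) : List Val → List UVal
    | [] => []
    | V :: Vs => V.comp a :: Val.compList a Vs
  /-- `⟦M⟧_a` -/
  def Tm.comp (a : Side) : Tm → UTm
    | .val V => .val (V.comp a)
    | .letin x M N => .letin (.tm x) (M.comp a) (N.comp a)
    | .proj i V => .proj i (V.comp a)
    | .app V W => .app (V.comp a) (W.comp a)
    | .tapp V _ => .val (.unit (V.comp a))
    | .lapp V L => .app (V.comp a) L.comp
end

/-- `⟦l̄ ᾱ. z̄. OpenCode⟧_a = z̄_l z̄. ⟦OpenCode⟧_a`. In `Λ l. V` the variable `l` has index `0`,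
and the variables `l̄` have the indices `1, …, nl`. -/
def FunDef.comp (a : Side) (d : FunDef) : UFun :=
  match d.code with
  | .lam x M =>
      { zs := (List.range d.nl).map UVar.loc ++ d.zs.map UVar.tm
        x := .tm x
        body := M.comp a }
  | .llam V =>
      { zs := (List.range d.nl).map (fun i => UVar.loc (i + 1)) ++ d.zs.map UVar.tm
        x := .loc 0
        body := .val (V.comp a) }

/-- `⟦Φ_c, Φ_s⟧ = ⟦Φ_c⟧_c, ⟦Φ_s⟧_s` -/
def Program.comp (P : Program) : UProgram where
  client F := (P.client F).map (FunDef.comp .c)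
  server F := (P.server F).map (FunDef.comp .s)

end LamCS

namespace LamCS

/-! ### Substitution calculus for locations and types -/

-- A step-by-step simulation fails. The source may reduce a monadic value while it still sits in a
-- `let`: in `let y = gen(..) in N` the `gen` becomes `V(W)`, which is then reduced in place. The
-- compiled `gen` is `do x ← case ..; unit x`, and no evaluation context of the target reaches below
-- a `do` that lies inside a `let`. The proof therefore passes through a big-step semantics that
-- delays such work: `Ev` evaluates terms to values and treats monadic values as inert, and `RunVal`
-- runs a monadic value when its result is demanded.
--
-- From small steps to big steps: `ConfRun.of_step` shows that big-step evaluation of configurations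
-- is closed under backward reduction, and `run_of_steps` iterates this from the final
-- configuration. The difficulty is again work done early. The relation `Forced` compares a term in
-- which closed monadic values have been reduced in advance with the term in which they have not.
-- Pure redexes never inspect monadic values, so evaluation respects `Forced`. By
-- `Typing.eq_of_forced` the relation is equality on values of relocatable type, since such values
-- contain no monadic subvalue. Results under `unit` and arguments of remote calls are relocatable,
-- so delaying computations changes neither (`Forced.runVal`).
--
-- From big steps to the target: types are erased, and locations become values passed as leading
-- arguments of closures. Each pure redex compiles to at most one target step (`PureStep.comp`), so
-- `Ev.simulate` and `RunVal.simulate` follow by induction on the evaluation. During the whole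
-- simulation the idle side waits in `loop ()`. A remote call hands control over by `Apply` and
-- takes it back by `Ret` (`simulate_remoteCall`). The two sides compile a transmitted value
-- identically, because only `gen` compiles differently at the two sides and movable values contain
-- no `gen` (`Movable.comp_eq`).
--
-- All of this relies on subject reduction. There the central fact is that a value of relocatable
-- type is typable at every location as soon as it is typable at one (`Typing.relocate`).

@[simp] theorem Loc.ren_id (L : Loc) : L.ren id = L := by cases L <;> rfl

@[simp] theorem Loc.subst_var (L : Loc) : L.subst Loc.var = L := by cases L <;> rfl

theorem Loc.ren_subst (L : Loc) (ρ : ℕ → ℕ) (σ : ℕ → Loc) :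
    (L.ren ρ).subst σ = L.subst (fun i => σ (ρ i)) := by cases L <;> rfl

theorem Loc.subst_ren (L : Loc) (σ : ℕ → Loc) (ρ : ℕ → ℕ) :
    (L.subst σ).ren ρ = L.subst (fun i => (σ i).ren ρ) := by cases L <;> rfl

theorem Loc.subst_subst (L : Loc) (σ τ : ℕ → Loc) :
    (L.subst σ).subst τ = L.subst (fun i => (σ i).subst τ) := by cases L <;> rfl

theorem Loc.subst_congr {L : Loc} {nl : ℕ} {σ σ' : ℕ → Loc} (hL : L.WF nl)
    (h : ∀ i < nl, σ i = σ' i) : L.subst σ = L.subst σ' := by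
  cases L with
  | const a => rfl
  | var i => exact h i hL

theorem Loc.WF.subst {L : Loc} {nl nl' : ℕ} {σ : ℕ → Loc} (hL : L.WF nl)
    (h : ∀ i < nl, (σ i).WF nl') : (L.subst σ).WF nl' := by
  cases L with
  | const a => trivial
  | var i => exact h i hL

theorem Loc.WF.mono {L : Loc} {nl nl' : ℕ} (hL : L.WF nl) (h : nl ≤ nl') : L.WF nl' := by
  cases L with
  | const a => trivial
  | var i => exact lt_of_lt_of_le (show i < nl from hL) h

theorem Loc.WF.ren_succ {L : Loc} {nl : ℕ} (hL : L.WF nl) : (L.ren Nat.succ).WF (nl + 1) := by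
  cases L with
  | const a => trivial
  | var i => exact Nat.succ_lt_succ hL

theorem Loc.WF.eq_const {L : Loc} (hL : L.WF 0) : ∃ a, L = .const a := by
  cases L with
  | const a => exact ⟨a, rfl⟩
  | var i => exact absurd hL (Nat.not_lt_zero i)

theorem ofList_of_lt {α : Type} (v : ℕ → α) (as : List α) {i : ℕ} (h : i < as.length) :
    ofList v as i = as[i] := by
  simp [ofList, h]

@[simp] theorem ofList_singleton_succ {α : Type} (v : ℕ → α) (a : α) (i : ℕ) :
    ofList v [a] (i + 1) = v i := by
  simp [ofList]

theorem liftL_var : liftL Loc.var = Loc.var := by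
  funext i; cases i <;> rfl

namespace Ty

theorem ren_eq_subst (A : Ty) (ρl ρt : ℕ → ℕ) :
    A.ren ρl ρt = A.subst (fun i => .var (ρl i)) (fun i => .var (ρt i)) := by
  have hL : ∀ (L : Loc) (ρ : ℕ → ℕ), L.ren ρ = L.subst (fun i => .var (ρ i)) := by
    intro L ρ; cases L <;> rfl
  have hlL : ∀ ρ : ℕ → ℕ, (fun i => Loc.var (liftRen ρ i)) = liftL (fun i => .var (ρ i)) := by
    intro ρ; funext i; cases i <;> rfl
  have hlT : ∀ ρ : ℕ → ℕ, (fun i => Ty.var (liftRen ρ i)) = liftT (fun i => .var (ρ i)) := by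
    intro ρ; funext i; cases i <;> rfl
  induction A generalizing ρl ρt with
  | base => rfl
  | var i => rfl
  | fn A L B ihA ihB => simp only [ren, subst, ihA, ihB, hL]
  | clo A ih => simp only [ren, subst, ih]
  | T A ih => simp only [ren, subst, ih]
  | prod A B ihA ihB => simp only [ren, subst, ihA, ihB]
  | allT A ih => simp only [ren, subst, ih, hlT]
  | allL A ih => simp only [ren, subst, ih, hlL]; rfl

theorem ren_subst (A : Ty) (ρl ρt : ℕ → ℕ) (σl : ℕ → Loc) (σt : ℕ → Ty) :
    (A.ren ρl ρt).subst σl σt = A.subst (fun i => σl (ρl i)) (fun i => σt (ρt i)) := by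
  have hlL : ∀ (σ : ℕ → Loc) (ρ : ℕ → ℕ),
      (fun i => liftL σ (liftRen ρ i)) = liftL (fun i => σ (ρ i)) := by
    intro σ ρ; funext i; cases i <;> rfl
  have hlT : ∀ (σ : ℕ → Ty) (ρ : ℕ → ℕ),
      (fun i => liftT σ (liftRen ρ i)) = liftT (fun i => σ (ρ i)) := by
    intro σ ρ; funext i; cases i <;> rfl
  induction A generalizing ρl ρt σl σt with
  | base => rfl
  | var i => rfl
  | fn A L B ihA ihB => simp only [ren, subst, ihA, ihB, Loc.ren_subst]
  | clo A ih => simp only [ren, subst, ih]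
  | T A ih => simp only [ren, subst, ih]
  | prod A B ihA ihB => simp only [ren, subst, ihA, ihB]
  | allT A ih => simp only [ren, subst, ih, hlT]
  | allL A ih => simp only [ren, subst, ih, hlL]

theorem ren_ren (A : Ty) (ρl ρt ρl' ρt' : ℕ → ℕ) :
    (A.ren ρl ρt).ren ρl' ρt' = A.ren (fun i => ρl' (ρl i)) (fun i => ρt' (ρt i)) := by
  rw [ren_eq_subst, ren_subst, ren_eq_subst A]

theorem subst_ren (A : Ty) (σl : ℕ → Loc) (σt : ℕ → Ty) (ρl ρt : ℕ → ℕ) :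
    (A.subst σl σt).ren ρl ρt
      = A.subst (fun i => (σl i).ren ρl) (fun i => (σt i).ren ρl ρt) := by
  have hlL : ∀ (σ : ℕ → Loc) (ρ : ℕ → ℕ),
      (fun i => (liftL σ i).ren (liftRen ρ)) = liftL (fun i => (σ i).ren ρ) := by
    intro σ ρ; funext i
    cases i with
    | zero => rfl
    | succ i => simp only [liftL]; cases σ i <;> rfl
  have hlT : ∀ (σ : ℕ → Ty) (ρl ρ : ℕ → ℕ),
      (fun i => (liftT σ i).ren ρl (liftRen ρ)) = liftT (fun i => (σ i).ren ρl ρ) := by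
    intro σ ρl ρ; funext i
    cases i with
    | zero => rfl
    | succ i => simp only [liftT, shiftT, ren_ren]; rfl
  induction A generalizing ρl ρt σl σt with
  | base => rfl
  | var i => rfl
  | fn A L B ihA ihB => simp only [ren, subst, ihA, ihB, Loc.subst_ren]
  | clo A ih => simp only [ren, subst, ih]
  | T A ih => simp only [ren, subst, ih]
  | prod A B ihA ihB => simp only [ren, subst, ihA, ihB]
  | allT A ih => simp only [ren, subst, ih, hlT]
  | allL A ih => simp only [ren, subst, ih, hlL, shiftL, ren_ren]; rfl

theorem shiftT_subst (A : Ty) (σl : ℕ → Loc) (σt : ℕ → Ty) :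
    A.shiftT.subst σl (liftT σt) = (A.subst σl σt).shiftT := by
  simp only [shiftT, ren_subst, subst_ren, Loc.ren_id]; rfl

theorem shiftL_subst (A : Ty) (σl : ℕ → Loc) (σt : ℕ → Ty) :
    A.shiftL.subst (liftL σl) (fun i => (σt i).shiftL) = (A.subst σl σt).shiftL := by
  simp only [shiftL, ren_subst, subst_ren]; rfl

/-- Under a binder both substitutions are lifted, so the induction needs lifting to commute with
composition. This is the commutation of shifts with substitution, which is why the laws for
renamings come earlier. -/
theorem subst_subst (A : Ty) (σl τl : ℕ → Loc) (σt τt : ℕ → Ty) :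
    (A.subst σl σt).subst τl τt
      = A.subst (fun i => (σl i).subst τl) (fun i => (σt i).subst τl τt) := by
  have hlL : ∀ (σ τ : ℕ → Loc),
      (fun i => (liftL σ i).subst (liftL τ)) = liftL (fun i => (σ i).subst τ) := by
    intro σ τ; funext i
    cases i with
    | zero => rfl
    | succ i => simp only [liftL]; cases σ i <;> rfl
  have hlT : ∀ (σ : ℕ → Ty) (τl : ℕ → Loc) (τ : ℕ → Ty),
      (fun i => (liftT σ i).subst τl (liftT τ)) = liftT (fun i => (σ i).subst τl τ) := by
    intro σ τl τ; funext i
    cases i with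
    | zero => rfl
    | succ i => simp only [liftT, shiftT_subst]
  induction A generalizing σl τl σt τt with
  | base => rfl
  | var i => rfl
  | fn A L B ihA ihB => simp only [subst, ihA, ihB, Loc.subst_subst]
  | clo A ih => simp only [subst, ih]
  | T A ih => simp only [subst, ih]
  | prod A B ihA ihB => simp only [subst, ihA, ihB]
  | allT A ih => simp only [subst, ih, hlT]
  | allL A ih => simp only [subst, ih, hlL, shiftL_subst]

theorem subst_congr {A : Ty} {nl nt : ℕ} {σl σl' : ℕ → Loc} {σt σt' : ℕ → Ty} (hA : A.WF nl nt)
    (hl : ∀ i < nl, σl i = σl' i) (ht : ∀ i < nt, σt i = σt' i) :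
    A.subst σl σt = A.subst σl' σt' := by
  induction A generalizing nl nt σl σl' σt σt' with
  | base => rfl
  | var i => exact ht i hA
  | fn A L B ihA ihB =>
    simp only [subst, ihA hA.1 hl ht, ihB hA.2.2 hl ht, Loc.subst_congr hA.2.1 hl]
  | clo A ih => simp only [subst, ih (show A.WF nl nt from hA) hl ht]
  | T A ih => simp only [subst, ih (show A.WF nl nt from hA) hl ht]
  | prod A B ihA ihB => simp only [subst, ihA hA.1 hl ht, ihB hA.2 hl ht]
  | allT A ih =>
    have ht' : ∀ i < nt + 1, liftT σt i = liftT σt' i := by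
      rintro (_ | i) hi
      · rfl
      · simp only [liftT, ht i (by omega)]
    simp only [subst, ih (show A.WF nl (nt + 1) from hA) hl ht']
  | allL A ih =>
    have hl' : ∀ i < nl + 1, liftL σl i = liftL σl' i := by
      rintro (_ | i) hi
      · rfl
      · simp only [liftL, hl i (by omega)]
    have ht' : ∀ i < nt, (σt i).shiftL = (σt' i).shiftL := fun i hi => by rw [ht i hi]
    simp only [subst, ih (show A.WF (nl + 1) nt from hA) hl' ht']

theorem liftT_var : liftT Ty.var = Ty.var := by
  funext i; cases i <;> rfl

@[simp] theorem subst_var (A : Ty) : A.subst Loc.var Ty.var = A := by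
  have h : (fun i => (Ty.var i).shiftL) = Ty.var := rfl
  induction A with
  | base => rfl
  | var i => rfl
  | fn A L B ihA ihB => simp only [subst, ihA, ihB, Loc.subst_var]
  | clo A ih => simp only [subst, ih]
  | T A ih => simp only [subst, ih]
  | prod A B ihA ihB => simp only [subst, ihA, ihB]
  | allT A ih => simp only [subst, liftT_var, ih]
  | allL A ih => simp only [subst, liftL_var, h, ih]

theorem subst_eq_self {A : Ty} {nl nt : ℕ} {σl : ℕ → Loc} {σt : ℕ → Ty} (hA : A.WF nl nt)
    (hl : ∀ i < nl, σl i = .var i) (ht : ∀ i < nt, σt i = .var i) : A.subst σl σt = A := by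
  rw [subst_congr hA hl ht, subst_var]

theorem shiftT_eq_self {A : Ty} (hA : A.WF 0 0) : A.shiftT = A := by
  rw [shiftT, ren_eq_subst]
  exact subst_eq_self hA (fun i hi => absurd hi (by omega)) (fun i hi => absurd hi (by omega))

theorem shiftL_eq_self {A : Ty} (hA : A.WF 0 0) : A.shiftL = A := by
  rw [shiftL, ren_eq_subst]
  exact subst_eq_self hA (fun i hi => absurd hi (by omega)) (fun i hi => absurd hi (by omega))

theorem WF.mono {A : Ty} {nl nt nl' nt' : ℕ} (hA : A.WF nl nt) (hl : nl ≤ nl') (ht : nt ≤ nt') :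
    A.WF nl' nt' := by
  induction A generalizing nl nt nl' nt' with
  | base => trivial
  | var i => exact lt_of_lt_of_le (show i < nt from hA) ht
  | fn A L B ihA ihB => exact ⟨ihA hA.1 hl ht, hA.2.1.mono hl, ihB hA.2.2 hl ht⟩
  | clo A ih => exact ih (show A.WF nl nt from hA) hl ht
  | T A ih => exact ih (show A.WF nl nt from hA) hl ht
  | prod A B ihA ihB => exact ⟨ihA hA.1 hl ht, ihB hA.2 hl ht⟩
  | allT A ih => exact ih (show A.WF nl (nt + 1) from hA) hl (by omega)
  | allL A ih => exact ih (show A.WF (nl + 1) nt from hA) (by omega) ht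

theorem WF.ren {A : Ty} {nl nt nl' nt' : ℕ} {ρl ρt : ℕ → ℕ} (hA : A.WF nl nt)
    (hl : ∀ i < nl, ρl i < nl') (ht : ∀ i < nt, ρt i < nt') : (A.ren ρl ρt).WF nl' nt' := by
  have lift : ∀ {n n' : ℕ} {ρ : ℕ → ℕ}, (∀ i < n, ρ i < n') →
      ∀ i < n + 1, liftRen ρ i < n' + 1 := by
    rintro n n' ρ h (_ | i) hi
    · exact Nat.succ_pos _
    · exact Nat.succ_lt_succ (h i (by omega))
  induction A generalizing nl nt nl' nt' ρl ρt with
  | base => trivial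
  | var i => exact ht i hA
  | fn A L B ihA ihB =>
    refine ⟨ihA hA.1 hl ht, ?_, ihB hA.2.2 hl ht⟩
    have := hA.2.1
    cases L with
    | const a => trivial
    | var i => exact hl i this
  | clo A ih => exact ih (show A.WF nl nt from hA) hl ht
  | T A ih => exact ih (show A.WF nl nt from hA) hl ht
  | prod A B ihA ihB => exact ⟨ihA hA.1 hl ht, ihB hA.2 hl ht⟩
  | allT A ih => exact ih (show A.WF nl (nt + 1) from hA) hl (lift ht)
  | allL A ih => exact ih (show A.WF (nl + 1) nt from hA) (lift hl) ht

theorem WF.shiftT {A : Ty} {nl nt : ℕ} (hA : A.WF nl nt) : A.shiftT.WF nl (nt + 1) :=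
  WF.ren hA (fun _ h => h) (fun _ h => Nat.succ_lt_succ h)

theorem WF.shiftL {A : Ty} {nl nt : ℕ} (hA : A.WF nl nt) : A.shiftL.WF (nl + 1) nt :=
  WF.ren hA (fun _ h => Nat.succ_lt_succ h) (fun _ h => h)

theorem WF.subst {A : Ty} {nl nt nl' nt' : ℕ} {σl : ℕ → Loc} {σt : ℕ → Ty} (hA : A.WF nl nt)
    (hl : ∀ i < nl, (σl i).WF nl') (ht : ∀ i < nt, (σt i).WF nl' nt') :
    (A.subst σl σt).WF nl' nt' := by
  induction A generalizing nl nt nl' nt' σl σt with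
  | base => trivial
  | var i => exact ht i hA
  | fn A L B ihA ihB => exact ⟨ihA hA.1 hl ht, hA.2.1.subst hl, ihB hA.2.2 hl ht⟩
  | clo A ih => exact ih (show A.WF nl nt from hA) hl ht
  | T A ih => exact ih (show A.WF nl nt from hA) hl ht
  | prod A B ihA ihB => exact ⟨ihA hA.1 hl ht, ihB hA.2 hl ht⟩
  | allT A ih =>
    refine ih (show A.WF nl (nt + 1) from hA) hl ?_
    rintro (_ | i) hi
    · exact Nat.succ_pos _
    · exact (ht i (by omega)).shiftT
  | allL A ih =>
    refine ih (show A.WF (nl + 1) nt from hA) ?_ (fun i hi => (ht i hi).shiftL)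
    rintro (_ | i) hi
    · exact Nat.succ_pos _
    · exact (hl i (by omega)).ren_succ

/-- Type variables count as relocatable, so they may only be replaced by relocatable types. Asking
this of every index, in scope or not, costs nothing: out of range, `ofList` returns a variable. -/
theorem Reloc.subst {A : Ty} {σl : ℕ → Loc} {σt : ℕ → Ty} (hA : A.Reloc)
    (h : ∀ i, (σt i).Reloc) : (A.subst σl σt).Reloc := by
  induction A with
  | base => trivial
  | var i => exact h i
  | fn A L B => exact hA.elim
  | clo A => trivial
  | T A => exact hA.elim
  | prod A B ihA ihB => exact ⟨ihA hA.1, ihB hA.2⟩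
  | allT A => trivial
  | allL A => exact hA.elim

theorem Reloc.ren {A : Ty} (hA : A.Reloc) (ρl ρt : ℕ → ℕ) : (A.ren ρl ρt).Reloc := by
  rw [ren_eq_subst]
  exact hA.subst fun _ => trivial

theorem instT_subst (A B : Ty) (σl : ℕ → Loc) (σt : ℕ → Ty) :
    (A.instT B).subst σl σt = (A.subst σl (liftT σt)).instT (B.subst σl σt) := by
  simp only [instT, subst_subst, Loc.subst_var]
  congr 1
  funext i
  cases i with
  | zero => rfl
  | succ i =>
    simp only [ofList_singleton_succ, liftT, shiftT, ren_subst, subst]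
    exact (subst_var _).symm

theorem instL_subst (A : Ty) (L : Loc) (σl : ℕ → Loc) (σt : ℕ → Ty) :
    (A.instL L).subst σl σt
      = (A.subst (liftL σl) (fun i => (σt i).shiftL)).instL (L.subst σl) := by
  simp only [instL, subst_subst]
  congr 1
  · funext i
    cases i with
    | zero => rfl
    | succ i =>
      simp only [liftL, Loc.ren_subst, ofList_singleton_succ, Loc.subst_var]
      rfl
  · funext i
    simp only [shiftL, ren_subst, subst, ofList_singleton_succ]
    exact (subst_var _).symm

end Ty

/-! ### Lists of values and typing environments -/

theorem Val.substList_eq_map (Vs : List Val) (x : Name) (U : Val) :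
    Val.substList Vs x U = Vs.map (fun V => V.subst x U) := by
  induction Vs with
  | nil => rfl
  | cons V Vs ih => simp [Val.substList, ih]

theorem Val.instList_eq_map (σl : ℕ → Loc) (σt : ℕ → Ty) (Vs : List Val) :
    Val.instList σl σt Vs = Vs.map (Val.inst σl σt) := by
  induction Vs with
  | nil => rfl
  | cons V Vs ih => simp [Val.instList, ih]

theorem Val.compList_eq_map (a : Side) (Vs : List Val) :
    Val.compList a Vs = Vs.map (Val.comp a) := by
  induction Vs with
  | nil => rfl
  | cons V Vs ih => simp [Val.compList, ih]

/-- Apply a map to all types of a typing environment. -/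
abbrev Ctx.mapTy (f : Ty → Ty) (Γ : Ctx) : Ctx := Γ.map fun p => (p.1, f p.2)

theorem Ctx.lookup_mapTy (f : Ty → Ty) (Γ : Ctx) (x : Name) :
    (Γ.mapTy f).lookup x = (Γ.lookup x).map f := by
  induction Γ with
  | nil => rfl
  | cons p Γ ih =>
    obtain ⟨y, B⟩ := p
    simp only [Ctx.mapTy, List.map_cons, List.lookup_cons] at ih ⊢
    cases x == y <;> simp [ih]

theorem Ctx.lookup_append (Γ Γ' : Ctx) (x : Name) :
    (Γ ++ Γ').lookup x = (Γ.lookup x).or (Γ'.lookup x) := by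
  induction Γ with
  | nil => rfl
  | cons p Γ ih =>
    obtain ⟨y, B⟩ := p
    simp only [List.cons_append, List.lookup_cons]
    cases x == y <;> simp [ih]

theorem Ctx.lookup_zip_eq_none {zs : List Name} {Bs : List Ty} {x : Name} (h : x ∉ zs) :
    (zs.zip Bs : Ctx).lookup x = none := by
  induction zs generalizing Bs with
  | nil => rfl
  | cons z zs ih =>
    cases Bs with
    | nil => rfl
    | cons B Bs =>
      simp only [List.mem_cons, not_or] at h
      simp only [List.zip_cons_cons, List.lookup_cons, beq_eq_false_iff_ne.mpr h.1]
      exact ih h.2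

theorem Ctx.lookup_cons_congr {Γ Γ' : Ctx} (y : Name) (B : Ty)
    (h : ∀ z, Γ'.lookup z = Γ.lookup z) (z : Name) :
    List.lookup z ((y, B) :: Γ') = List.lookup z ((y, B) :: Γ) := by
  simp only [List.lookup_cons, h]

theorem forall_mem_zip_map_left {α β γ : Type} {f : α → γ} {as : List α} {bs : List β}
    {p : γ → β → Prop} (h : ∀ q ∈ as.zip bs, p (f q.1) q.2) :
    ∀ q ∈ (as.map f).zip bs, p q.1 q.2 := by
  intro q hq
  rw [List.zip_map_left, List.mem_map] at hq
  obtain ⟨r, hr, rfl⟩ := hq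
  exact h r hr

theorem exists_mem_zip_left {α β : Type} {as : List α} {bs : List β}
    (hlen : as.length = bs.length) {a : α} (ha : a ∈ as) : ∃ b, (a, b) ∈ as.zip bs := by
  induction as generalizing bs with
  | nil => cases ha
  | cons a' as ih =>
    cases bs with
    | nil => simp at hlen
    | cons b bs =>
      rcases List.mem_cons.mp ha with rfl | ha
      · exact ⟨b, by simp⟩
      · obtain ⟨c, hc⟩ := ih (by simpa using hlen) ha
        exact ⟨c, by simp [hc]⟩

/-! ### Function typing -/

/-- Every binding of every part of the decomposition is well-typed. -/
def Decomp.OK (D : Decomp) : Prop := ∀ L F d, D.at L F = some d → BindingOK D F d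

theorem Program.WF.decomp_ok {P : Program} {D : Decomp} (hP : P.WF D) : D.OK := by
  intro L F d h
  refine hP.ok F d ((hP.union F d).2 ?_)
  match L, h with
  | .const .c, h => exact Or.inl h
  | .const .s, h => exact Or.inr (Or.inl h)
  | .var _, h => exact Or.inr (Or.inr h)

/-- Reduction looks names up in the program, typing in the decomposition. As the parts have disjoint
names, both find the same binding. -/
theorem Program.WF.lookup_eq {P : Program} {D : Decomp} (hP : P.WF D) {a : Side} {L : Loc}
    {F : FName} {d d' : FunDef} (h : P.at a F = some d) (h' : D.at L F = some d') : d = d' := by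
  have hu : D.client F = some d ∨ D.server F = some d ∨ D.common F = some d := by
    refine (hP.union F d).1 ?_
    match a, h with
    | .c, h => exact Or.inl h
    | .s, h => exact Or.inr h
  have h' : D.client F = some d' ∨ D.server F = some d' ∨ D.common F = some d' := by
    match L, h' with
    | .const .c, h => exact Or.inl h
    | .const .s, h => exact Or.inr (Or.inl h)
    | .var _, h => exact Or.inr (Or.inr h)
  have h1 := hP.disj_client_server F
  have h2 := hP.disj_client_common F
  have h3 := hP.disj_server_common F
  rcases hu with hu | hu | hu <;> rcases h' with h' | h' | h' <;> simp_all

theorem BindingOK.ty_wf {D : Decomp} {F : FName} {d : FunDef} (h : BindingOK D F d) :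
    d.ty.WF d.nl d.nt := by
  cases h <;> assumption

theorem BindingOK.Bs_wf {D : Decomp} {F : FName} {d : FunDef} (h : BindingOK D F d) :
    ∀ B ∈ d.Bs, B.WF d.nl d.nt := by
  cases h <;> assumption

theorem FunTyping.exists_def {D : Decomp} {nl nt : ℕ} {F : FName} {Ls : List Loc}
    {As Bs : List Ty} {A : Ty} (h : FunTyping D nl nt F Ls As Bs A) :
    ∃ L d, D.at L F = some d ∧ Ls.length = d.nl ∧ As.length = d.nt ∧
      (∀ L' ∈ Ls, L'.WF nl) ∧ (∀ A' ∈ As, A'.WF nl nt) ∧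
      (∀ A' ∈ As, A'.Reloc) ∧ (∀ B' ∈ d.Bs, B'.Reloc) ∧
      Bs = d.Bs.map (Ty.subst (ofList Loc.var Ls) (ofList Ty.var As)) ∧
      A = d.ty.subst (ofList Loc.var Ls) (ofList Ty.var As) := by
  cases h with
  | abs h1 h2 h3 h4 h5 h6 h7 h8 h9 => exact ⟨_, _, h1, h4, h5, h6, h7, h8, h9, rfl, rfl⟩
  -- Every location variable denotes the common part; the index `0` is arbitrary.
  | labs h1 h2 h3 h4 h5 h6 h7 h8 h9 => exact ⟨.var 0, _, h1, h4, h5, h6, h7, h8, h9, rfl, rfl⟩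

theorem ofList_forall {α : Type} {p : α → Prop} {v : ℕ → α} {as : List α} {n : ℕ}
    (hlen : as.length = n) (h : ∀ a ∈ as, p a) : ∀ i < n, p (ofList v as i) := by
  intro i hi
  rw [ofList_of_lt v as (hlen ▸ hi)]
  exact h _ (List.getElem_mem _)

theorem ofList_reloc {As : List Ty} (h : ∀ A ∈ As, A.Reloc) (i : ℕ) :
    (ofList Ty.var As i).Reloc := by
  by_cases hi : i < As.length
  · exact ofList_forall rfl h i hi
  · rw [ofList, List.getD_eq_default _ _ (not_lt.mp hi)]
    trivial

theorem FunTyping.reloc {D : Decomp} {nl nt : ℕ} {F : FName} {Ls : List Loc}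
    {As Bs : List Ty} {A : Ty} (h : FunTyping D nl nt F Ls As Bs A) : ∀ B ∈ Bs, B.Reloc := by
  obtain ⟨_, d, _, _, _, _, _, hr, hB, rfl, rfl⟩ := h.exists_def
  intro B hB'
  obtain ⟨B', hmem, rfl⟩ := List.mem_map.mp hB'
  exact (hB B' hmem).subst (ofList_reloc hr)

theorem FunTyping.wf {D : Decomp} (hD : D.OK) {nl nt : ℕ} {F : FName} {Ls : List Loc}
    {As Bs : List Ty} {A : Ty} (h : FunTyping D nl nt F Ls As Bs A) : A.WF nl nt := by
  obtain ⟨L, d, hd, hLs, hAs, hL, hA, _, _, rfl, rfl⟩ := h.exists_def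
  exact (hD _ _ _ hd).ty_wf.subst (ofList_forall hLs hL) (ofList_forall hAs hA)

theorem FunTyping.mono {D : Decomp} {nl nt nl' nt' : ℕ} {F : FName} {Ls : List Loc}
    {As Bs : List Ty} {A : Ty} (h : FunTyping D nl nt F Ls As Bs A) (hl : nl ≤ nl')
    (ht : nt ≤ nt') : FunTyping D nl' nt' F Ls As Bs A := by
  cases h with
  | abs h1 h2 h3 h4 h5 h6 h7 h8 h9 =>
    exact .abs h1 h2 h3 h4 h5 (fun L hL => (h6 L hL).mono hl)
      (fun A hA => (h7 A hA).mono hl ht) h8 h9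
  | labs h1 h2 h3 h4 h5 h6 h7 h8 h9 =>
    exact .labs h1 h2 h3 h4 h5 (fun L hL => (h6 L hL).mono hl)
      (fun A hA => (h7 A hA).mono hl ht) h8 h9

/-- The two substitutions agree only on indices within the lists: beyond them the left side applies
`σl` and `σt` and the right side does not. Well-formedness of the declared type excludes those
indices. -/
theorem Ty.subst_ofList {X : Ty} {nl nt : ℕ} (hX : X.WF nl nt) {Ls : List Loc} {As : List Ty}
    (hLs : Ls.length = nl) (hAs : As.length = nt) (σl : ℕ → Loc) (σt : ℕ → Ty) :
    (X.subst (ofList Loc.var Ls) (ofList Ty.var As)).subst σl σt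
      = X.subst (ofList Loc.var (Ls.map (Loc.subst σl)))
          (ofList Ty.var (As.map (Ty.subst σl σt))) := by
  rw [Ty.subst_subst]
  refine Ty.subst_congr hX (fun i hi => ?_) (fun i hi => ?_)
  · rw [ofList_of_lt _ _ (hLs ▸ hi), ofList_of_lt _ _ (by simpa using hLs ▸ hi)]; simp
  · rw [ofList_of_lt _ _ (hAs ▸ hi), ofList_of_lt _ _ (by simpa using hAs ▸ hi)]; simp

theorem FunTyping.subst {D : Decomp} (hD : D.OK) {nl nt nl' nt' : ℕ} {F : FName} {Ls : List Loc}
    {As Bs : List Ty} {A : Ty} {σl : ℕ → Loc} {σt : ℕ → Ty}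
    (h : FunTyping D nl nt F Ls As Bs A)
    (hl : ∀ i < nl, (σl i).WF nl') (ht : ∀ i < nt, (σt i).WF nl' nt')
    (hr : ∀ i, (σt i).Reloc) :
    FunTyping D nl' nt' F (Ls.map (Loc.subst σl)) (As.map (Ty.subst σl σt))
      (Bs.map (Ty.subst σl σt)) (A.subst σl σt) := by
  have hLs' : ∀ {Ls : List Loc}, (∀ L ∈ Ls, L.WF nl) →
      ∀ L ∈ Ls.map (Loc.subst σl), L.WF nl' := by
    intro Ls hLs L hL
    obtain ⟨L, hmem, rfl⟩ := List.mem_map.mp hL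
    exact (hLs L hmem).subst hl
  have hAs' : ∀ {As : List Ty}, (∀ A ∈ As, A.WF nl nt) →
      ∀ A ∈ As.map (Ty.subst σl σt), A.WF nl' nt' := by
    intro As hAs A hA
    obtain ⟨A, hmem, rfl⟩ := List.mem_map.mp hA
    exact (hAs A hmem).subst hl ht
  have hRs' : ∀ {As : List Ty}, (∀ A ∈ As, A.Reloc) → ∀ A ∈ As.map (Ty.subst σl σt), A.Reloc := by
    intro As hRs A hA
    obtain ⟨A, hmem, rfl⟩ := List.mem_map.mp hA
    exact (hRs A hmem).subst hr
  have key : ∀ {L : Loc} {d : FunDef}, D.at L F = some d → Ls.length = d.nl → As.length = d.nt →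
      (d.Bs.map (Ty.subst (ofList Loc.var Ls) (ofList Ty.var As))).map (Ty.subst σl σt)
        = d.Bs.map (Ty.subst (ofList Loc.var (Ls.map (Loc.subst σl)))
            (ofList Ty.var (As.map (Ty.subst σl σt)))) := by
    intro L d hd hLs hAs
    rw [List.map_map]
    exact List.map_congr_left fun B hB =>
      Ty.subst_ofList ((hD _ _ _ hd).Bs_wf B hB) hLs hAs σl σt
  cases h with
  | abs h1 h2 h3 h4 h5 h6 h7 h8 h9 =>
    rw [key h1 h4 h5, Ty.subst_ofList (hD _ _ _ h1).ty_wf h4 h5]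
    exact .abs h1 h2 h3 (by simpa using h4) (by simpa using h5) (hLs' h6) (hAs' h7)
      (hRs' h8) h9
  | labs h1 h2 h3 h4 h5 h6 h7 h8 h9 =>
    have h1' : D.at (.var 0) F = some _ := h1
    rw [key h1' h4 h5, Ty.subst_ofList (hD _ _ _ h1').ty_wf h4 h5]
    exact .labs h1 h2 h3 (by simpa using h4) (by simpa using h5) (hLs' h6) (hAs' h7)
      (hRs' h8) h9

/-! ### Structural properties of typing -/

section
variable {D : Decomp} {nl nt nl' nt' : ℕ} {Γ Γ' : Ctx} {L L' : Loc} {M : Tm} {V W : Val}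
  {A B : Ty}

/-- Values of relocatable type may be moved to any location. -/
theorem Typing.relocate_aux (h : Typing D nl nt Γ L M A) :
    ∀ V, M = .val V → A.Reloc → ∀ L', Typing D nl nt Γ L' M A := by
  induction h with
  | var h => exact fun _ _ _ _ => .var h
  | clo hF hlen hW ih =>
    intro _ _ _ L'
    refine .clo hF hlen fun p hp => ih p hp _ rfl ?_ L'
    exact hF.reloc _ (List.of_mem_zip hp).2
  | pair _ _ ih1 ih2 =>
    exact fun _ _ hr L' => .pair (ih1 _ rfl hr.1 L') (ih2 _ rfl hr.2 L')
  | tabs h _ => exact fun _ _ _ _ => .tabs h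
  | letin => exact fun _ h => by cases h
  | proj1 => exact fun _ h => by cases h
  | proj2 => exact fun _ h => by cases h
  | tapp => exact fun _ h => by cases h
  | lapp => exact fun _ h => by cases h
  | app => exact fun _ h => by cases h
  | unit => exact fun _ _ h => h.elim
  | bind => exact fun _ _ h => h.elim
  | gen => exact fun _ _ h => h.elim
  | req => exact fun _ _ h => h.elim
  | call => exact fun _ _ h => h.elim

theorem Typing.relocate (h : Typing D nl nt Γ L (.val V) A) (hA : A.Reloc)
    (L' : Loc) : Typing D nl nt Γ L' (.val V) A :=
  h.relocate_aux V rfl hA L'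

theorem Typing.unit_inv (h : Typing D nl nt Γ L (.val (.unit V)) A) :
    ∃ B, A = .T B ∧ Typing D nl nt Γ L (.val V) B ∧ B.Reloc := by
  cases h with
  | unit h hr => exact ⟨_, rfl, h, hr⟩

/-- A type abstraction is typable as soon as its body is typable at one location. -/
theorem Typing.tabs_of_loc {L₀ : Loc}
    (h : Typing D nl (nt + 1) (Γ.mapTy Ty.shiftT) L₀ (.val (.unit V)) A) :
    Typing D nl nt Γ L (.val (.tabs V)) (.allT A) := by
  obtain ⟨B, rfl, h, hr⟩ := h.unit_inv
  exact .tabs fun L₁ _ => .unit (h.relocate hr L₁) hr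

/-- Environments matter only through lookup. This covers both exchange and the removal of shadowed
bindings. -/
theorem Typing.ctx_congr (h : Typing D nl nt Γ L M A) (hΓ : ∀ x, Γ'.lookup x = Γ.lookup x) :
    Typing D nl nt Γ' L M A := by
  induction h generalizing Γ' with
  | var h => exact .var (by rw [hΓ, h])
  | letin _ _ ih1 ih2 => exact .letin (ih1 hΓ) (ih2 (Ctx.lookup_cons_congr _ _ hΓ))
  | clo hF hlen _ ih => exact .clo hF hlen fun p hp => ih p hp hΓ
  | proj1 _ ih => exact .proj1 (ih hΓ)
  | proj2 _ ih => exact .proj2 (ih hΓ)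
  | pair _ _ ih1 ih2 => exact .pair (ih1 hΓ) (ih2 hΓ)
  | tabs _ ih =>
    exact .tabs fun L₀ h₀ => ih L₀ h₀ fun x => by
      rw [Ctx.lookup_mapTy, Ctx.lookup_mapTy, hΓ x]
  | tapp _ h1 h2 ih => exact .tapp (ih hΓ) h1 h2
  | lapp _ h1 ih => exact .lapp (ih hΓ) h1
  | unit _ hr ih => exact .unit (ih hΓ) hr
  | bind _ _ ih1 ih2 => exact .bind (ih1 hΓ) (ih2 (Ctx.lookup_cons_congr _ _ hΓ))
  | app _ _ ih1 ih2 => exact .app (ih1 hΓ) (ih2 hΓ)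
  | gen _ _ hr hL ih1 ih2 => exact .gen (ih1 hΓ) (ih2 hΓ) hr hL
  | req _ _ hr ih1 ih2 => exact .req (ih1 hΓ) (ih2 hΓ) hr
  | call _ _ hr ih1 ih2 => exact .call (ih1 hΓ) (ih2 hΓ) hr

/-- New index variables are added at the outer end and new bindings at the far end, so the term
needs no shifting and nothing is captured. This puts a closed value into an arbitrary environment.
-/
theorem Typing.weaken (h : Typing D nl nt Γ L M A) (hl : nl ≤ nl') (ht : nt ≤ nt')
    (Γ' : Ctx) : Typing D nl' nt' (Γ ++ Γ') L M A := by
  induction h generalizing nl' nt' Γ' with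
  | var h => exact .var (by rw [Ctx.lookup_append, h]; rfl)
  | letin _ _ ih1 ih2 => exact .letin (ih1 hl ht Γ') (ih2 hl ht Γ')
  | clo hF hlen _ ih => exact .clo (hF.mono hl ht) hlen fun p hp => ih p hp hl ht Γ'
  | proj1 _ ih => exact .proj1 (ih hl ht Γ')
  | proj2 _ ih => exact .proj2 (ih hl ht Γ')
  | pair _ _ ih1 ih2 => exact .pair (ih1 hl ht Γ') (ih2 hl ht Γ')
  | tabs _ ih =>
    -- The premise covers the locations over `nl`, the goal those over `nl'`. A constant belongs to
    -- both, and one location suffices.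
    refine .tabs_of_loc (L₀ := .const .c) ?_
    have := ih (.const .c) trivial hl (Nat.succ_le_succ ht) (Γ'.mapTy Ty.shiftT)
    rwa [← List.map_append] at this
  | tapp _ h1 h2 ih => exact .tapp (ih hl ht Γ') (h1.mono hl ht) h2
  | lapp _ h1 ih => exact .lapp (ih hl ht Γ') (h1.mono hl)
  | unit _ hr ih => exact .unit (ih hl ht Γ') hr
  | bind _ _ ih1 ih2 => exact .bind (ih1 hl ht Γ') (ih2 hl ht Γ')
  | app _ _ ih1 ih2 => exact .app (ih1 hl ht Γ') (ih2 hl ht Γ')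
  | gen _ _ hr hL ih1 ih2 => exact .gen (ih1 hl ht Γ') (ih2 hl ht Γ') hr (hL.mono hl)
  | req _ _ hr ih1 ih2 => exact .req (ih1 hl ht Γ') (ih2 hl ht Γ') hr
  | call _ _ hr ih1 ih2 => exact .call (ih1 hl ht Γ') (ih2 hl ht Γ') hr

theorem Ctx.forall_lookup_cons {P : Ty → Prop} {Γ : Ctx} {y : Name} {B : Ty}
    (hΓ : ∀ x A, Γ.lookup x = some A → P A) (hB : P B) :
    ∀ x A, List.lookup x ((y, B) :: Γ) = some A → P A := by
  intro x A h
  rw [List.lookup_cons] at h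
  split at h
  · cases h; exact hB
  · exact hΓ x A h

/-- Needed for closed values: their types have no free variables, so shifting an environment under a
type abstraction leaves such types unchanged. -/
theorem Typing.wf (hD : D.OK) (h : Typing D nl nt Γ L M A)
    (hΓ : ∀ x A, Γ.lookup x = some A → A.WF nl nt) : A.WF nl nt := by
  induction h with
  | var h => exact hΓ _ _ h
  | letin _ _ ih1 ih2 => exact ih2 (Ctx.forall_lookup_cons hΓ (ih1 hΓ))
  | clo hF => exact hF.wf hD
  | proj1 _ ih => exact (ih hΓ).1
  | proj2 _ ih => exact (ih hΓ).2
  | pair _ _ ih1 ih2 => exact ⟨ih1 hΓ, ih2 hΓ⟩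
  | tabs _ ih =>
    refine ih (.const .c) trivial fun x A h => ?_
    rw [Ctx.lookup_mapTy, Option.map_eq_some_iff] at h
    obtain ⟨B, hB, rfl⟩ := h
    exact (hΓ x B hB).shiftT
  | tapp _ h1 h2 ih =>
    refine Ty.WF.subst (ih hΓ) (fun i hi => hi) ?_
    rintro (_ | i) hi
    · exact h1
    · rw [ofList_singleton_succ]; exact Nat.lt_of_succ_lt_succ hi
  | lapp _ h1 ih =>
    refine Ty.WF.subst (ih hΓ) ?_ (fun i hi => hi)
    rintro (_ | i) hi
    · exact h1
    · rw [ofList_singleton_succ]; exact Nat.lt_of_succ_lt_succ hi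
  | unit _ hr ih => exact ih hΓ
  | bind _ _ ih1 ih2 => exact ih2 (Ctx.forall_lookup_cons hΓ (ih1 hΓ))
  | app _ _ ih1 _ => exact (ih1 hΓ).2.2
  | gen _ _ _ _ ih1 _ => exact (ih1 hΓ).2.2
  | req _ _ _ ih1 _ => exact (ih1 hΓ).2.2
  | call _ _ _ ih1 _ => exact (ih1 hΓ).2.2

theorem Typing.closed_wf (hD : D.OK) (h : Typing D nl nt [] L M A) : A.WF nl nt :=
  h.wf hD fun _ _ h => by cases h

-- Substitution and instantiation in typed terms

theorem map_eq_self_of_forall {α : Type} {f : α → α} {as : List α} (h : ∀ a ∈ as, f a = a) :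
    as.map f = as := by
  conv_rhs => rw [← List.map_id as]
  exact List.map_congr_left h

/-- With its counterpart `Typing.inst_eq_self` this turns closed typing into invariance under all
substitutions. `Forcing` asks for closedness in that form. -/
theorem Typing.subst_eq_self (h : Typing D nl nt Γ L M A) {x : Name} (hx : Γ.lookup x = none)
    (U : Val) : M.subst x U = M := by
  have hcons : ∀ {Γ : Ctx} {y : Name} {B : Ty}, Γ.lookup x = none → ¬ x = y →
      List.lookup x ((y, B) :: Γ) = none := by
    intro Γ y B h hxy
    rw [List.lookup_cons, beq_eq_false_iff_ne.mpr hxy]; exact h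
  induction h with
  | @var _ _ _ y A h =>
    have : x ≠ y := by rintro rfl; rw [hx] at h; cases h
    simp [Tm.subst, Val.subst, this]
  | @letin _ _ _ y _ _ _ _ _ _ ih1 ih2 =>
    by_cases hxy : x = y
    · simp [Tm.subst, hxy]; simpa [hxy] using ih1 hx
    · simp [Tm.subst, ih1 hx, ih2 (hcons hx hxy)]
  | clo hF hlen _ ih =>
    simp only [Tm.subst, Val.subst, Val.substList_eq_map]
    congr 2
    refine map_eq_self_of_forall fun W hW => ?_
    obtain ⟨B, hB⟩ := exists_mem_zip_left hlen hW
    simpa [Tm.subst] using ih _ hB hx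
  | proj1 _ ih => simpa [Tm.subst] using ih hx
  | proj2 _ ih => simpa [Tm.subst] using ih hx
  | pair _ _ ih1 ih2 => simpa [Tm.subst, Val.subst] using And.intro (ih1 hx) (ih2 hx)
  | tabs _ ih =>
    simpa [Tm.subst, Val.subst] using
      ih (.const .c) trivial (by
        have := Ctx.lookup_mapTy Ty.shiftT ‹Ctx› x
        rw [hx] at this
        exact this)
  | tapp _ _ _ ih => simpa [Tm.subst] using ih hx
  | lapp _ _ ih => simpa [Tm.subst] using ih hx
  | unit _ _ ih => simpa [Tm.subst, Val.subst] using ih hx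
  | @bind _ _ _ y _ _ _ _ _ _ ih1 ih2 =>
    by_cases hxy : x = y
    · simp [Tm.subst, Val.subst, hxy]; simpa [hxy] using ih1 hx
    · simp [Tm.subst, Val.subst, ih1 hx, ih2 (hcons hx hxy)]
  | app _ _ ih1 ih2 => simpa [Tm.subst] using And.intro (ih1 hx) (ih2 hx)
  | gen _ _ _ _ ih1 ih2 => simpa [Tm.subst, Val.subst] using And.intro (ih1 hx) (ih2 hx)
  | req _ _ _ ih1 ih2 => simpa [Tm.subst, Val.subst] using And.intro (ih1 hx) (ih2 hx)
  | call _ _ _ ih1 ih2 => simpa [Tm.subst, Val.subst] using And.intro (ih1 hx) (ih2 hx)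

theorem Typing.inst_eq_self (h : Typing D nl nt Γ L M A) {σl : ℕ → Loc} {σt : ℕ → Ty}
    (hl : ∀ i < nl, σl i = .var i) (ht : ∀ i < nt, σt i = .var i) : M.inst σl σt = M := by
  induction h generalizing σl σt with
  | var h => rfl
  | letin _ _ ih1 ih2 => simp [Tm.inst, ih1 hl ht, ih2 hl ht]
  | clo hF hlen _ ih =>
    obtain ⟨_, _, _, _, _, hLs, hAs, _⟩ := hF.exists_def
    simp only [Tm.inst, Val.inst, Val.instList_eq_map]
    congr 2
    · refine map_eq_self_of_forall fun W hW => ?_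
      obtain ⟨B, hB⟩ := exists_mem_zip_left hlen hW
      simpa [Tm.inst] using ih _ hB hl ht
    · exact map_eq_self_of_forall fun L hL => by
        rw [Loc.subst_congr (hLs L hL) hl, Loc.subst_var]
    · exact map_eq_self_of_forall fun A hA => Ty.subst_eq_self (hAs A hA) hl ht
  | proj1 _ ih => simpa [Tm.inst] using ih hl ht
  | proj2 _ ih => simpa [Tm.inst] using ih hl ht
  | pair _ _ ih1 ih2 => simpa [Tm.inst, Val.inst] using And.intro (ih1 hl ht) (ih2 hl ht)
  | @tabs nt _ _ _ _ _ ih =>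
    have ht' : ∀ i < nt + 1, Ty.liftT σt i = .var i := by
      rintro (_ | i) hi
      · rfl
      · simp only [Ty.liftT, ht i (by omega)]; rfl
    simpa [Tm.inst, Val.inst] using ih (.const .c) trivial hl ht'
  | tapp _ h1 _ ih => simpa [Tm.inst, Ty.subst_eq_self h1 hl ht] using ih hl ht
  | lapp _ h1 ih =>
    have := ih hl ht
    simp only [Tm.inst, Tm.val.injEq] at this ⊢
    rw [this, Loc.subst_congr h1 hl, Loc.subst_var]
  | unit _ _ ih => simpa [Tm.inst, Val.inst] using ih hl ht
  | bind _ _ ih1 ih2 => simp [Tm.inst, Val.inst, ih1 hl ht, ih2 hl ht]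
  | app _ _ ih1 ih2 => simpa [Tm.inst] using And.intro (ih1 hl ht) (ih2 hl ht)
  | gen _ _ _ h1 ih1 ih2 =>
    have h1' := ih1 hl ht
    have h2' := ih2 hl ht
    simp only [Tm.inst, Tm.val.injEq] at h1' h2'
    simp only [Tm.inst, Val.inst, h1', h2', Loc.subst_congr h1 hl, Loc.subst_var]
  | req _ _ _ ih1 ih2 => simpa [Tm.inst, Val.inst] using And.intro (ih1 hl ht) (ih2 hl ht)
  | call _ _ _ ih1 ih2 => simpa [Tm.inst, Val.inst] using And.intro (ih1 hl ht) (ih2 hl ht)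

/-- Substitution of a closed value preserves typing. -/
theorem Typing.subst (hD : D.OK) (h : Typing D nl nt Γ L M A) {x : Name}
    (hL : L.WF nl)
    (hW : Typing D 0 0 [] L (.val W) B) (hx : Γ.lookup x = some B)
    (hΓ : ∀ y, y ≠ x → Γ'.lookup y = Γ.lookup y) :
    Typing D nl nt Γ' L (M.subst x W) A := by
  have hB := hW.closed_wf hD
  have hcons : ∀ {Γ Γ' : Ctx} (z : Name) (C : Ty), (∀ y, y ≠ x → Γ'.lookup y = Γ.lookup y) →
      ∀ y, y ≠ x → List.lookup y ((z, C) :: Γ') = List.lookup y ((z, C) :: Γ) := by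
    intro Γ Γ' z C h y hy
    simp only [List.lookup_cons, h y hy]
  have hconsx : ∀ {Γ : Ctx} (z : Name) (C : Ty), Γ.lookup x = some B → x ≠ z →
      List.lookup x ((z, C) :: Γ) = some B := by
    intro Γ z C h hxz
    rw [List.lookup_cons, beq_eq_false_iff_ne.mpr hxz]; exact h
  have hconse : ∀ {Γ Γ' : Ctx} (C : Ty), (∀ y, y ≠ x → Γ'.lookup y = Γ.lookup y) →
      ∀ y, List.lookup y ((x, C) :: Γ') = List.lookup y ((x, C) :: Γ) := by
    intro Γ Γ' C h y
    by_cases hy : y = x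
    · subst hy; simp
    · simp only [List.lookup_cons, h y hy]
  induction h generalizing Γ' with
  | @var nt Γ L y A h =>
    by_cases hxy : x = y
    · subst hxy
      rw [hx] at h
      cases h
      simpa [Tm.subst, Val.subst] using hW.weaken (Nat.zero_le nl) (Nat.zero_le nt) Γ'
    · simp only [Tm.subst, Val.subst, hxy, if_false]
      exact .var (by rw [hΓ y (Ne.symm hxy), h])
  | @letin _ _ _ y _ _ _ _ _ h2 ih1 ih2 =>
    refine .letin (ih1 hL hW hx hΓ) ?_
    by_cases hxy : x = y
    · subst hxy
      rw [if_pos rfl]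
      exact h2.ctx_congr (hconse _ hΓ)
    · rw [if_neg hxy]
      exact ih2 hL hW (hconsx _ _ hx hxy) (hcons _ _ hΓ)
  | clo hF hlen _ ih =>
    simp only [Tm.subst, Val.subst, Val.substList_eq_map]
    refine .clo hF (by simpa using hlen) ?_
    exact forall_mem_zip_map_left (p := fun V B => Typing D _ _ Γ' _ (.val V) B)
      fun p hp => ih p hp hL hW hx hΓ
  | proj1 _ ih => exact .proj1 (ih hL hW hx hΓ)
  | proj2 _ ih => exact .proj2 (ih hL hW hx hΓ)
  | pair _ _ ih1 ih2 => exact .pair (ih1 hL hW hx hΓ) (ih2 hL hW hx hΓ)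
  | @tabs nt Γ L V A _ ih =>
    -- The body is typed at every location but `W` only at `L`, so the induction hypothesis is used
    -- at `L` alone. Relocatability of the body recovers the other locations.
    refine .tabs_of_loc (L₀ := L) (ih L hL hL hW ?_ ?_)
    · have := Ctx.lookup_mapTy Ty.shiftT Γ x
      rw [hx, Option.map_some, Ty.shiftT_eq_self hB] at this
      exact this
    · intro y hy
      have h1 := Ctx.lookup_mapTy Ty.shiftT Γ y
      have h2 := Ctx.lookup_mapTy Ty.shiftT Γ' y
      rw [hΓ y hy] at h2
      exact h2.trans h1.symm
  | tapp _ h1 h2 ih => exact .tapp (ih hL hW hx hΓ) h1 h2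
  | lapp _ h1 ih => exact .lapp (ih hL hW hx hΓ) h1
  | unit _ hr ih => exact .unit (ih hL hW hx hΓ) hr
  | @bind _ _ _ y _ _ _ _ _ h2 ih1 ih2 =>
    refine .bind (ih1 hL hW hx hΓ) ?_
    by_cases hxy : x = y
    · subst hxy
      rw [if_pos rfl]
      exact h2.ctx_congr (hconse _ hΓ)
    · rw [if_neg hxy]
      exact ih2 hL hW (hconsx _ _ hx hxy) (hcons _ _ hΓ)
  | app _ _ ih1 ih2 => exact .app (ih1 hL hW hx hΓ) (ih2 hL hW hx hΓ)
  | gen _ _ hr hL' ih1 ih2 => exact .gen (ih1 hL hW hx hΓ) (ih2 hL hW hx hΓ) hr hL'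
  | req _ _ hr ih1 ih2 => exact .req (ih1 hL hW hx hΓ) (ih2 hL hW hx hΓ) hr
  | call _ _ hr ih1 ih2 => exact .call (ih1 hL hW hx hΓ) (ih2 hL hW hx hΓ) hr

theorem Typing.subst_head (hD : D.OK) {x : Name} (h : Typing D nl nt ((x, B) :: Γ) L M A)
    (hL : L.WF nl) (hW : Typing D 0 0 [] L (.val W) B) :
    Typing D nl nt Γ L (M.subst x W) A := by
  refine h.subst hD hL hW (by simp) fun y hy => ?_
  rw [List.lookup_cons, beq_eq_false_iff_ne.mpr hy]

/-- The values are closed, so substituting them one after the other removes the bindings from the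
front one at a time. -/
theorem Typing.substs (hD : D.OK) {zs : List Name} {Ws : List Val} {Bs : List Ty}
    (h : Typing D nl nt (zs.zip Bs ++ Γ) L M A) (hL : L.WF nl)
    (hlen : zs.length = Bs.length) (hlen' : Ws.length = Bs.length)
    (hW : ∀ p ∈ Ws.zip Bs, Typing D 0 0 [] L (.val p.1) p.2) :
    Typing D nl nt Γ L (M.substs zs Ws) A := by
  induction zs generalizing M Ws Bs with
  | nil =>
    cases Bs with
    | nil => simpa [Tm.substs] using h
    | cons => simp at hlen
  | cons z zs ih =>
    cases Bs with
    | nil => simp at hlen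
    | cons B Bs =>
      cases Ws with
      | nil => simp at hlen'
      | cons W Ws =>
        have h1 : Typing D nl nt (zs.zip Bs ++ Γ) L (M.subst z W) A :=
          Typing.subst_head hD h hL (hW (W, B) (by simp))
        exact ih h1 (by simpa using hlen) (by simpa using hlen')
          fun p hp => hW p (by simp [hp])

theorem Val.substs_val (V : Val) (zs : List Name) (Ws : List Val) :
    (Tm.val V).substs zs Ws = .val (V.substs zs Ws) := by
  simp only [Tm.substs, Val.substs]
  induction zs.zip Ws generalizing V with
  | nil => rfl
  | cons p ps ih => simp only [List.foldl_cons, Tm.subst, ih]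

/-- Instantiation of location and type variables preserves typing. -/
theorem Typing.inst (hD : D.OK) (h : Typing D nl nt Γ L M A) {σl : ℕ → Loc} {σt : ℕ → Ty}
    (hl : ∀ i < nl, (σl i).WF nl') (ht : ∀ i < nt, (σt i).WF nl' nt')
    (hr : ∀ i, (σt i).Reloc) :
    Typing D nl' nt' (Γ.mapTy (Ty.subst σl σt)) (L.subst σl) (M.inst σl σt) (A.subst σl σt) := by
  induction h generalizing nl' nt' σl σt with
  | var h => exact .var (by rw [Ctx.lookup_mapTy, h]; rfl)
  | letin _ _ ih1 ih2 => exact .letin (ih1 hl ht hr) (ih2 hl ht hr)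
  | clo hF hlen _ ih =>
    simp only [Tm.inst, Val.inst, Val.instList_eq_map]
    refine .clo (hF.subst hD hl ht hr) (by simpa using hlen) fun p hp => ?_
    rw [List.zip_map, List.mem_map] at hp
    obtain ⟨q, hq, rfl⟩ := hp
    exact ih q hq hl ht hr
  | proj1 _ ih => exact .proj1 (ih hl ht hr)
  | proj2 _ ih => exact .proj2 (ih hl ht hr)
  | pair _ _ ih1 ih2 => exact .pair (ih1 hl ht hr) (ih2 hl ht hr)
  | tabs _ ih =>
    refine .tabs_of_loc (L₀ := .const .c) ?_
    have := ih (.const .c) trivial (σl := σl) (σt := Ty.liftT σt) (nl' := nl') (nt' := nt' + 1) hl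
      (by
        rintro (_ | i) hi
        · exact Nat.succ_pos _
        · exact (ht i (by omega)).shiftT)
      (by
        rintro (_ | i)
        · trivial
        · exact (hr i).ren _ _)
    simp only [Ctx.mapTy, List.map_map, Function.comp_def, Ty.shiftT_subst] at this ⊢
    exact this
  | tapp _ h1 h2 ih =>
    rw [Ty.instT_subst]
    exact .tapp (ih hl ht hr) (h1.subst hl ht) (h2.subst hr)
  | lapp _ h1 ih =>
    rw [Ty.instL_subst]
    exact .lapp (ih hl ht hr) (h1.subst hl)
  | unit _ h1 ih =>
    exact .unit (ih hl ht hr) (h1.subst hr)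
  | bind _ _ ih1 ih2 => exact .bind (ih1 hl ht hr) (ih2 hl ht hr)
  | app _ _ ih1 ih2 => exact .app (ih1 hl ht hr) (ih2 hl ht hr)
  | gen _ _ h1 h2 ih1 ih2 => exact .gen (ih1 hl ht hr) (ih2 hl ht hr) (h1.subst hr) (h2.subst hl)
  | req _ _ h1 ih1 ih2 => exact .req (ih1 hl ht hr) (ih2 hl ht hr) (h1.subst hr)
  | call _ _ h1 ih1 ih2 => exact .call (ih1 hl ht hr) (ih2 hl ht hr) (h1.subst hr)

end

/-! ### Subject reduction for pure redexes -/

/-- Reduction of the redexes that are neither `let` nor monadic. -/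
inductive PureStep (Φ : FunMap) : Tm → Tm → Prop where
  | proj1 {V₁ V₂} : PureStep Φ (.proj 0 (.pair V₁ V₂)) (.val V₁)
  | proj2 {V₁ V₂} : PureStep Φ (.proj 1 (.pair V₁ V₂)) (.val V₂)
  | tapp {V A} : PureStep Φ (.tapp (.tabs V) A) (.val (.unit (V.instT A)))
  | app {Ws F Ls As V zs x M} :
      Lookup Φ F Ls As zs (.lam x M) → Ws.length = zs.length →
      PureStep Φ (.app (.clo Ws F Ls As) V) ((M.substs zs Ws).subst x V)
  | lapp {Ws F Ls As b zs V} :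
      Lookup Φ F Ls As zs (.llam V) → Ws.length = zs.length →
      PureStep Φ (.lapp (.clo Ws F Ls As) (.const b)) (.val ((V.substs zs Ws).instL (.const b)))

theorem Ctx.mapTy_zip (f : Ty → Ty) (zs : List Name) (Bs : List Ty) :
    Ctx.mapTy f (zs.zip Bs) = zs.zip (Bs.map f) := by
  rw [List.zip_map_right]; rfl

section
variable {P : Program} {D : Decomp}

theorem Typing.clo_inv {nl nt : ℕ} {Γ : Ctx} {L : Loc} {Ws : List Val} {F : FName}
    {Ls : List Loc} {As : List Ty} {A : Ty} (h : Typing D nl nt Γ L (.val (.clo Ws F Ls As)) A) :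
    ∃ Bs A', A = .clo A' ∧ FunTyping D nl nt F Ls As Bs A' ∧ Ws.length = Bs.length ∧
      ∀ p ∈ Ws.zip Bs, Typing D nl nt Γ L (.val p.1) p.2 := by
  cases h with
  | clo hF hlen hW => exact ⟨_, _, rfl, hF, hlen, hW⟩

/-- The body of a location abstraction, after instantiation and substitution of its closed
environment, depends on one location variable only. -/
theorem Typing.llam_body (hP : P.WF D) {a : Side} {Ws : List Val} {F : FName} {Ls : List Loc}
    {As : List Ty} {zs : List Name} {V : Val} {C : Ty}
    (h : Typing D 0 0 [] (.const a) (.val (.clo Ws F Ls As)) (.clo (.allL C)))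
    (hΦ : Lookup (P.at a) F Ls As zs (.llam V)) :
    Typing D 1 0 [] (.const a) (.val (V.substs zs Ws)) C := by
  have hD := hP.decomp_ok
  obtain ⟨Bs, A', hA, hF, hlen, hW⟩ := h.clo_inv
  cases hA
  obtain ⟨L, d, hd, hLs, hAs, hL, hA, hr, -, rfl, hty⟩ := hF.exists_def
  obtain ⟨d', hd', -, -, rfl, hcode⟩ := hΦ
  obtain rfl := hP.lookup_eq hd' hd
  cases hD _ _ _ hd with
  | abs h1 => rw [h1] at hty; cases hty
  | labs h1 h2 _ h4 _ _ h7 h8 =>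
    rw [h1] at hty
    rw [h2] at hcode
    cases hty
    cases hcode
    rw [← Val.substs_val]
    have hB : ∀ B ∈ d'.Bs, (B.subst (ofList Loc.var Ls) (ofList Ty.var As)).WF 0 0 := fun B hB =>
      (BindingOK.Bs_wf (hD _ _ _ hd) B hB).subst (ofList_forall hLs hL) (ofList_forall hAs hA)
    have key := (h8 (.const a) trivial).inst hD (nl' := 1) (nt' := 0)
      (σl := liftL (ofList Loc.var Ls)) (σt := fun i => (ofList Ty.var As i).shiftL)
      (by
        rintro (_ | i) hi
        · exact Nat.one_pos
        · exact (ofList_forall (v := Loc.var) hLs hL i (by omega)).ren_succ)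
      (fun i hi => (ofList_forall (v := Ty.var) hAs hA i hi).shiftL)
      (fun i => (ofList_reloc hr i).ren _ _)
    refine Typing.substs hD (Γ := []) (Bs := d'.Bs.map
      (Ty.subst (ofList Loc.var Ls) (ofList Ty.var As))) ?_ trivial (by simpa using h4) hlen hW
    rw [Ctx.mapTy_zip, List.map_map] at key
    -- The environment types are closed once instantiated, so the weakening by the bound location
    -- variable has no effect on them.
    have hmap : d'.Bs.map (Ty.subst (liftL (ofList Loc.var Ls))
        (fun i => (ofList Ty.var As i).shiftL) ∘ Ty.shiftL)
        = d'.Bs.map (Ty.subst (ofList Loc.var Ls) (ofList Ty.var As)) := by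
      refine List.map_congr_left fun B hmem => ?_
      rw [Function.comp_apply, Ty.shiftL_subst, Ty.shiftL_eq_self (hB B hmem)]
    rw [hmap] at key
    rw [List.append_nil]
    exact key

/-- A pure step preserves closed typing. -/
theorem PureStep.typing (hP : P.WF D) {a : Side} {M M' : Tm} {A : Ty}
    (hs : PureStep (P.at a) M M') (h : Typing D 0 0 [] (.const a) M A) :
    Typing D 0 0 [] (.const a) M' A := by
  have hD := hP.decomp_ok
  cases hs with
  | proj1 =>
    cases h with
    | proj1 h => cases h with | pair h1 h2 => exact h1
  | proj2 =>
    cases h with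
    | proj2 h => cases h with | pair h1 h2 => exact h2
  | tapp =>
    cases h with
    | tapp h hB hr =>
      cases h with
      | tabs h =>
        refine (h (.const a) trivial).inst hD (nl' := 0) (nt' := 0) (fun i hi => hi) ?_ ?_
        · rintro (_ | i) hi
          · exact hB
          · omega
        · exact ofList_reloc (by simpa using hr)
  | @app Ws F Ls As V zs x M hΦ hlen' =>
    cases h with
    | app hV hW =>
      obtain ⟨Bs, A', hA, hF, hlen, hWs⟩ := hV.clo_inv
      cases hA
      obtain ⟨L, d, hd, hLs, hAs, hL, hA, hr, -, rfl, hty⟩ := hF.exists_def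
      obtain ⟨d', hd', -, -, rfl, hcode⟩ := hΦ
      obtain rfl := hP.lookup_eq hd' hd
      cases hD _ _ _ hd with
      | labs h1 => rw [h1] at hty; cases hty
      | abs h1 h2 _ h4 h5 _ h7 h8 =>
        rw [h1] at hty
        rw [h2] at hcode
        simp only [Ty.subst, Ty.fn.injEq] at hty
        obtain ⟨rfl, hloc, rfl⟩ := hty
        cases hcode
        have key := h8.inst hD (nl' := 0) (nt' := 0) (ofList_forall (v := Loc.var) hLs hL)
          (ofList_forall (v := Ty.var) hAs hA) (ofList_reloc hr)
        -- The instance of the location annotation of the function is the side at which the call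
        -- takes place.
        rw [← hloc] at key
        -- The binding lists `x` before `z̄`, while reduction substitutes `W̄` for `z̄` first. Since
        -- `x ∉ z̄`, moving `x` to the end does not alter lookups.
        refine Typing.subst_head hD (Typing.substs hD (key.ctx_congr ?_) trivial
          (by simpa using h4) hlen hWs) trivial hW
        intro y
        simp only [Ctx.mapTy, List.map_cons]
        have hz := Ctx.mapTy_zip (Ty.subst (ofList Loc.var Ls) (ofList Ty.var As)) d'.zs d'.Bs
        simp only [Ctx.mapTy] at hz
        rw [hz, Ctx.lookup_append]
        by_cases hy : y = x
        · subst hy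
          rw [Ctx.lookup_zip_eq_none (List.nodup_cons.mp h5).1]
          simp
        · simp [List.lookup_cons, beq_eq_false_iff_ne.mpr hy]
  | lapp hΦ hlen' =>
    cases h with
    | lapp h _ =>
      refine (h.llam_body hP hΦ).inst hD (nl' := 0) (nt' := 0) ?_ (fun i hi => hi) ?_
      · rintro (_ | i) hi
        · trivial
        · omega
      · intro i; trivial

/-! ### Big-step evaluation -/

/-- `Ev Φ M V`: the term `M` evaluates to the value `V` without running monadic values. -/
inductive Ev (Φ : FunMap) : Tm → Val → Prop where
  | val {V} : Ev Φ (.val V) V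
  | letin {x M N V W} : Ev Φ M V → Ev Φ (N.subst x V) W → Ev Φ (.letin x M N) W
  | step {M M' V} : PureStep Φ M M' → Ev Φ M' V → Ev Φ M V

/-- `RunVal P a V U`: running the monadic value `V` at `a` returns `U`. -/
inductive RunVal (P : Program) : Side → Val → Val → Prop where
  | unit {a U} : RunVal P a (.unit U) U
  | bind {a x M N V U V' U'} :
      Ev (P.at a) M V → RunVal P a V U → Ev (P.at a) (N.subst x U) V' → RunVal P a V' U' →
      RunVal P a (.bind x M N) U'
  | req {V W V' U} :
      Ev (P.at .s) (.app V W) V' → RunVal P .s V' U → RunVal P .c (.req V W) U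
  | call {V W V' U} :
      Ev (P.at .c) (.app V W) V' → RunVal P .c V' U → RunVal P .s (.call V W) U
  | gen {a V W V' U} :
      Ev (P.at a) (.app V W) V' → RunVal P a V' U → RunVal P a (.gen (.const a) V W) U
  | genReq {V W U} : RunVal P .c (.req V W) U → RunVal P .c (.gen (.const .s) V W) U
  | genCall {V W U} : RunVal P .s (.call V W) U → RunVal P .s (.gen (.const .c) V W) U

/-- `Run P a M U`: running the term `M` at `a` returns `U`. -/
def Run (P : Program) (a : Side) (M : Tm) (U : Val) : Prop :=
  ∃ V, Ev (P.at a) M V ∧ RunVal P a V U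

theorem Ev.val_inv {Φ : FunMap} {V W : Val} (h : Ev Φ (.val V) W) : W = V := by
  cases h with
  | val => rfl
  | step h _ => cases h

theorem Run.val_iff {a : Side} {V U : Val} : Run P a (.val V) U ↔ RunVal P a V U := by
  constructor
  · rintro ⟨W, h, hr⟩
    rwa [h.val_inv] at hr
  · exact fun h => ⟨V, .val, h⟩

theorem Ev.typing (hP : P.WF D) {a : Side} {M : Tm} {V : Val} {A : Ty} (he : Ev (P.at a) M V)
    (h : Typing D 0 0 [] (.const a) M A) : Typing D 0 0 [] (.const a) (.val V) A := by
  induction he generalizing A with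
  | val => exact h
  | letin _ _ ih1 ih2 =>
    cases h with
    | letin h1 h2 => exact ih2 (h2.subst_head hP.decomp_ok trivial (ih1 h1))
  | step hs _ ih => exact ih (hs.typing hP h)

/-- A closure type is always relocatable and the argument type is so by assumption, so both values
can move to the side of the function. -/
theorem Typing.app_of_remote {a b : Side} {V W : Val} {A B : Ty}
    (h1 : Typing D 0 0 [] (.const a) (.val V) (.clo (.fn A (.const b) B)))
    (h2 : Typing D 0 0 [] (.const a) (.val W) A) (hr : A.Reloc) :
    Typing D 0 0 [] (.const b) (.app V W) B :=
  .app (h1.relocate trivial _) (h2.relocate hr _)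

/-- Every run ends in some `unit U`, whose typing makes `A` relocatable. A remote result can
therefore be typed again at the side of the caller. -/
theorem RunVal.typing (hP : P.WF D) {a : Side} {V U : Val} {A : Ty} (hr : RunVal P a V U)
    (h : Typing D 0 0 [] (.const a) (.val V) (.T A)) :
    Typing D 0 0 [] (.const a) (.val U) A ∧ A.Reloc := by
  induction hr generalizing A with
  | unit => cases h with | unit h hr => exact ⟨h, hr⟩
  | bind he1 _ he2 _ ih1 ih2 =>
    cases h with
    | bind h1 h2 =>
      exact ih2 (he2.typing hP (h2.subst_head hP.decomp_ok trivial (ih1 (he1.typing hP h1)).1))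
  | req he _ ih =>
    cases h with
    | req h1 h2 hA =>
      obtain ⟨h, hr⟩ := ih (he.typing hP (h1.app_of_remote h2 hA))
      exact ⟨h.relocate hr _, hr⟩
  | call he _ ih =>
    cases h with
    | call h1 h2 hA =>
      obtain ⟨h, hr⟩ := ih (he.typing hP (h1.app_of_remote h2 hA))
      exact ⟨h.relocate hr _, hr⟩
  | gen he _ ih =>
    cases h with
    | gen h1 h2 hA => exact ih (he.typing hP (.app h1 h2))
  | genReq _ ih =>
    cases h with
    | gen h1 h2 hA => exact ih (.req h1 h2 hA)
  | genCall _ ih =>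
    cases h with
    | gen h1 h2 hA => exact ih (.call h1 h2 hA)

theorem Run.typing (hP : P.WF D) {a : Side} {M : Tm} {U : Val} {A : Ty} (hr : Run P a M U)
    (h : Typing D 0 0 [] (.const a) M (.T A)) :
    Typing D 0 0 [] (.const a) (.val U) A ∧ A.Reloc := by
  obtain ⟨V, he, hr⟩ := hr
  exact hr.typing hP (he.typing hP h)

/-! ### Movable values -/

/-- Values without computations outside of function bodies and the implicit `unit` of type
abstractions. -/
inductive Movable : Val → Prop where
  | var {x} : Movable (.var x)
  | pair {V W} : Movable V → Movable W → Movable (.pair V W)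
  | clo {Ws F Ls As} : (∀ W ∈ Ws, Movable W) → Movable (.clo Ws F Ls As)
  | tabs {V} : Movable V → Movable (.tabs V)

/-- The second conjunct serves type abstractions: their premise types `unit V`, whose type `T A` is
not relocatable although the type of `V` is. -/
theorem Typing.movable_aux {nl nt : ℕ} {Γ : Ctx} {L : Loc} {M : Tm} {A : Ty}
    (h : Typing D nl nt Γ L M A) :
    (∀ V, M = .val V → A.Reloc → Movable V) ∧ (∀ V, M = .val (.unit V) → Movable V) := by
  induction h with
  | var => exact ⟨by rintro _ ⟨⟩ _; exact .var, by rintro _ ⟨⟩⟩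
  | clo hF hlen _ ih =>
    refine ⟨?_, by rintro _ ⟨⟩⟩
    rintro _ ⟨⟩ _
    refine .clo fun W hW => ?_
    obtain ⟨B, hB⟩ := exists_mem_zip_left hlen hW
    exact (ih _ hB).1 _ rfl (hF.reloc _ (List.of_mem_zip hB).2)
  | pair _ _ ih1 ih2 =>
    exact ⟨by rintro _ ⟨⟩ hr; exact .pair (ih1.1 _ rfl hr.1) (ih2.1 _ rfl hr.2), by rintro _ ⟨⟩⟩
  | tabs _ ih =>
    exact ⟨by rintro _ ⟨⟩ hr; exact .tabs ((ih (.const .c) trivial).2 _ rfl), by rintro _ ⟨⟩⟩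
  | unit _ hr ih =>
    exact ⟨fun _ _ h => h.elim, by rintro _ ⟨⟩; exact ih.1 _ rfl hr⟩
  | bind => exact ⟨fun _ _ h => h.elim, by rintro _ ⟨⟩⟩
  | gen => exact ⟨fun _ _ h => h.elim, by rintro _ ⟨⟩⟩
  | req => exact ⟨fun _ _ h => h.elim, by rintro _ ⟨⟩⟩
  | call => exact ⟨fun _ _ h => h.elim, by rintro _ ⟨⟩⟩
  | letin => exact ⟨by rintro _ ⟨⟩, by rintro _ ⟨⟩⟩
  | proj1 => exact ⟨by rintro _ ⟨⟩, by rintro _ ⟨⟩⟩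
  | proj2 => exact ⟨by rintro _ ⟨⟩, by rintro _ ⟨⟩⟩
  | tapp => exact ⟨by rintro _ ⟨⟩, by rintro _ ⟨⟩⟩
  | lapp => exact ⟨by rintro _ ⟨⟩, by rintro _ ⟨⟩⟩
  | app => exact ⟨by rintro _ ⟨⟩, by rintro _ ⟨⟩⟩

theorem Typing.movable {nl nt : ℕ} {Γ : Ctx} {L : Loc} {V : Val} {A : Ty}
    (h : Typing D nl nt Γ L (.val V) A) (hr : A.Reloc) : Movable V :=
  h.movable_aux.1 V rfl hr

/-! ### Forced computations -/

/-- The monadic forms of values. -/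
def Val.Monadic : Val → Prop
  | .unit _ | .bind _ _ _ | .req _ _ | .call _ _ | .gen _ _ _ => True
  | _ => False

theorem Typing.monadic {L : Loc} {V : Val} {A : Ty} {nl nt : ℕ}
    (h : Typing D nl nt [] L (.val V) (.T A)) : V.Monadic := by
  cases h with
  | var h => cases h
  | _ => trivial

/-- The closed monadic value `V` returns only what the closed value `R` returns. -/
structure Forcing (P : Program) (a : Side) (V R : Val) : Prop where
  monadic : V.Monadic
  subst_left : ∀ x U, V.subst x U = V
  subst_right : ∀ x U, R.subst x U = R
  inst_left : ∀ σl σt, V.inst σl σt = V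
  inst_right : ∀ σl σt, R.inst σl σt = R
  run : ∀ U, RunVal P a V U → RunVal P a R U

/-- `Forced P a M N`: the term `M` arises from `N` when some closed monadic values are replaced
by values to which they have been reduced in advance. -/
inductive Forced (P : Program) (a : Side) : Tm → Tm → Prop where
  | base {V R} : Forcing P a V R → Forced P a (.val V) (.val R)
  | var {x} : Forced P a (.val (.var x)) (.val (.var x))
  | pair {V W V' W'} : Forced P a (.val V) (.val V') → Forced P a (.val W) (.val W') →
      Forced P a (.val (.pair V W)) (.val (.pair V' W'))
  | clo {Ws Ws' F Ls As} : Ws.length = Ws'.length →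
      (∀ p ∈ Ws.zip Ws', Forced P a (.val p.1) (.val p.2)) →
      Forced P a (.val (.clo Ws F Ls As)) (.val (.clo Ws' F Ls As))
  | tabs {V V'} : Forced P a (.val V) (.val V') → Forced P a (.val (.tabs V)) (.val (.tabs V'))
  | unit {V V'} : Forced P a (.val V) (.val V') → Forced P a (.val (.unit V)) (.val (.unit V'))
  | bind {x M N M' N'} : Forced P a M M' → Forced P a N N' →
      Forced P a (.val (.bind x M N)) (.val (.bind x M' N'))
  | req {V W V' W'} : Forced P a (.val V) (.val V') → Forced P a (.val W) (.val W') →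
      Forced P a (.val (.req V W)) (.val (.req V' W'))
  | call {V W V' W'} : Forced P a (.val V) (.val V') → Forced P a (.val W) (.val W') →
      Forced P a (.val (.call V W)) (.val (.call V' W'))
  | gen {L V W V' W'} : Forced P a (.val V) (.val V') → Forced P a (.val W) (.val W') →
      Forced P a (.val (.gen L V W)) (.val (.gen L V' W'))
  | letin {x M N M' N'} : Forced P a M M' → Forced P a N N' →
      Forced P a (.letin x M N) (.letin x M' N')
  | proj {i V V'} : Forced P a (.val V) (.val V') → Forced P a (.proj i V) (.proj i V')
  | app {V W V' W'} : Forced P a (.val V) (.val V') → Forced P a (.val W) (.val W') →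
      Forced P a (.app V W) (.app V' W')
  | tapp {V V' A} : Forced P a (.val V) (.val V') → Forced P a (.tapp V A) (.tapp V' A)
  | lapp {V V' L} : Forced P a (.val V) (.val V') → Forced P a (.lapp V L) (.lapp V' L)

variable {a : Side}

mutual
  theorem Forced.refl_val (P : Program) (a : Side) : ∀ V : Val, Forced P a (.val V) (.val V)
    | .var _ => .var
    | .pair V W => .pair (refl_val P a V) (refl_val P a W)
    | .clo Ws _ _ _ => .clo rfl (refl_list P a Ws)
    | .tabs V => .tabs (refl_val P a V)
    | .unit V => .unit (refl_val P a V)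
    | .bind _ M N => .bind (refl P a M) (refl P a N)
    | .req V W => .req (refl_val P a V) (refl_val P a W)
    | .call V W => .call (refl_val P a V) (refl_val P a W)
    | .gen _ V W => .gen (refl_val P a V) (refl_val P a W)
  theorem Forced.refl_list (P : Program) (a : Side) : ∀ Vs : List Val,
      ∀ p ∈ Vs.zip Vs, Forced P a (.val p.1) (.val p.2)
    | [] => by simp
    | V :: Vs => by
      rw [List.zip_cons_cons, List.forall_mem_cons]
      exact ⟨refl_val P a V, refl_list P a Vs⟩
  theorem Forced.refl (P : Program) (a : Side) : ∀ M : Tm, Forced P a M M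
    | .val V => refl_val P a V
    | .letin _ M N => .letin (refl P a M) (refl P a N)
    | .proj _ V => .proj (refl_val P a V)
    | .app V W => .app (refl_val P a V) (refl_val P a W)
    | .tapp V _ => .tapp (refl_val P a V)
    | .lapp V _ => .lapp (refl_val P a V)
end

/-- Forced computations are closed, so substitution passes over them. -/
theorem Forced.subst {M M' : Tm} {U U' : Val} (h : Forced P a M M')
    (hU : Forced P a (.val U) (.val U')) (x : Name) :
    Forced P a (M.subst x U) (M'.subst x U') := by
  induction h with
  | base h =>
    simp only [Tm.subst, h.subst_left, h.subst_right]
    exact .base h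
  | @var y =>
    by_cases hxy : x = y
    · simpa [Tm.subst, Val.subst, hxy] using hU
    · simpa [Tm.subst, Val.subst, hxy] using Forced.var
  | pair _ _ ih1 ih2 => exact .pair ih1 ih2
  | clo hlen _ ih =>
    simp only [Tm.subst, Val.subst, Val.substList_eq_map]
    refine .clo (by simpa using hlen) fun p hp => ?_
    rw [List.zip_map, List.mem_map] at hp
    obtain ⟨q, hq, rfl⟩ := hp
    exact ih q hq
  | tabs _ ih => exact .tabs ih
  | unit _ ih => exact .unit ih
  | @bind y _ _ _ _ _ h2 ih1 ih2 =>
    refine .bind ih1 ?_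
    split
    · exact h2
    · exact ih2
  | req _ _ ih1 ih2 => exact .req ih1 ih2
  | call _ _ ih1 ih2 => exact .call ih1 ih2
  | gen _ _ ih1 ih2 => exact .gen ih1 ih2
  | letin _ h2 ih1 ih2 =>
    refine .letin ih1 ?_
    split
    · exact h2
    · exact ih2
  | proj _ ih => exact .proj ih
  | app _ _ ih1 ih2 => exact .app ih1 ih2
  | tapp _ ih => exact .tapp ih
  | lapp _ ih => exact .lapp ih

theorem Forced.substs {M M' : Tm} (h : Forced P a M M') {Ws Ws' : List Val}
    (hlen : Ws.length = Ws'.length)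
    (hW : ∀ p ∈ Ws.zip Ws', Forced P a (.val p.1) (.val p.2)) (zs : List Name) :
    Forced P a (M.substs zs Ws) (M'.substs zs Ws') := by
  induction zs generalizing M M' Ws Ws' with
  | nil => exact h
  | cons z zs ih =>
    match Ws, Ws', hlen with
    | [], [], _ => exact h
    | W :: Ws, W' :: Ws', hlen =>
      rw [List.zip_cons_cons, List.forall_mem_cons] at hW
      exact ih (h.subst hW.1 z) (by simpa using hlen) hW.2

theorem Forced.inst {M M' : Tm} (h : Forced P a M M') (σl : ℕ → Loc) (σt : ℕ → Ty) :
    Forced P a (M.inst σl σt) (M'.inst σl σt) := by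
  induction h generalizing σt with
  | base h =>
    simp only [Tm.inst, h.inst_left, h.inst_right]
    exact .base h
  | var => exact .var
  | pair _ _ ih1 ih2 => exact .pair (ih1 _) (ih2 _)
  | clo hlen _ ih =>
    simp only [Tm.inst, Val.inst, Val.instList_eq_map]
    refine .clo (by simpa using hlen) fun p hp => ?_
    rw [List.zip_map, List.mem_map] at hp
    obtain ⟨q, hq, rfl⟩ := hp
    exact ih q hq _
  | tabs _ ih => exact .tabs (ih _)
  | unit _ ih => exact .unit (ih _)
  | bind _ _ ih1 ih2 => exact .bind (ih1 _) (ih2 _)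
  | req _ _ ih1 ih2 => exact .req (ih1 _) (ih2 _)
  | call _ _ ih1 ih2 => exact .call (ih1 _) (ih2 _)
  | gen _ _ ih1 ih2 => exact .gen (ih1 _) (ih2 _)
  | letin _ _ ih1 ih2 => exact .letin (ih1 _) (ih2 _)
  | proj _ ih => exact .proj (ih _)
  | app _ _ ih1 ih2 => exact .app (ih1 _) (ih2 _)
  | tapp _ ih => exact .tapp (ih _)
  | lapp _ ih => exact .lapp (ih _)

/-- The value eliminated by a pure redex is a pair, a closure or a type abstraction, never a monadic
form. Hence it is not itself a forced computation, and the same redex occurs on the other side. -/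
theorem Forced.pureStep {Φ : FunMap} {M M₁ M' : Tm} (h : Forced P a M M')
    (hs : PureStep Φ M M₁) : ∃ M₁', PureStep Φ M' M₁' ∧ Forced P a M₁ M₁' := by
  cases hs with
  | proj1 =>
    cases h with
    | proj h =>
      cases h with
      | base h => exact h.monadic.elim
      | pair h1 h2 => exact ⟨_, .proj1, h1⟩
  | proj2 =>
    cases h with
    | proj h =>
      cases h with
      | base h => exact h.monadic.elim
      | pair h1 h2 => exact ⟨_, .proj2, h2⟩
  | tapp =>
    cases h with
    | tapp h =>
      cases h with
      | base h => exact h.monadic.elim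
      | tabs h => exact ⟨_, .tapp, .unit (h.inst _ _)⟩
  | app hΦ hlen =>
    cases h with
    | app h hV =>
      cases h with
      | base h => exact h.monadic.elim
      | clo hl hWs =>
        exact ⟨_, .app hΦ (hl ▸ hlen), ((refl P a _).substs hl hWs _).subst hV _⟩
  | @lapp _ _ _ _ _ zs V hΦ hlen =>
    cases h with
    | lapp h =>
      cases h with
      | base h => exact h.monadic.elim
      | clo hl hWs =>
        refine ⟨_, .lapp hΦ (hl ▸ hlen), ?_⟩
        have := (refl_val P a V).substs hl hWs zs
        rw [Val.substs_val, Val.substs_val] at this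
        exact this.inst _ _

theorem Forced.ev {Φ : FunMap} {M M' : Tm} {V : Val} (h : Forced P a M M') (he : Ev Φ M V) :
    ∃ V', Ev Φ M' V' ∧ Forced P a (.val V) (.val V') := by
  induction he generalizing M' with
  | @val V =>
    have : ∃ V', M' = .val V' := by cases h <;> exact ⟨_, rfl⟩
    obtain ⟨V', rfl⟩ := this
    exact ⟨V', .val, h⟩
  | letin _ _ ih1 ih2 =>
    cases h with
    | letin h1 h2 =>
      obtain ⟨V', he1, hV⟩ := ih1 h1
      obtain ⟨W', he2, hW⟩ := ih2 (h2.subst hV _)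
      exact ⟨W', .letin he1 he2, hW⟩
  | step hs _ ih =>
    obtain ⟨M₁', hs', h'⟩ := h.pureStep hs
    obtain ⟨V', he', hV⟩ := ih h'
    exact ⟨V', .step hs' he', hV⟩

theorem Movable.eq_of_forced {V V' : Val} (hV : Movable V)
    (h : Forced P a (.val V) (.val V')) : V = V' := by
  induction hV generalizing V' with
  | var =>
    cases h with
    | base h => exact h.monadic.elim
    | var => rfl
  | pair _ _ ih1 ih2 =>
    cases h with
    | base h => exact h.monadic.elim
    | pair h1 h2 => rw [ih1 h1, ih2 h2]
  | @clo Ws _ _ _ _ ih =>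
    cases h with
    | base h => exact h.monadic.elim
    | @clo _ Ws' _ _ _ hlen h =>
      congr 1
      refine List.ext_getElem hlen fun i h1 h2 => ?_
      refine ih _ (List.getElem_mem h1) (h (Ws[i], Ws'[i]) ?_)
      rw [← List.getElem_zip (h := by simp [h1, h2])]
      exact List.getElem_mem _
  | tabs _ ih =>
    cases h with
    | base h => exact h.monadic.elim
    | tabs h => rw [ih h]

theorem Typing.eq_of_forced {nl nt : ℕ} {Γ : Ctx} {L : Loc} {V V' : Val} {A : Ty}
    (h : Typing D nl nt Γ L (.val V) A) (hr : A.Reloc) (hf : Forced P a (.val V) (.val V')) :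
    V = V' :=
  (h.movable hr).eq_of_forced hf

/-- Delaying computations does not change results. -/
theorem Forced.runVal (hP : P.WF D) {V V' U : Val} {A : Ty} (hr : RunVal P a V U)
    (h : Typing D 0 0 [] (.const a) (.val V) (.T A)) (hf : Forced P a (.val V) (.val V')) :
    RunVal P a V' U := by
  induction hr generalizing A V' with
  | unit =>
    cases hf with
    | base hb => exact hb.run _ .unit
    | unit hf =>
      cases h with
      | unit h hr => rw [← h.eq_of_forced hr hf]; exact .unit
  | bind he1 hr1 he2 hr2 ih1 ih2 =>
    cases hf with
    | base hb => exact hb.run _ (.bind he1 hr1 he2 hr2)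
    | bind hM hN =>
      cases h with
      | bind h1 h2 =>
        have t1 := he1.typing hP h1
        obtain ⟨V₁, he1', hf1⟩ := hM.ev he1
        obtain ⟨V₂, he2', hf2⟩ := (hN.subst (Forced.refl_val P _ _) _).ev he2
        have t2 := he2.typing hP (h2.subst_head hP.decomp_ok trivial (hr1.typing hP t1).1)
        exact .bind he1' (ih1 t1 hf1) he2' (ih2 t2 hf2)
  | req he hr _ =>
    cases hf with
    | base hb => exact hb.run _ (.req he hr)
    | req hV hW =>
      cases h with
      | req h1 h2 hA =>
        -- Function and argument have relocatable types, so `Forced` is equality on them and the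
        -- given run applies unchanged.
        rw [← h1.eq_of_forced trivial hV, ← h2.eq_of_forced hA hW]
        exact .req he hr
  | call he hr _ =>
    cases hf with
    | base hb => exact hb.run _ (.call he hr)
    | call hV hW =>
      cases h with
      | call h1 h2 hA =>
        rw [← h1.eq_of_forced trivial hV, ← h2.eq_of_forced hA hW]
        exact .call he hr
  | gen he hr _ =>
    cases hf with
    | base hb => exact hb.run _ (.gen he hr)
    | gen hV hW =>
      cases h with
      | gen h1 h2 hA =>
        rw [← h1.eq_of_forced trivial hV, ← h2.eq_of_forced hA hW]
        exact .gen he hr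
  | genReq hr _ =>
    cases hf with
    | base hb => exact hb.run _ (.genReq hr)
    | gen hV hW =>
      cases h with
      | gen h1 h2 hA =>
        rw [← h1.eq_of_forced trivial hV, ← h2.eq_of_forced hA hW]
        exact .genReq hr
  | genCall hr _ =>
    cases hf with
    | base hb => exact hb.run _ (.genCall hr)
    | gen hV hW =>
      cases h with
      | gen h1 h2 hA =>
        rw [← h1.eq_of_forced trivial hV, ← h2.eq_of_forced hA hW]
        exact .genCall hr

end

/-! ### Evaluation contexts and configurations -/

section
variable {P : Program} {D : Decomp} {a : Side}

theorem ELet.typing_plug {E : ELet} {M : Tm} {A : Ty} {L : Loc}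
    (h : Typing D 0 0 [] L (E.plug M) A) :
    ∃ B, Typing D 0 0 [] L M B ∧
      ∀ M', Typing D 0 0 [] L M' B → Typing D 0 0 [] L (E.plug M') A := by
  induction E generalizing A with
  | hole => exact ⟨A, h, fun _ h => h⟩
  | letin x E N ih =>
    cases h with
    | letin h1 h2 =>
      obtain ⟨B, hM, hB⟩ := ih h1
      exact ⟨B, hM, fun M' h' => .letin (hB M' h') h2⟩

theorem ECtx.typing_plug {E : ECtx} {M : Tm} {A : Ty} {L : Loc}
    (h : Typing D 0 0 [] L (E.plug M) A) :
    ∃ B, Typing D 0 0 [] L M B ∧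
      ∀ M', Typing D 0 0 [] L M' B → Typing D 0 0 [] L (E.plug M') A := by
  induction E generalizing A with
  | ofLet E => exact E.typing_plug h
  | bind x E N ih =>
    cases h with
    | bind h1 h2 =>
      obtain ⟨B, hM, hB⟩ := ih h1
      exact ⟨B, hM, fun N hN => .bind (hB N hN) h2⟩

/-- Every value of `M'` is a value of `M` in which some computations have been forced. -/
def EvForced (P : Program) (a : Side) (M' M : Tm) : Prop :=
  ∀ V, Ev (P.at a) M' V → ∃ V', Ev (P.at a) M V' ∧ Forced P a (.val V) (.val V')

/-- A `let` substitutes the value without running it, so a computation forced in the hole may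
reappear anywhere in the resulting value. Only `Forced`, not equality, can be preserved here. -/
theorem EvForced.plug_let {M M' : Tm} (h : EvForced P a M' M) (E : ELet) :
    EvForced P a (E.plug M') (E.plug M) := by
  induction E with
  | hole => exact h
  | letin x E N ih =>
    intro V hV
    cases hV with
    | letin h1 h2 =>
      obtain ⟨V₁, he1, hf1⟩ := ih _ h1
      obtain ⟨V₂, he2, hf2⟩ := ((Forced.refl P a N).subst hf1 x).ev h2
      exact ⟨V₂, .letin he1 he2, hf2⟩
    | step hs => cases hs

/-- The innermost layer, made of `let`s, yields values related by `Forced`, which return the same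
result when run. The `do` frames around it see only that result. -/
theorem EvForced.run_plug (hP : P.WF D) {M M' : Tm} (h : EvForced P a M' M) {E : ECtx} {A : Ty}
    {U : Val} (ht : Typing D 0 0 [] (.const a) (E.plug M') (.T A))
    (hr : Run P a (E.plug M') U) : Run P a (E.plug M) U := by
  induction E generalizing A U with
  | ofLet E =>
    obtain ⟨V, he, hr⟩ := hr
    obtain ⟨V', he', hf⟩ := h.plug_let E V he
    exact ⟨V', he', hf.runVal hP hr (he.typing hP ht)⟩
  | bind x E N ih =>
    cases ht with
    | bind h1 h2 =>
      rw [ECtx.plug, Run.val_iff] at hr ⊢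
      cases hr with
      | bind he1 hr1 he2 hr2 =>
        obtain ⟨V₁, he1', hr1'⟩ := ih h1 ⟨_, he1, hr1⟩
        exact .bind he1' hr1' he2 hr2

theorem EvForced.of_ev {M M' : Tm} (h : ∀ V, Ev (P.at a) M' V → Ev (P.at a) M V) :
    EvForced P a M' M :=
  fun V hV => ⟨V, h V hV, Forced.refl_val P a V⟩

/-- This serves every step that rewrites a monadic value `R` in the hole: `R` is already a value for
`Ev`, so whatever `M'` evaluates to is a forced version of it. -/
theorem EvForced.of_run (hP : P.WF D) {M' : Tm} {R : Val} {A : Ty} {L : Loc}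
    (ht : Typing D 0 0 [] (.const a) M' (.T A)) (hR : Typing D 0 0 [] L (.val R) (.T A))
    (h : ∀ U, Run P a M' U → RunVal P a R U) : EvForced P a M' (.val R) := by
  intro V hV
  have hVt := hV.typing hP ht
  refine ⟨R, .val, .base ⟨hVt.monadic, fun x U => ?_, fun x U => ?_, fun σl σt => ?_,
    fun σl σt => ?_, fun U hU => h U ⟨V, hV, hU⟩⟩⟩
  · simpa [Tm.subst] using hVt.subst_eq_self (x := x) rfl U
  · simpa [Tm.subst] using hR.subst_eq_self (x := x) rfl U
  · simpa [Tm.inst] using hVt.inst_eq_self (σl := σl) (σt := σt) (fun i hi => absurd hi (by omega))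
      (fun i hi => absurd hi (by omega))
  · simpa [Tm.inst] using hR.inst_eq_self (σl := σl) (σt := σt) (fun i hi => absurd hi (by omega))
      (fun i hi => absurd hi (by omega))

-- Local steps: subject reduction and backward evaluation

theorem LocalStep.typing (hP : P.WF D) {M M' : Tm} {A : Ty} (hs : LocalStep (P.at a) M M')
    (h : Typing D 0 0 [] (.const a) M A) : Typing D 0 0 [] (.const a) M' A := by
  have hD := hP.decomp_ok
  cases hs with
  | letin => cases h with | letin h1 h2 => exact h2.subst_head hD trivial h1
  | bind =>
    cases h with
    | bind h1 h2 => cases h1 with | unit h1 _ => exact h2.subst_head hD trivial h1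
  | proj1 => exact PureStep.proj1.typing hP h
  | proj2 => exact PureStep.proj2.typing hP h
  | tapp => exact PureStep.tapp.typing hP h
  | app h1 h2 => exact (PureStep.app h1 h2).typing hP h
  | lapp h1 h2 => exact (PureStep.lapp h1 h2).typing hP h

/-- `Ev` performs all local redexes except the monadic one, which is a value for `Ev`; reducing that
one is a forced computation. -/
theorem LocalStep.evForced (hP : P.WF D) {M M' : Tm} {A : Ty} (hs : LocalStep (P.at a) M M')
    (h : Typing D 0 0 [] (.const a) M A) : EvForced P a M' M := by
  have ht := hs.typing hP h
  cases hs with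
  | letin => exact .of_ev fun V hV => .letin .val hV
  | bind =>
    have hA : ∃ B, A = .T B := by cases h; exact ⟨_, rfl⟩
    obtain ⟨B, rfl⟩ := hA
    exact .of_run hP ht h fun U ⟨V, he, hr⟩ => .bind .val .unit he hr
  | proj1 => exact .of_ev fun V hV => .step .proj1 hV
  | proj2 => exact .of_ev fun V hV => .step .proj2 hV
  | tapp => exact .of_ev fun V hV => .step .tapp hV
  | app h1 h2 => exact .of_ev fun V hV => .step (.app h1 h2) hV
  | lapp h1 h2 => exact .of_ev fun V hV => .step (.lapp h1 h2) hV

-- Configurations: typing and big-step evaluation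

/-- `StackTyping D A a Δ Δ' B`: a computation of type `T B` running at `a`, with the stack `Δ` at
`a` and the stack `Δ'` at the other side, is part of a program of type `T A`. -/
inductive StackTyping (D : Decomp) (A : Ty) : Side → Stack → Stack → Ty → Prop where
  | nil : StackTyping D A .c [] [] A
  | cons {a b E Δa Δb B C} : a ≠ b →
      (∀ M, Typing D 0 0 [] (.const b) M (.T B) → Typing D 0 0 [] (.const b) (E.plug M) (.T C)) →
      StackTyping D A b Δb Δa C → StackTyping D A a Δa (E :: Δb) B

/-- Typing of configurations. -/
def ConfTyping (D : Decomp) (A : Ty) : Conf → Prop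
  | .client M Δc Δs => ∃ B, Typing D 0 0 [] (.const .c) M (.T B) ∧ StackTyping D A .c Δc Δs B
  | .server Δc M Δs => ∃ B, Typing D 0 0 [] (.const .s) M (.T B) ∧ StackTyping D A .s Δs Δc B

/-- Replacing the term in the hole of an evaluation context, with all that is needed of its
typing. -/
theorem typing_replace {E : ECtx} {M M' : Tm} {A : Ty}
    (h : Typing D 0 0 [] (.const a) (E.plug M) A)
    (h' : ∀ B, Typing D 0 0 [] (.const a) M B → Typing D 0 0 [] (.const a) M' B) :
    Typing D 0 0 [] (.const a) (E.plug M') A := by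
  obtain ⟨B, hM, hE⟩ := E.typing_plug h
  exact hE M' (h' B hM)

theorem Step.confTyping (hP : P.WF D) {A : Ty} {C C' : Conf} (hs : Step P C C')
    (h : ConfTyping D A C) : ConfTyping D A C' := by
  cases hs with
  | localC hs =>
    obtain ⟨B, h, hΔ⟩ := h
    exact ⟨B, typing_replace h fun _ => hs.typing (a := .c) hP, hΔ⟩
  | localS hs =>
    obtain ⟨B, h, hΔ⟩ := h
    exact ⟨B, typing_replace h fun _ => hs.typing (a := .s) hP, hΔ⟩
  | req =>
    obtain ⟨B, h, hΔ⟩ := h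
    obtain ⟨B', h, hE⟩ := ECtx.typing_plug h
    cases h with
    | req h1 h2 hA => exact ⟨_, h1.app_of_remote h2 hA, .cons (by simp) hE hΔ⟩
  | call =>
    obtain ⟨B, h, hΔ⟩ := h
    obtain ⟨B', h, hE⟩ := ECtx.typing_plug h
    cases h with
    | call h1 h2 hA => exact ⟨_, h1.app_of_remote h2 hA, .cons (by simp) hE hΔ⟩
  | unitC =>
    obtain ⟨B, h, hΔ⟩ := h
    cases h with
    | unit h hr =>
      cases hΔ with
      | @cons _ b _ _ _ _ C hab hE hΔ =>
        cases b with
        | c => exact absurd rfl hab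
        | s => exact ⟨C, hE _ (.unit (h.relocate hr _) hr), hΔ⟩
  | unitS =>
    obtain ⟨B, h, hΔ⟩ := h
    cases h with
    | unit h hr =>
      cases hΔ with
      | @cons _ b _ _ _ _ C hab hE hΔ =>
        cases b with
        | s => exact absurd rfl hab
        | c => exact ⟨C, hE _ (.unit (h.relocate hr _) hr), hΔ⟩
  -- This step does not occur in a typed configuration: control alternates and the outermost
  -- computation belongs to the client, so the server never runs with both stacks empty.
  | unitSE =>
    obtain ⟨B, _, hΔ⟩ := h
    cases hΔ
  | genCC =>
    obtain ⟨B, h, hΔ⟩ := h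
    exact ⟨B, typing_replace h fun _ h => by cases h with | gen h1 h2 => exact .app h1 h2, hΔ⟩
  | genSC =>
    obtain ⟨B, h, hΔ⟩ := h
    exact ⟨B, typing_replace h fun _ h => by cases h with | gen h1 h2 hA => exact .req h1 h2 hA, hΔ⟩
  | genCS =>
    obtain ⟨B, h, hΔ⟩ := h
    exact ⟨B, typing_replace h fun _ h => by
      cases h with | gen h1 h2 hA => exact .call h1 h2 hA, hΔ⟩
  | genSS =>
    obtain ⟨B, h, hΔ⟩ := h
    exact ⟨B, typing_replace h fun _ h => by cases h with | gen h1 h2 => exact .app h1 h2, hΔ⟩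

/-- Big-step evaluation of configurations. -/
inductive ConfRun (P : Program) : Conf → Val → Prop where
  | done {M U} : Run P .c M U → ConfRun P (.client M [] []) U
  | client {M E Δc Δs U₁ U} : Run P .c M U₁ →
      ConfRun P (.server Δc (E.plug (.val (.unit U₁))) Δs) U →
      ConfRun P (.client M Δc (E :: Δs)) U
  | server {M E Δc Δs U₁ U} : Run P .s M U₁ →
      ConfRun P (.client (E.plug (.val (.unit U₁))) Δc Δs) U →
      ConfRun P (.server (E :: Δc) M Δs) U

theorem ConfRun.replace_client {M M' : Tm} {Δc Δs : Stack} {U : Val}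
    (h : ConfRun P (.client M' Δc Δs) U) (hr : ∀ U, Run P .c M' U → Run P .c M U) :
    ConfRun P (.client M Δc Δs) U := by
  cases h with
  | done h => exact .done (hr _ h)
  | client h h' => exact .client (hr _ h) h'

theorem ConfRun.replace_server {M M' : Tm} {Δc Δs : Stack} {U : Val}
    (h : ConfRun P (.server Δc M' Δs) U) (hr : ∀ U, Run P .s M' U → Run P .s M U) :
    ConfRun P (.server Δc M Δs) U := by
  cases h with
  | server h h' => exact .server (hr _ h) h'

theorem run_gen_local {E : ECtx} {V W U : Val} {A : Ty} (hP : P.WF D)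
    (h : Typing D 0 0 [] (.const a) (E.plug (.val (.gen (.const a) V W))) (.T A))
    (hr : Run P a (E.plug (.app V W)) U) :
    Run P a (E.plug (.val (.gen (.const a) V W))) U := by
  obtain ⟨B, h, hE⟩ := ECtx.typing_plug h
  cases h with
  | gen h1 h2 hA hL =>
    exact (EvForced.of_run hP (.app h1 h2) (.gen h1 h2 hA hL)
      fun U ⟨V, he, hr⟩ => .gen he hr).run_plug hP (hE _ (.app h1 h2)) hr

/-- Backward closure. Steps within one side replace the term in the hole by one whose values it can
only have forced. A return step is one rule of `ConfRun`. For `req` and `call` the evaluation after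
the step splits into the remote run and the caller resumed with its result. -/
theorem ConfRun.of_step (hP : P.WF D) {A : Ty} {C C' : Conf} {U : Val} (hs : Step P C C')
    (h : ConfTyping D A C) (hr : ConfRun P C' U) : ConfRun P C U := by
  cases hs with
  | localC hs =>
    obtain ⟨B, h, _⟩ := h
    obtain ⟨_, hM, _⟩ := ECtx.typing_plug h
    exact hr.replace_client fun U => (hs.evForced (a := .c) hP hM).run_plug hP
      (typing_replace h fun _ => hs.typing (a := .c) hP)
  | localS hs =>
    obtain ⟨B, h, _⟩ := h
    obtain ⟨_, hM, _⟩ := ECtx.typing_plug h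
    exact hr.replace_server fun U => (hs.evForced (a := .s) hP hM).run_plug hP
      (typing_replace h fun _ => hs.typing (a := .s) hP)
  | req =>
    obtain ⟨B, h, _⟩ := h
    obtain ⟨B', hM, hE⟩ := ECtx.typing_plug h
    cases hr with
    | @server _ _ _ _ U₁ _ hr1 hr2 =>
      cases hM with
      | req h1 h2 hA =>
        obtain ⟨ht, hB⟩ := hr1.typing hP (h1.app_of_remote h2 hA)
        have hu : Typing D 0 0 [] (.const .c) (.val (.unit U₁)) (.T _) :=
          .unit (ht.relocate hB _) hB
        -- The resumed caller has `unit U₁` in the hole, which is a forced version of `req(V, W)`: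
        -- the remote run `hr1` is what shows that the request returns `U₁`.
        refine hr2.replace_client fun U => (EvForced.of_run hP hu (.req h1 h2 hA)
          fun U hU => ?_).run_plug hP (hE _ hu)
        obtain ⟨V', he, hr⟩ := hr1
        cases Run.val_iff.mp hU
        exact .req he hr
  | call =>
    obtain ⟨B, h, _⟩ := h
    obtain ⟨B', hM, hE⟩ := ECtx.typing_plug h
    cases hM with
    | call h1 h2 hA =>
      cases hr with
      | @client _ _ _ _ U₁ _ hr1 hr2 =>
        obtain ⟨ht, hB⟩ := hr1.typing hP (h1.app_of_remote h2 hA)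
        have hu : Typing D 0 0 [] (.const .s) (.val (.unit U₁)) (.T _) :=
          .unit (ht.relocate hB _) hB
        refine hr2.replace_server fun U => (EvForced.of_run hP hu (.call h1 h2 hA)
          fun U hU => ?_).run_plug hP (hE _ hu)
        obtain ⟨V', he, hr⟩ := hr1
        cases Run.val_iff.mp hU
        exact .call he hr
  | unitC => exact .client (Run.val_iff.mpr .unit) hr
  | unitS => exact .server (Run.val_iff.mpr .unit) hr
  | unitSE =>
    obtain ⟨B, _, hΔ⟩ := h
    cases hΔ
  | genCC =>
    obtain ⟨B, h, _⟩ := h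
    exact hr.replace_client fun U => run_gen_local hP h
  | genSS =>
    obtain ⟨B, h, _⟩ := h
    exact hr.replace_server fun U => run_gen_local hP h
  | genSC =>
    obtain ⟨B, h, _⟩ := h
    obtain ⟨B', hM, hE⟩ := ECtx.typing_plug h
    cases hM with
    | gen h1 h2 hA hL =>
      exact hr.replace_client fun U => (EvForced.of_run hP (.req h1 h2 hA) (.gen h1 h2 hA hL)
        fun U hU => .genReq (Run.val_iff.mp hU)).run_plug hP (hE _ (.req h1 h2 hA))
  | genCS =>
    obtain ⟨B, h, _⟩ := h
    obtain ⟨B', hM, hE⟩ := ECtx.typing_plug h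
    cases hM with
    | gen h1 h2 hA hL =>
      exact hr.replace_server fun U => (EvForced.of_run hP (.call h1 h2 hA) (.gen h1 h2 hA hL)
        fun U hU => .genCall (Run.val_iff.mp hU)).run_plug hP (hE _ (.call h1 h2 hA))

/-- A program that reduces to `unit V` returns `V` in the big-step semantics. -/
theorem run_of_steps (hP : P.WF D) {M : Tm} {A : Ty} {V : Val}
    (hM : Typing D 0 0 [] (.const .c) M (.T A))
    (hred : Relation.ReflTransGen (Step P) (.client M [] []) (.client (.val (.unit V)) [] [])) :
    Run P .c M V := by
  have key : ∀ C, Relation.ReflTransGen (Step P) C (.client (.val (.unit V)) [] []) →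
      ConfTyping D A C → ConfRun P C V := by
    intro C hC
    induction hC using Relation.ReflTransGen.head_induction_on with
    | refl => exact fun _ => .done (Run.val_iff.mpr .unit)
    | head hs _ ih => exact fun h => .of_step hP hs h (ih (hs.confTyping hP h))
  cases key _ hred ⟨A, hM, .nil⟩ with
  | done h => exact h

end

/-! ### Compilation and substitution -/

theorem Loc.comp_subst_tm (L : Loc) (x : Name) (u : UVal) :
    L.comp.subst (.tm x) u = L.comp := by
  match L with
  | .const .c => rfl
  | .const .s => rfl
  | .var l => simp [Loc.comp, UVal.subst]

theorem UVal.substList_eq_map (vs : List UVal) (x : UVar) (u : UVal) :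
    UVal.substList vs x u = vs.map (fun v => v.subst x u) := by
  induction vs with
  | nil => rfl
  | cons v vs ih => simp [UVal.substList, ih]

theorem remoteCall_subst (v w : UVal) (x : UVar) (u : UVal) :
    (remoteCall v w).subst x u = remoteCall (v.subst x u) (w.subst x u) := by
  simp [remoteCall, sendThen, UVal.subst, UTm.subst, UVal.substList]

/-- The fixed variable `tm 0` may clash with a source variable, but it binds only in the trailing
`unit x` and in the continuation `loop ()`, where no compiled subterm occurs. So it captures
nothing. -/
theorem genCall_subst (a : Side) (l v w : UVal) (x : UVar) (u : UVal) :
    (genCall a l v w).subst x u = genCall a (l.subst x u) (v.subst x u) (w.subst x u) := by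
  by_cases hx : x = .tm 0 <;> cases a <;>
    simp [genCall, bindUnit, ifClient, UVal.subst, UTm.subst, Branches.subst, hx, remoteCall_subst]

mutual
  theorem Val.comp_subst (a : Side) (x : Name) (U : Val) : ∀ V : Val,
      (V.subst x U).comp a = (V.comp a).subst (.tm x) (U.comp a)
    | .var y => by by_cases h : x = y <;> simp [Val.subst, Val.comp, UVal.subst, h]
    | .pair V W => by
      simp [Val.subst, Val.comp, UVal.subst, Val.comp_subst a x U V,
        Val.comp_subst a x U W]
    | .clo Ws _ Ls _ => by
      have h : Ls.map ((fun v => v.subst (.tm x) (U.comp a)) ∘ Loc.comp) = Ls.map Loc.comp :=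
        List.map_congr_left fun L _ => Loc.comp_subst_tm L x _
      simp only [Val.subst, Val.comp, UVal.subst, Val.comp_substList a x U Ws,
        UVal.substList_eq_map, List.map_append, List.map_map, h]
    | .tabs V => by simp [Val.subst, Val.comp, Val.comp_subst a x U V]
    | .unit V => by simp [Val.subst, Val.comp, UVal.subst, Val.comp_subst a x U V]
    | .bind y M N => by
      by_cases h : x = y <;>
        simp [Val.subst, Val.comp, UVal.subst, h, Tm.comp_subst a x U M, Tm.comp_subst a x U N]
      subst h
      exact Tm.comp_subst a x U M
    | .req V W => by
      simp [Val.subst, Val.comp, remoteCall_subst, Val.comp_subst a x U V, Val.comp_subst a x U W]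
    | .call V W => by
      simp [Val.subst, Val.comp, remoteCall_subst, Val.comp_subst a x U V, Val.comp_subst a x U W]
    | .gen L V W => by
      simp [Val.subst, Val.comp, genCall_subst, Loc.comp_subst_tm, Val.comp_subst a x U V,
        Val.comp_subst a x U W]
  theorem Val.comp_substList (a : Side) (x : Name) (U : Val) : ∀ Vs : List Val,
      Val.compList a (Val.substList Vs x U) = UVal.substList (Val.compList a Vs) (.tm x) (U.comp a)
    | [] => rfl
    | V :: Vs => by
      simp [Val.substList, Val.compList, UVal.substList, Val.comp_subst a x U V,
        Val.comp_substList a x U Vs]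
  theorem Tm.comp_subst (a : Side) (x : Name) (U : Val) : ∀ M : Tm,
      (M.subst x U).comp a = (M.comp a).subst (.tm x) (U.comp a)
    | .val V => by simp [Tm.subst, Tm.comp, UTm.subst, Val.comp_subst a x U V]
    | .letin y M N => by
      by_cases h : x = y <;>
        simp [Tm.subst, Tm.comp, UTm.subst, h, Tm.comp_subst a x U M, Tm.comp_subst a x U N]
      subst h
      exact Tm.comp_subst a x U M
    | .proj _ V => by simp [Tm.subst, Tm.comp, UTm.subst, Val.comp_subst a x U V]
    | .app V W => by
      simp [Tm.subst, Tm.comp, UTm.subst, Val.comp_subst a x U V, Val.comp_subst a x U W]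
    | .tapp V _ => by simp [Tm.subst, Tm.comp, UTm.subst, UVal.subst, Val.comp_subst a x U V]
    | .lapp V L => by
      simp [Tm.subst, Tm.comp, UTm.subst, Loc.comp_subst_tm, Val.comp_subst a x U V]
end

theorem Tm.comp_substs (a : Side) (M : Tm) (zs : List Name) (Ws : List Val) :
    (M.substs zs Ws).comp a = (M.comp a).substs (zs.map UVar.tm) (Ws.map (Val.comp a)) := by
  simp only [Tm.substs, UTm.substs, List.zip_map]
  induction zs.zip Ws generalizing M with
  | nil => rfl
  | cons p ps ih => simp only [List.foldl_cons, List.map_cons, ih, Tm.comp_subst]; rfl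

theorem UTm.substs_append (m : UTm) {xs ys : List UVar} {vs ws : List UVal}
    (h : xs.length = vs.length) :
    m.substs (xs ++ ys) (vs ++ ws) = (m.substs xs vs).substs ys ws := by
  simp only [UTm.substs, List.zip_append h, List.foldl_append]

/-! ### Compilation and instantiation -/

theorem Loc.comp_inst_subst {k : ℕ} {u : UVal} {σ σ' : ℕ → Loc}
    (h : ∀ i, (σ' i).comp = (σ i).comp.subst (.loc k) u) (L : Loc) :
    (L.subst σ').comp = (L.subst σ).comp.subst (.loc k) u := by
  match L with
  | .const .c => rfl
  | .const .s => rfl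
  | .var i => exact h i

mutual
  -- Terms have no location binders, since `Λ l` occurs only at the head of a code. So `σ` is never
  -- lifted, and substituting for `x_l` in the target can be absorbed into the instantiation. The
  -- type substitutions are unrelated because types are erased.
  theorem Val.comp_inst_subst {k : ℕ} {u : UVal} {σ σ' : ℕ → Loc} (a : Side)
      (h : ∀ i, (σ' i).comp = (σ i).comp.subst (.loc k) u) : ∀ (V : Val) (σt σt' : ℕ → Ty),
      (V.inst σ' σt').comp a = ((V.inst σ σt).comp a).subst (.loc k) u
    | .var y, _, _ => by simp [Val.inst, Val.comp, UVal.subst]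
    | .pair V W, σt, σt' => by
      simp [Val.inst, Val.comp, UVal.subst, Val.comp_inst_subst a h V σt σt',
        Val.comp_inst_subst a h W σt σt']
    | .clo Ws _ Ls _, σt, σt' => by
      simp [Val.inst, Val.comp, UVal.subst, Val.comp_instList_subst a h Ws σt σt',
        UVal.substList_eq_map, Loc.comp_inst_subst h]
    | .tabs V, σt, σt' => by
      simp [Val.inst, Val.comp, Val.comp_inst_subst a h V (Ty.liftT σt) (Ty.liftT σt')]
    | .unit V, σt, σt' => by
      simp [Val.inst, Val.comp, UVal.subst, Val.comp_inst_subst a h V σt σt']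
    | .bind y M N, σt, σt' => by
      simp [Val.inst, Val.comp, UVal.subst, Tm.comp_inst_subst a h M σt σt',
        Tm.comp_inst_subst a h N σt σt']
    | .req V W, σt, σt' => by
      simp [Val.inst, Val.comp, remoteCall_subst, Val.comp_inst_subst a h V σt σt',
        Val.comp_inst_subst a h W σt σt']
    | .call V W, σt, σt' => by
      simp [Val.inst, Val.comp, remoteCall_subst, Val.comp_inst_subst a h V σt σt',
        Val.comp_inst_subst a h W σt σt']
    | .gen L V W, σt, σt' => by
      simp [Val.inst, Val.comp, genCall_subst, Loc.comp_inst_subst h,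
        Val.comp_inst_subst a h V σt σt', Val.comp_inst_subst a h W σt σt']
  theorem Val.comp_instList_subst {k : ℕ} {u : UVal} {σ σ' : ℕ → Loc} (a : Side)
      (h : ∀ i, (σ' i).comp = (σ i).comp.subst (.loc k) u) : ∀ (Vs : List Val) (σt σt' : ℕ → Ty),
      Val.compList a (Val.instList σ' σt' Vs)
        = UVal.substList (Val.compList a (Val.instList σ σt Vs)) (.loc k) u
    | [], _, _ => rfl
    | V :: Vs, σt, σt' => by
      simp [Val.instList, Val.compList, UVal.substList, Val.comp_inst_subst a h V σt σt',
        Val.comp_instList_subst a h Vs σt σt']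
  theorem Tm.comp_inst_subst {k : ℕ} {u : UVal} {σ σ' : ℕ → Loc} (a : Side)
      (h : ∀ i, (σ' i).comp = (σ i).comp.subst (.loc k) u) : ∀ (M : Tm) (σt σt' : ℕ → Ty),
      (M.inst σ' σt').comp a = ((M.inst σ σt).comp a).subst (.loc k) u
    | .val V, σt, σt' => by
      simp [Tm.inst, Tm.comp, UTm.subst, Val.comp_inst_subst a h V σt σt']
    | .letin y M N, σt, σt' => by
      simp [Tm.inst, Tm.comp, UTm.subst, Tm.comp_inst_subst a h M σt σt',
        Tm.comp_inst_subst a h N σt σt']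
    | .proj _ V, σt, σt' => by
      simp [Tm.inst, Tm.comp, UTm.subst, Val.comp_inst_subst a h V σt σt']
    | .app V W, σt, σt' => by
      simp [Tm.inst, Tm.comp, UTm.subst, Val.comp_inst_subst a h V σt σt',
        Val.comp_inst_subst a h W σt σt']
    | .tapp V _, σt, σt' => by
      simp [Tm.inst, Tm.comp, UTm.subst, UVal.subst, Val.comp_inst_subst a h V σt σt']
    | .lapp V L, σt, σt' => by
      simp [Tm.inst, Tm.comp, UTm.subst, Loc.comp_inst_subst h, Val.comp_inst_subst a h V σt σt']
end

mutual
  theorem Val.comp_inst_var (a : Side) : ∀ (V : Val) (σt : ℕ → Ty),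
      (V.inst Loc.var σt).comp a = V.comp a
    | .var y, _ => rfl
    | .pair V W, σt => by
      simp [Val.inst, Val.comp, Val.comp_inst_var a V σt,
        Val.comp_inst_var a W σt]
    | .clo Ws _ Ls _, σt => by simp [Val.inst, Val.comp, Val.comp_instList_var a Ws σt]
    | .tabs V, σt => by simp [Val.inst, Val.comp, Val.comp_inst_var a V (Ty.liftT σt)]
    | .unit V, σt => by simp [Val.inst, Val.comp, Val.comp_inst_var a V σt]
    | .bind y M N, σt => by
      simp [Val.inst, Val.comp, Tm.comp_inst_var a M σt, Tm.comp_inst_var a N σt]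
    | .req V W, σt => by
      simp [Val.inst, Val.comp, Val.comp_inst_var a V σt,
        Val.comp_inst_var a W σt]
    | .call V W, σt => by
      simp [Val.inst, Val.comp, Val.comp_inst_var a V σt,
        Val.comp_inst_var a W σt]
    | .gen L V W, σt => by
      simp [Val.inst, Val.comp, Val.comp_inst_var a V σt,
        Val.comp_inst_var a W σt]
  theorem Val.comp_instList_var (a : Side) : ∀ (Vs : List Val) (σt : ℕ → Ty),
      Val.compList a (Val.instList Loc.var σt Vs) = Val.compList a Vs
    | [], _ => rfl
    | V :: Vs, σt => by
      simp [Val.instList, Val.compList, Val.comp_inst_var a V σt, Val.comp_instList_var a Vs σt]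
  theorem Tm.comp_inst_var (a : Side) : ∀ (M : Tm) (σt : ℕ → Ty),
      (M.inst Loc.var σt).comp a = M.comp a
    | .val V, σt => by simp [Tm.inst, Tm.comp, Val.comp_inst_var a V σt]
    | .letin y M N, σt => by
      simp [Tm.inst, Tm.comp, Tm.comp_inst_var a M σt, Tm.comp_inst_var a N σt]
    | .proj _ V, σt => by simp [Tm.inst, Tm.comp, Val.comp_inst_var a V σt]
    | .app V W, σt => by
      simp [Tm.inst, Tm.comp, Val.comp_inst_var a V σt, Val.comp_inst_var a W σt]
    | .tapp V _, σt => by simp [Tm.inst, Tm.comp, Val.comp_inst_var a V σt]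
    | .lapp V L, σt => by simp [Tm.inst, Tm.comp, Val.comp_inst_var a V σt]
end

/-- Only the instances of the location variables in scope matter for the compilation. -/
theorem Typing.comp_inst_congr {D : Decomp} {nl nt : ℕ} {Γ : Ctx} {L : Loc} {M : Tm} {A : Ty}
    (h : Typing D nl nt Γ L M A) (a : Side) {σl σl' : ℕ → Loc} (hl : ∀ i < nl, σl i = σl' i)
    (σt σt' : ℕ → Ty) : (M.inst σl σt).comp a = (M.inst σl' σt').comp a := by
  induction h generalizing σt σt' with
  | var => rfl
  | letin _ _ ih1 ih2 => simp [Tm.inst, Tm.comp, ih1 σt σt', ih2 σt σt']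
  | clo hF hlen _ ih =>
    obtain ⟨_, _, _, _, _, hLs, _⟩ := hF.exists_def
    simp only [Tm.inst, Val.inst, Tm.comp, Val.comp, Val.instList_eq_map, Val.compList_eq_map,
      List.map_map]
    congr 3
    · exact List.map_congr_left fun L hL => by
        simp only [Function.comp_apply, Loc.subst_congr (hLs L hL) hl]
    · refine List.map_congr_left fun W hW => ?_
      obtain ⟨B, hB⟩ := exists_mem_zip_left hlen hW
      simpa [Tm.inst, Tm.comp] using ih _ hB σt σt'
  | proj1 _ ih => simpa [Tm.inst, Tm.comp] using ih σt σt'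
  | proj2 _ ih => simpa [Tm.inst, Tm.comp] using ih σt σt'
  | pair _ _ ih1 ih2 =>
    simpa [Tm.inst, Tm.comp, Val.inst, Val.comp] using And.intro (ih1 σt σt') (ih2 σt σt')
  | tabs _ ih =>
    simpa [Tm.inst, Tm.comp, Val.inst, Val.comp] using
      ih (.const .c) trivial (Ty.liftT σt) (Ty.liftT σt')
  | tapp _ _ _ ih => simpa [Tm.inst, Tm.comp] using ih σt σt'
  | lapp _ h1 ih =>
    have := ih σt σt'
    simp only [Tm.inst, Tm.comp, UTm.val.injEq] at this ⊢
    rw [this, Loc.subst_congr h1 hl]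
  | unit _ _ ih => simpa [Tm.inst, Tm.comp, Val.inst, Val.comp] using ih σt σt'
  | bind _ _ ih1 ih2 =>
    simp [Tm.inst, Tm.comp, Val.inst, Val.comp, ih1 σt σt', ih2 σt σt']
  | app _ _ ih1 ih2 =>
    simpa [Tm.inst, Tm.comp] using And.intro (ih1 σt σt') (ih2 σt σt')
  | gen _ _ _ h1 ih1 ih2 =>
    have h1' := ih1 σt σt'
    have h2' := ih2 σt σt'
    simp only [Tm.inst, Tm.comp, UTm.val.injEq] at h1' h2'
    simp only [Tm.inst, Tm.comp, Val.inst, Val.comp, h1', h2', Loc.subst_congr h1 hl]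
  | req _ _ _ ih1 ih2 =>
    have hV := ih1 σt σt'
    have hW := ih2 σt σt'
    simp only [Tm.inst, Tm.comp, UTm.val.injEq] at hV hW
    simp only [Tm.inst, Tm.comp, Val.inst, Val.comp, hV, hW]
  | call _ _ _ ih1 ih2 =>
    have hV := ih1 σt σt'
    have hW := ih2 σt σt'
    simp only [Tm.inst, Tm.comp, UTm.val.injEq] at hV hW
    simp only [Tm.inst, Tm.comp, Val.inst, Val.comp, hV, hW]

-- Sequential against simultaneous substitution of locations

/-- Substitution of the locations `Ls` for the location variables `ks`, one after the other. -/
def Loc.substSeq (ks : List ℕ) (Ls : List Loc) (L : Loc) : Loc :=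
  (ks.zip Ls).foldl (fun L p => L.subst (Function.update Loc.var p.1 p.2)) L

theorem Loc.comp_subst_update (k : ℕ) (L' L : Loc) :
    (L.subst (Function.update Loc.var k L')).comp = L.comp.subst (.loc k) L'.comp := by
  match L with
  | .const .c => rfl
  | .const .s => rfl
  | .var i =>
    by_cases h : i = k
    · subst h; simp [Loc.subst, Loc.comp, UVal.subst]
    · simp [Loc.subst, Loc.comp, UVal.subst, Function.update_of_ne h, Ne.symm h]

theorem Tm.comp_substs_loc (a : Side) (M : Tm) (σ : ℕ → Loc) (σt : ℕ → Ty) (ks : List ℕ)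
    (Ls : List Loc) :
    ((M.inst σ σt).comp a).substs (ks.map UVar.loc) (Ls.map Loc.comp)
      = (M.inst (fun i => (σ i).substSeq ks Ls) σt).comp a := by
  simp only [UTm.substs, List.zip_map, Loc.substSeq]
  induction ks.zip Ls generalizing σ with
  | nil => rfl
  | cons p ps ih =>
    simp only [List.map_cons, List.foldl_cons]
    rw [← ih]
    congr 1
    exact (Tm.comp_inst_subst a (fun i => Loc.comp_subst_update p.1 p.2 (σ i)) M σt σt).symm

theorem Loc.substSeq_const (ks : List ℕ) (Ls : List Loc) (b : Side) :
    (Loc.const b).substSeq ks Ls = .const b := by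
  rw [Loc.substSeq]
  induction ks.zip Ls with
  | nil => rfl
  | cons p ps ih => exact ih

theorem Loc.substSeq_of_notMem {i : ℕ} {ks : List ℕ} (h : i ∉ ks) (Ls : List Loc) :
    (Loc.var i).substSeq ks Ls = .var i := by
  induction ks generalizing Ls with
  | nil => rfl
  | cons k ks ih =>
    cases Ls with
    | nil => rfl
    | cons L Ls =>
      simp only [List.mem_cons, not_or] at h
      have := ih h.2 Ls
      rw [Loc.substSeq] at this ⊢
      simpa [Loc.subst, Function.update_of_ne h.1] using this

/-- Distinctness of `ks` keeps the variable intact until its turn, and closedness of the locations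
keeps the result intact afterwards. -/
theorem Loc.substSeq_getElem {ks : List ℕ} {Ls : List Loc} (hks : ks.Nodup)
    (hLs : ∀ L ∈ Ls, L.WF 0) {j : ℕ} (h : j < ks.length) (h' : j < Ls.length) :
    (Loc.var ks[j]).substSeq ks Ls = Ls[j] := by
  induction ks generalizing Ls j with
  | nil => simp at h
  | cons k ks ih =>
    cases Ls with
    | nil => simp at h'
    | cons L Ls =>
      rw [List.nodup_cons] at hks
      rw [List.forall_mem_cons] at hLs
      cases j with
      | zero =>
        obtain ⟨b, rfl⟩ := hLs.1.eq_const
        have := Loc.substSeq_const ks Ls b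
        rw [Loc.substSeq] at this ⊢
        simpa [Loc.subst] using this
      | succ j =>
        have hne : ks[j]'(by simpa using h) ≠ k := by
          intro he
          exact hks.1 (he ▸ List.getElem_mem _)
        have := ih hks.2 hLs.2 (j := j) (by simpa using h) (by simpa using h')
        rw [Loc.substSeq] at this ⊢
        simpa [Loc.subst, Function.update_of_ne hne] using this

/-- The compilation of an instance with closed locations. -/
theorem Typing.comp_substs_loc {D : Decomp} {nl nt : ℕ} {Γ : Ctx} {L : Loc} {M : Tm} {A : Ty}
    (h : Typing D nl nt Γ L M A) (a : Side) {ks : List ℕ} {Ls : List Loc} {σ : ℕ → Loc}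
    (σt : ℕ → Ty) (hσ : ∀ i < nl, (Loc.var i).substSeq ks Ls = σ i) :
    (M.comp a).substs (ks.map UVar.loc) (Ls.map Loc.comp) = (M.inst σ σt).comp a := by
  rw [← Tm.comp_inst_var a M σt, Tm.comp_substs_loc]
  exact h.comp_inst_congr a hσ σt σt

/-- The side enters the compilation only at `gen`, and a movable value contains none. Function
bodies are referred to by name. -/
theorem Movable.comp_eq {V : Val} (h : Movable V) (a b : Side) : V.comp a = V.comp b := by
  induction h with
  | var => rfl
  | pair _ _ ih1 ih2 => simp only [Val.comp, ih1, ih2]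
  | clo _ ih =>
    simp only [Val.comp, Val.compList_eq_map]
    rw [List.map_congr_left ih]
  | tabs _ ih => exact ih

/-! ### Simulation -/

def UProgram.at (p : UProgram) : Side → UFunMap
  | .c => p.client
  | .s => p.server

theorem Program.comp_at (P : Program) (a : Side) (F : FName) :
    P.comp.at a F = (P.at a F).map (FunDef.comp a) := by
  cases a <;> rfl

/-- The first alternative is type application: `(Λα. unit V)[A]` compiles directly to `unit V`. The
other redexes take exactly one target step. -/
theorem PureStep.comp {P : Program} {D : Decomp} (hP : P.WF D) {a : Side} {M M' : Tm} {A : Ty}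
    (hs : PureStep (P.at a) M M') (h : Typing D 0 0 [] (.const a) M A) :
    M.comp a = M'.comp a ∨ ULocalStep (P.comp.at a) (M.comp a) (M'.comp a) := by
  have hD := hP.decomp_ok
  cases hs with
  | proj1 => exact .inr .proj1
  | proj2 => exact .inr .proj2
  | tapp =>
    left
    simp only [Tm.comp, Val.comp, Val.instT, Val.comp_inst_var]
  | @app Ws F Ls As V zs x M hΦ hlen' =>
    right
    cases h with
    | app hV hW =>
      obtain ⟨Bs, A', hA, hF, -, -⟩ := hV.clo_inv
      cases hA
      obtain ⟨L, d, hd, hLs, -, hL, -, -, -, rfl, hty⟩ := hF.exists_def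
      obtain ⟨d', hd', -, -, rfl, hcode⟩ := hΦ
      obtain rfl := hP.lookup_eq hd' hd
      cases hD _ _ _ hd with
      | labs h1 => rw [h1] at hty; cases hty
      | @abs _ _ _ _ M₀ h1 h2 _ _ _ _ _ h8 =>
        rw [h2] at hcode
        cases hcode
        have hf : P.comp.at a F = some (d'.comp a) := by rw [P.comp_at, hd']; rfl
        have hcomp : d'.comp a = ⟨(List.range d'.nl).map UVar.loc ++ d'.zs.map UVar.tm, .tm x,
            M₀.comp a⟩ := by simp only [FunDef.comp, h2]
        rw [hcomp] at hf
        have key := ULocalStep.app (v := V.comp a)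
          (ws := Ls.map Loc.comp ++ Ws.map (Val.comp a)) hf (by simp [hLs, hlen'])
        -- The target substitutes the location arguments, then the environment, then `x`. The first
        -- group becomes the instantiation of the code, the others are substitutions of the source.
        rw [UTm.substs_append _ (by simp [hLs]), h8.comp_substs_loc a (ofList Ty.var As)
          (σ := ofList Loc.var Ls) ?_, ← Tm.comp_substs, ← Tm.comp_subst] at key
        · simpa only [Tm.comp, Val.comp, Val.compList_eq_map] using key
        · intro i hi
          have := Loc.substSeq_getElem (ks := List.range d'.nl) List.nodup_range hL (j := i)
            (by simpa using hi) (by omega)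
          rw [List.getElem_range] at this
          rw [this, ofList_of_lt _ _ (by omega)]
  | @lapp Ws F Ls As b zs V hΦ hlen' =>
    right
    cases h with
    | lapp hV hb =>
      have hbody := hV.llam_body hP hΦ
      obtain ⟨Bs, A', hA, hF, -, -⟩ := hV.clo_inv
      cases hA
      obtain ⟨L, d, hd, hLs, -, hL, -, -, -, rfl, hty⟩ := hF.exists_def
      obtain ⟨d', hd', -, -, rfl, hcode⟩ := hΦ
      obtain rfl := hP.lookup_eq hd' hd
      cases hD _ _ _ hd with
      | abs h1 => rw [h1] at hty; cases hty
      | @labs _ V₀ h1 h2 _ _ _ _ _ h8 =>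
        rw [h2] at hcode
        simp only [OpenCode.inst, OpenCode.llam.injEq] at hcode
        have hf : P.comp.at a F = some (d'.comp a) := by rw [P.comp_at, hd']; rfl
        -- Index `0` is the variable bound by `Λ l`, so the parameters `l̄` are shifted by one.
        have hcomp : d'.comp a = ⟨((List.range d'.nl).map Nat.succ).map UVar.loc
            ++ d'.zs.map UVar.tm, .loc 0, (Tm.val V₀).comp a⟩ := by
          simp only [FunDef.comp, h2, List.map_map]; rfl
        rw [hcomp] at hf
        have key := ULocalStep.app (v := (Loc.const b).comp)
          (ws := Ls.map Loc.comp ++ Ws.map (Val.comp a)) hf (by simp [hLs, hlen'])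
        rw [UTm.substs_append _ (by simp [hLs]), (h8 (.const a) trivial).comp_substs_loc a
          (fun i => (ofList Ty.var As i).shiftL) (σ := liftL (ofList Loc.var Ls)) ?_,
          ← Tm.comp_substs] at key
        · have hinst : ((Tm.inst (liftL (ofList Loc.var Ls))
              (fun i => (ofList Ty.var As i).shiftL) (Tm.val V₀)).substs d'.zs Ws)
              = .val (V.substs d'.zs Ws) := by
            rw [hcode, ← Val.substs_val]; rfl
          rw [hinst] at key
          -- Only index `0` is left free in the body. Replacing it by `b` in the target therefore
          -- agrees with `instL`, which also lowers the other indices.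
          have hlast := hbody.comp_substs_loc a (ks := [0]) (Ls := [.const b])
            (σ := ofList Loc.var [.const b]) Ty.var (by
              intro i hi
              obtain rfl : i = 0 := by omega
              rfl)
          have hlast' : ((Tm.val (V.substs d'.zs Ws)).comp a).subst (.loc 0) (Loc.const b).comp
              = (Tm.val ((V.substs d'.zs Ws).instL (.const b))).comp a := hlast
          rw [hlast'] at key
          simpa only [Tm.comp, Val.comp, Val.compList_eq_map] using key
        · rintro (_ | i) hi
          · exact Loc.substSeq_of_notMem (by simp) Ls
          · have := Loc.substSeq_getElem (ks := (List.range d'.nl).map Nat.succ)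
              (List.nodup_range.map Nat.succ_injective) hL (j := i) (by simpa using hi) (by omega)
            rw [List.getElem_map, List.getElem_range] at this
            rw [this, liftL, ofList_of_lt _ _ (by omega)]
            obtain ⟨b₁, hb₁⟩ := (hL _ (List.getElem_mem (by omega : i < Ls.length))).eq_const
            rw [hb₁]; rfl

-- Target configurations and contexts, symmetric in the two sides

/-- The side other than `a`. -/
def Side.other : Side → Side
  | .c => .s
  | .s => .c

/-- The configuration with `m` at `a` and `n` at the other side. -/
def UConf.mkAt : Side → UTm → UTm → UConf
  | .c, m, n => ⟨m, n⟩
  | .s, m, n => ⟨n, m⟩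

theorem UConf.mkAt_other (a : Side) (m n : UTm) : mkAt a.other m n = mkAt a n m := by
  cases a <;> rfl

theorem UStep.local_at {p : UProgram} {a : Side} {m m' : UTm} (h : ULocalStep (p.at a) m m')
    (e₁ e₂ : UECtx) :
    UStep p (.mkAt a (e₁.plug m) (e₂.plug (.val .loop)))
      (.mkAt a (e₁.plug m') (e₂.plug (.val .loop))) := by
  cases a with
  | c => exact .localC h .loop
  | s => exact .localS h .loop

theorem UStep.comm_at (p : UProgram) (a : Side) (v : UVal) (e₁ e₂ : UECtx) :
    UStep p (.mkAt a (e₁.plug (.val (sendThen v (.val .loop)))) (e₂.plug (.val .loop)))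
      (.mkAt a (e₁.plug (.val .loop)) (e₂.plug (loopCase.subst (.tm 0) v))) := by
  cases a with
  | c => exact .commCS (fun _ => rfl) .loop
  | s => exact .commSC .loop (fun _ => rfl)

/-- Put `let x = [ ] in m` into the hole. -/
def UELet.snocLet (x : UVar) (m : UTm) : UELet → UELet
  | .hole => .letin x .hole m
  | .letin y e n => .letin y (e.snocLet x m) n

/-- Put `let x = [ ] in m` into the hole. -/
def UECtx.snocLet (x : UVar) (m : UTm) : UECtx → UECtx
  | .ofLet e => .ofLet (e.snocLet x m)
  | .bind y e n => .bind y (e.snocLet x m) n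

theorem UELet.plug_snocLet (e : UELet) (x : UVar) (m n : UTm) :
    (e.snocLet x m).plug n = e.plug (.letin x n m) := by
  induction e with
  | hole => rfl
  | letin y e k ih => simp only [snocLet, plug, ih]

theorem UECtx.plug_snocLet (e : UECtx) (x : UVar) (m n : UTm) :
    (e.snocLet x m).plug n = e.plug (.letin x n m) := by
  induction e with
  | ofLet e => exact e.plug_snocLet x m n
  | bind y e k ih => simp only [snocLet, plug, ih]

/-- The evaluation context of a list of monadic continuations, the outermost first. -/
def bindCtx : List (UVar × UTm) → UECtx
  | [] => .ofLet .hole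
  | (x, m) :: k => .bind x (bindCtx k) m

theorem bindCtx_append_plug (k : List (UVar × UTm)) (x : UVar) (m n : UTm) :
    (bindCtx (k ++ [(x, m)])).plug n = (bindCtx k).plug (.val (.bind x n m)) := by
  induction k with
  | nil => rfl
  | cons q k ih => simp only [List.cons_append, bindCtx, UECtx.plug, ih]

section
variable {P : Program} {D : Decomp} {a : Side}

/-- Any context `e` is allowed, because evaluation only adds `let` frames and these fit innermost
everywhere. Running values adds `do` frames, which do not fit inside a `let`, so the later lemmas
are confined to `bindCtx`. -/
theorem Ev.simulate (hP : P.WF D) {M : Tm} {V : Val} {A : Ty} (he : Ev (P.at a) M V)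
    (h : Typing D 0 0 [] (.const a) M A) (e e₂ : UECtx) :
    Relation.ReflTransGen (UStep P.comp)
      (.mkAt a (e.plug (M.comp a)) (e₂.plug (.val .loop)))
      (.mkAt a (e.plug (.val (V.comp a))) (e₂.plug (.val .loop))) := by
  induction he generalizing A e with
  | val => exact .refl
  | @letin x M N V W he1 _ ih1 ih2 =>
    cases h with
    | letin h1 h2 =>
      have s1 := ih1 h1 (e.snocLet (.tm x) (N.comp a))
      rw [UECtx.plug_snocLet, UECtx.plug_snocLet] at s1
      have s2 := ih2 (h2.subst_head hP.decomp_ok trivial (he1.typing hP h1)) e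
      rw [Tm.comp_subst] at s2
      exact (s1.tail (UStep.local_at .letin e e₂)).trans s2
  | step hs _ ih =>
    have s := ih (hs.typing hP h) e
    rcases hs.comp hP h with heq | hstep
    · rw [heq]; exact s
    · exact .head (UStep.local_at hstep e e₂) s

/-- A remote call, given the evaluation of the call at the other side. -/
theorem simulate_remoteCall (p : UProgram) {v w u : UVal} (hv : v.subst (.tm 2) w = v)
    (k k₂ : List (UVar × UTm))
    (h : ∀ k k₂ : List (UVar × UTm), Relation.ReflTransGen (UStep p)
      (.mkAt a.other ((bindCtx k).plug (.app v w)) ((bindCtx k₂).plug (.val .loop)))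
      (.mkAt a.other ((bindCtx k).plug (.val (.unit u))) ((bindCtx k₂).plug (.val .loop)))) :
    Relation.ReflTransGen (UStep p)
      (.mkAt a ((bindCtx k).plug (.val (remoteCall v w))) ((bindCtx k₂).plug (.val .loop)))
      (.mkAt a ((bindCtx k).plug (.val (.unit u))) ((bindCtx k₂).plug (.val .loop))) := by
  let r : UTm := .val (sendThen (.con .ret [.var (.tm 3)]) (.val .loop))
  have s1 := UStep.comm_at p a (.con .apply [v, w]) (bindCtx k) (bindCtx k₂)
  -- The branch substitutes `v` for `f` and then `w` for `arg`; `hv` says that the second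
  -- substitution leaves `v` alone.
  have l2 : ULocalStep (p.at a.other) (loopCase.subst (.tm 0) (.con .apply [v, w]))
      (.val (.bind (.tm 3) (.app v w) r)) := by
    have := ULocalStep.case (φ := p.at a.other) (k := .apply) (vs := [v, w])
      (brs := .cons .apply [.tm 1, .tm 2]
        (.val (.bind (.tm 3) (.app (.var (.tm 1)) (.var (.tm 2))) r))
        (.cons .ret [.tm 4] (.val (.unit (.var (.tm 4)))) .nil)) rfl rfl
    simpa [UTm.substs, UTm.subst, UVal.subst, UVal.substList, hv, r, loopCase, sendThen,
      Branches.subst] using this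
  have s2 := UStep.local_at l2 (bindCtx k₂) (bindCtx k)
  -- The callee runs under the extra frame that sends `Ret z` and goes back to `loop ()`, while the
  -- caller waits in `loop ()` under `k`.
  have s3 := h (k₂ ++ [(.tm 3, r)]) k
  rw [bindCtx_append_plug, bindCtx_append_plug] at s3
  have l4 : ULocalStep (p.at a.other) (.val (.bind (.tm 3) (.val (.unit u)) r))
      (.val (sendThen (.con .ret [u]) (.val .loop))) := by
    have := ULocalStep.bind (φ := p.at a.other) (x := .tm 3) (v := u) (m := r)
    simpa [UTm.subst, UVal.subst, UVal.substList, r, sendThen] using this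
  have s4 := UStep.local_at l4 (bindCtx k₂) (bindCtx k)
  have s5 := UStep.comm_at p a.other (.con .ret [u]) (bindCtx k₂) (bindCtx k)
  have l6 : ULocalStep (p.at a) (loopCase.subst (.tm 0) (.con .ret [u])) (.val (.unit u)) := by
    have := ULocalStep.case (φ := p.at a) (k := .ret) (vs := [u])
      (brs := .cons .apply [.tm 1, .tm 2]
        (.val (.bind (.tm 3) (.app (.var (.tm 1)) (.var (.tm 2))) r))
        (.cons .ret [.tm 4] (.val (.unit (.var (.tm 4)))) .nil)) rfl rfl
    simpa [UTm.substs, UTm.subst, UVal.subst, UVal.substList, r, loopCase, sendThen,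
      Branches.subst] using this
  have s6 := UStep.local_at l6 (bindCtx k) (bindCtx k₂)
  rw [UConf.mkAt_other, UConf.mkAt_other] at s2 s3 s4 s5
  exact .head s1 (.head s2 (s3.trans (.head s4 (.head s5 (.single s6)))))

/-- The case selects `m` under the wrapper `do x ← [ ]; unit x`. This becomes one more frame, and it
vanishes by one step once `m` has returned `unit u`. -/
theorem simulate_genCall (p : UProgram) {l v w u : UVal} {m : UTm}
    (hm : ∃ m₁ m₂, genCall a l v w = bindUnit (ifClient l m₁ m₂) ∧
      ULocalStep (p.at a) (ifClient l m₁ m₂) m)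
    (k k₂ : List (UVar × UTm))
    (h : ∀ k : List (UVar × UTm), Relation.ReflTransGen (UStep p)
      (.mkAt a ((bindCtx k).plug m) ((bindCtx k₂).plug (.val .loop)))
      (.mkAt a ((bindCtx k).plug (.val (.unit u))) ((bindCtx k₂).plug (.val .loop)))) :
    Relation.ReflTransGen (UStep p)
      (.mkAt a ((bindCtx k).plug (.val (genCall a l v w))) ((bindCtx k₂).plug (.val .loop)))
      (.mkAt a ((bindCtx k).plug (.val (.unit u))) ((bindCtx k₂).plug (.val .loop))) := by
  obtain ⟨m₁, m₂, hgen, hstep⟩ := hm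
  let r : UTm := .val (.unit (.var (.tm 0)))
  have s1 := UStep.local_at hstep (bindCtx (k ++ [(.tm 0, r)])) (bindCtx k₂)
  have s2 := h (k ++ [(.tm 0, r)])
  rw [bindCtx_append_plug] at s1 s2
  rw [bindCtx_append_plug] at s1 s2
  have l3 : ULocalStep (p.at a) (.val (.bind (.tm 0) (.val (.unit u)) r)) (.val (.unit u)) := by
    have := ULocalStep.bind (φ := p.at a) (x := .tm 0) (v := u) (m := r)
    simpa [UTm.subst, UVal.subst, r] using this
  rw [hgen]
  exact .head s1 (s2.tail (UStep.local_at l3 (bindCtx k) (bindCtx k₂)))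

theorem ULocalStep.ifClient_client (φ : UFunMap) (m₁ m₂ : UTm) :
    ULocalStep φ (ifClient (Loc.const .c).comp m₁ m₂) m₁ :=
  ULocalStep.case (vs := []) (xs := []) rfl rfl

theorem ULocalStep.ifClient_server (φ : UFunMap) (m₁ m₂ : UTm) :
    ULocalStep φ (ifClient (Loc.const .s).comp m₁ m₂) m₂ :=
  ULocalStep.case (vs := []) (xs := []) rfl rfl

theorem Typing.comp_subst_eq_self {V W : Val} {A : Ty} {L : Loc}
    (h : Typing D 0 0 [] L (.val V) A) (b : Side) (x : Name) :
    (V.comp b).subst (.tm x) (W.comp b) = V.comp b := by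
  have := h.subst_eq_self (x := x) rfl W
  simp only [Tm.subst, Tm.val.injEq] at this
  rw [← Val.comp_subst, this]

/-- The caller sends values compiled at `a`, the callee computes with values compiled at `a.other`.
Function, argument and result are movable, so the two compilations coincide. -/
theorem simulate_remote (hP : P.WF D) {V W V' U : Val} {A B : Ty}
    (h1 : Typing D 0 0 [] (.const a) (.val V) (.clo (.fn A (.const a.other) (.T B))))
    (h2 : Typing D 0 0 [] (.const a) (.val W) A) (hA : A.Reloc)
    (he : Ev (P.at a.other) (.app V W) V') (hr : RunVal P a.other V' U)
    (ih : ∀ k k₂ : List (UVar × UTm), Relation.ReflTransGen (UStep P.comp)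
      (.mkAt a.other ((bindCtx k).plug (.val (V'.comp a.other))) ((bindCtx k₂).plug (.val .loop)))
      (.mkAt a.other ((bindCtx k).plug (.val (.unit (U.comp a.other))))
        ((bindCtx k₂).plug (.val .loop))))
    (k k₂ : List (UVar × UTm)) :
    Relation.ReflTransGen (UStep P.comp)
      (.mkAt a ((bindCtx k).plug (.val (remoteCall (V.comp a) (W.comp a))))
        ((bindCtx k₂).plug (.val .loop)))
      (.mkAt a ((bindCtx k).plug (.val (.unit (U.comp a)))) ((bindCtx k₂).plug (.val .loop))) := by
  have happ := h1.app_of_remote h2 hA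
  obtain ⟨hU, hB⟩ := hr.typing hP (he.typing hP happ)
  rw [(h1.movable trivial).comp_eq a a.other, (h2.movable hA).comp_eq a a.other,
    (hU.movable hB).comp_eq a a.other]
  exact simulate_remoteCall P.comp (h1.comp_subst_eq_self a.other 2) k k₂ fun k k₂ =>
    (he.simulate hP happ (bindCtx k) (bindCtx k₂)).trans (ih k k₂)

/-- Both continuation lists are arbitrary because a remote call exchanges their roles: the list of
the waiting side becomes that of the running side. -/
theorem RunVal.simulate (hP : P.WF D) {V U : Val} {A : Ty} (hr : RunVal P a V U)
    (h : Typing D 0 0 [] (.const a) (.val V) (.T A)) (k k₂ : List (UVar × UTm)) :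
    Relation.ReflTransGen (UStep P.comp)
      (.mkAt a ((bindCtx k).plug (.val (V.comp a))) ((bindCtx k₂).plug (.val .loop)))
      (.mkAt a ((bindCtx k).plug (.val (.unit (U.comp a)))) ((bindCtx k₂).plug (.val .loop))) := by
  induction hr generalizing A k k₂ with
  | unit => exact .refl
  | @bind a x M N V U V' U' he1 hr1 he2 hr2 ih1 ih2 =>
    cases h with
    | bind h1 h2 =>
      have t1 := he1.typing hP h1
      have t2 := h2.subst_head hP.decomp_ok trivial (hr1.typing hP t1).1
      have s1 := he1.simulate hP h1 (bindCtx (k ++ [(.tm x, N.comp a)])) (bindCtx k₂)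
      have s2 := ih1 t1 (k ++ [(.tm x, N.comp a)]) k₂
      have s3 := he2.simulate hP t2 (bindCtx k) (bindCtx k₂)
      have s4 := ih2 (he2.typing hP t2) k k₂
      have s12 := s1.trans s2
      rw [bindCtx_append_plug, bindCtx_append_plug] at s12
      rw [Tm.comp_subst] at s3
      exact (s12.tail (UStep.local_at .bind (bindCtx k) (bindCtx k₂))).trans (s3.trans s4)
  | req he hr ih =>
    cases h with
    | req h1 h2 hA =>
      exact simulate_remote (a := .c) hP h1 h2 hA he hr
        (ih (he.typing hP (h1.app_of_remote h2 hA))) k k₂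
  | call he hr ih =>
    cases h with
    | call h1 h2 hA =>
      exact simulate_remote (a := .s) hP h1 h2 hA he hr
        (ih (he.typing hP (h1.app_of_remote h2 hA))) k k₂
  | @gen a V W V' U he hr ih =>
    cases h with
    | gen h1 h2 hA =>
      refine simulate_genCall P.comp (m := (Tm.app V W).comp a) ?_ k k₂ fun k =>
        (he.simulate hP (.app h1 h2) (bindCtx k) (bindCtx k₂)).trans
          (ih (he.typing hP (.app h1 h2)) k k₂)
      cases a with
      | c => exact ⟨_, _, rfl, .ifClient_client _ _ _⟩
      | s => exact ⟨_, _, rfl, .ifClient_server _ _ _⟩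
  | genReq hr ih =>
    cases h with
    | gen h1 h2 hA =>
      exact simulate_genCall P.comp ⟨_, _, rfl, .ifClient_server _ _ _⟩ k k₂ fun k =>
        ih (.req h1 h2 hA) k k₂
  | genCall hr ih =>
    cases h with
    | gen h1 h2 hA =>
      exact simulate_genCall P.comp ⟨_, _, rfl, .ifClient_client _ _ _⟩ k k₂ fun k =>
        ih (.call h1 h2 hA) k k₂

end

end LamCS

theorem mainTheorem4 (P : LamCS.Program) (D : LamCS.Decomp) (hP : P.WF D)
    (M : LamCS.Tm) (A : LamCS.Ty) (hM : LamCS.Typing D 0 0 [] (.const .c) M (.T A))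
    (V : LamCS.Val)
    (hred : Relation.ReflTransGen (LamCS.Step P)
      (.client M [] []) (.client (.val (.unit V)) [] [])) :
    Relation.ReflTransGen (LamCS.UStep P.comp)
      ⟨M.comp .c, .val .loop⟩ ⟨(LamCS.Tm.val (.unit V)).comp .c, .val .loop⟩ := by
  obtain ⟨V', he, hr⟩ := LamCS.run_of_steps hP hM hred
  -- The empty context is `bindCtx []` by definition, so the evaluation and the run compose.
  exact (he.simulate hP hM (.ofLet .hole) (.ofLet .hole)).trans
    (hr.simulate hP (he.typing hP hM) [] [])
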